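/- **Setting.** Manifolds are smooth, finite-dimensional, Hausdorff, second countable and without boundary. Let $(\tilde M,\tilde\omega)$ be a symplectic manifold with a smooth action of a compact Lie group $G$ by symplectomorphisms. For $\xi\in\mathfrak g$ let $X_\xi$ be the vector field with $X_\xi(x)=\frac{d}{dt}\big|_{t=0}\exp(t\xi)\cdot x$. The action is *hamiltonian* with momentum map $\mu\colon\tilde M\to\mathfrak g^*$ if $\mu$ is smooth, $G$-equivariant for the coadjoint action, that is $\langle\mu(g\cdot x),\xi\rangle=\langle\mu(x),\mathrm{Ad}_{g^{-1}}\xi\rangle$, and $\iota_{X_\xi}\tilde\omega=-d\langle\mu,\xi\rangle$ for all $\xi\in\mathfrak g$. The same definition is used for actions on symplectic orbifolds. (Effectiveness of actions is neither assumed nor asserted.) **Lemma.** Let $G$ be a compact Lie group with a hamiltonian action on $(\tilde M,\tilde\omega)$ with momentum map $\mu$. Let $N$ be a closed normal Lie subgroup of $G$, let $i^*\colon\mathfrak g^*\to\mathfrak n^*$ be the adjoint of the inclusion $\mathfrak n\subseteq\mathfrak g$, and put $\mu_N=i^*\circ\mu$. Let $\tilde c\in\mathfrak g^*$ be invariant under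 the coadjoint action of $G$, and suppose that $c=i^*(\tilde c)$ is a regular value of $\mu_N$ and that $N$ acts locally freely (with discrete isotropy groups) on $\mu_N^{-1}(c)$. Let $M=\tilde M/\!/_cN:=\mu_N^{-1}(c)/N$ with projection $q\colon\mu_N^{-1}(c)\to M$. Then: 1. $\mu_N$ is a momentum map for the induced hamiltonian action of $N$ on $\tilde M$. 2. $M$, with its quotient smooth structure, is a symplectic orbifold whose symplectic form $\omega$ satisfies $q^*\omega=\tilde\omega|_{\mu_N^{-1}(c)}$. 3. $\mu_N^{-1}(c)$ is $G$-invariant, and $[g]\cdot q(z)=q(g\cdot z)$ defines an action of $G/N$ on $M$. This action is hamiltonian, with a momentum map $\nu\colon M\to(\mathfrak g/\mathfrak n)^*$ which, viewed as an $N$-invariant function on $\mu_N^{-1}(c)$, is the restriction of $\mu-\tilde c$: for all $z\in\mu_N^{-1}(c)$ and $\xi\in\mathfrak g$, $\langle\nu(q(z)),[\xi]\rangle=\langle\mu(z)-\tilde c,\xi\rangle$. -/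

import Mathlib

open scoped Manifold ContDiff Topology
open Diffeology

noncomputable section

/-! ## Symplectic forms and hamiltonian actions on manifolds

Manifolds are smooth manifolds without boundary modelled on a finite-dimensional real vector
space `E`.  The dual of a (finite-dimensional) Lie algebra is its algebraic dual. -/

section Manifold

variable {E : Type*} [NormedAddCommGroup E] [NormedSpace ℝ E]
  {M : Type*} [TopologicalSpace M] [ChartedSpace E M]

/-- The expression of a `k`-form on `M` in the preferred chart at `x₀` (meaningful on the target of
that chart). -/
def formInChart {k : ℕ} (Ω : ∀ x : M, TangentSpace 𝓘(ℝ, E) x [⋀^Fin k]→L[ℝ] ℝ) (x₀ : M) :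
    E → E [⋀^Fin k]→L[ℝ] ℝ := fun y =>
  (Ω ((extChartAt 𝓘(ℝ, E) x₀).symm y)).compContinuousLinearMap
    (mfderiv 𝓘(ℝ, E) 𝓘(ℝ, E) (extChartAt 𝓘(ℝ, E) x₀).symm y : E →L[ℝ] _)

/-- A symplectic form: a smooth, closed, pointwise nondegenerate 2-form. -/
structure IsSymplecticForm (Ω : ∀ x : M, TangentSpace 𝓘(ℝ, E) x [⋀^Fin 2]→L[ℝ] ℝ) : Prop where
  smooth : ∀ x₀ : M, ContDiffOn ℝ ∞ (formInChart Ω x₀) (extChartAt 𝓘(ℝ, E) x₀).target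
  closed : ∀ x₀ : M, ∀ y ∈ (extChartAt 𝓘(ℝ, E) x₀).target, extDeriv (formInChart Ω x₀) y = 0
  nondegenerate : ∀ (x : M) (v : TangentSpace 𝓘(ℝ, E) x), (∀ w, Ω x ![v, w] = 0) → v = 0

variable {EG : Type*} [NormedAddCommGroup EG] [NormedSpace ℝ EG]
  {G : Type*} [TopologicalSpace G] [ChartedSpace EG G] [Group G]

/-- The adjoint action of `g` on the Lie algebra: the derivative at `1` of `x ↦ g x g⁻¹`. -/
def adjointAction (g : G) :
    GroupLieAlgebra 𝓘(ℝ, EG) G →L[ℝ] GroupLieAlgebra 𝓘(ℝ, EG) G :=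
  (mfderiv 𝓘(ℝ, EG) 𝓘(ℝ, EG) (fun x : G => g * x * g⁻¹) 1 : EG →L[ℝ] EG)

/-- The vector field `X_ξ` on `M` generated by `ξ`: its value at `x` is the derivative at `1` of
`g ↦ g • x`, applied to `ξ`. -/
def generatingField [MulAction G M] (ξ : GroupLieAlgebra 𝓘(ℝ, EG) G) (x : M) :
    TangentSpace 𝓘(ℝ, E) x :=
  (mfderiv 𝓘(ℝ, EG) 𝓘(ℝ, E) (fun g : G => g • x) 1 : EG →L[ℝ] E) ξ

/-- A smooth action of `G` on `(M, Ω)` by symplectomorphisms is hamiltonian with momentum map `μ`: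
`μ` is smooth, equivariant for the coadjoint action, and `ι_{X_ξ} Ω = - d⟨μ, ξ⟩`. -/
structure IsHamiltonianAction [MulAction G M]
    (Ω : ∀ x : M, TangentSpace 𝓘(ℝ, E) x [⋀^Fin 2]→L[ℝ] ℝ)
    (μ : M → Module.Dual ℝ (GroupLieAlgebra 𝓘(ℝ, EG) G)) : Prop where
  smooth_action : ContMDiff (𝓘(ℝ, EG).prod 𝓘(ℝ, E)) 𝓘(ℝ, E) ∞ (fun p : G × M => p.1 • p.2)
  symplectic : ∀ (g : G) (x : M),
    (Ω (g • x)).compContinuousLinearMap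
      (mfderiv 𝓘(ℝ, E) 𝓘(ℝ, E) (fun y : M => g • y) x) = Ω x
  smooth : ∀ ξ, ContMDiff 𝓘(ℝ, E) 𝓘(ℝ, ℝ) ∞ (fun x => μ x ξ)
  equivariant : ∀ (g : G) (x : M) (ξ), μ (g • x) ξ = μ x (adjointAction g⁻¹ ξ)
  momentum : ∀ (ξ) (x : M) (v : TangentSpace 𝓘(ℝ, E) x),
    Ω x ![generatingField ξ x, v] =
      - (mfderiv 𝓘(ℝ, E) 𝓘(ℝ, ℝ) (fun y => μ y ξ) x : E →L[ℝ] ℝ) v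

/-- `c` is a regular value of a map `f` from `M` to the dual of `V`: at every point of the level
the differential of `f` is onto. -/
def IsRegularValue {V : Type*} [AddCommGroup V] [Module ℝ V]
    (f : M → Module.Dual ℝ V) (c : Module.Dual ℝ V) : Prop :=
  ∀ z : M, f z = c → ∀ l : Module.Dual ℝ V, ∃ v : TangentSpace 𝓘(ℝ, E) z,
    ∀ ζ : V, (mfderiv 𝓘(ℝ, E) 𝓘(ℝ, ℝ) (fun x => f x ζ) z : E →L[ℝ] ℝ) v = l ζ

end Manifold

/-! ## Lie subgroups -/

section Subgroup

variable (EN : Type*) [NormedAddCommGroup EN] [NormedSpace ℝ EN]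
  {EG : Type*} [NormedAddCommGroup EG] [NormedSpace ℝ EG]
  {G : Type*} [TopologicalSpace G] [ChartedSpace EG G] [Group G]

/-- `N`, with its given smooth structure (whose topology is the subspace topology), is a closed
Lie subgroup of `G`: it is closed and the inclusion is a smooth immersion. -/
structure IsClosedLieSubgroup (N : Subgroup G) [ChartedSpace EN N] : Prop where
  isClosed : IsClosed (N : Set G)
  smooth : ContMDiff 𝓘(ℝ, EN) 𝓘(ℝ, EG) ∞ (fun n : N => (n : G))
  immersion : ∀ n : N, Function.Injective
    (mfderiv 𝓘(ℝ, EN) 𝓘(ℝ, EG) (fun n : N => (n : G)) n)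

/-- The inclusion `i : 𝔫 → 𝔤`, derivative at `1` of the inclusion of `N` in `G`. -/
def lieInclusion (N : Subgroup G) [ChartedSpace EN N] :
    GroupLieAlgebra 𝓘(ℝ, EN) N →ₗ[ℝ] GroupLieAlgebra 𝓘(ℝ, EG) G :=
  (mfderiv 𝓘(ℝ, EN) 𝓘(ℝ, EG) (fun n : N => (n : G)) 1).toLinearMap

/-- `𝔫` as a subspace of `𝔤`. -/
def lieSubspace (N : Subgroup G) [ChartedSpace EN N] :
    Submodule ℝ (GroupLieAlgebra 𝓘(ℝ, EG) G) :=
  LinearMap.range (lieInclusion EN N)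

/-- The Lie algebra `𝔤 / 𝔫` of `G / N` (as a vector space). -/
abbrev QuotientLieAlgebra (N : Subgroup G) [ChartedSpace EN N] : Type _ :=
  GroupLieAlgebra 𝓘(ℝ, EG) G ⧸ lieSubspace (EG := EG) EN N

/-- The projection `i^* : 𝔤^* → 𝔫^*`, adjoint to the inclusion. -/
def dualRestrict (N : Subgroup G) [ChartedSpace EN N] :
    Module.Dual ℝ (GroupLieAlgebra 𝓘(ℝ, EG) G) →ₗ[ℝ]
      Module.Dual ℝ (GroupLieAlgebra 𝓘(ℝ, EN) N) :=
  (lieInclusion EN N).dualMap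

end Subgroup

/-! ## Smooth structures on quotients

Quotients of manifolds (in particular `G / N` and the orbifold `μ_N⁻¹(c) / N`) carry their quotient
diffeology: the smooth maps from `ℝⁿ` into a quotient are those which locally lift to smooth
maps. -/

/-- The standard `ℝⁿ`. -/
abbrev Eucl (n : ℕ) : Type := EuclideanSpace ℝ (Fin n)

/-- A smooth map into a given neighbourhood of `x` which is the identity near `x`. -/
theorem exists_smooth_localization {n : ℕ} {u : Set (Eucl n)} (hu : IsOpen u) {x : Eucl n}
    (hx : x ∈ u) : ∃ ρ : Eucl n → Eucl n, ContDiff ℝ ∞ ρ ∧ (∀ y, ρ y ∈ u) ∧ ρ =ᶠ[𝓝 x] id := by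
  obtain ⟨r, hr, hru⟩ := Metric.isOpen_iff.1 hu x hx
  let b : ContDiffBump x := ⟨r / 4, r / 2, by positivity, by linarith⟩
  refine ⟨fun y => x + b y • (y - x), ?_, fun y => hru ?_, ?_⟩
  · exact contDiff_const.add (b.contDiff.smul (contDiff_id.sub contDiff_const))
  · rw [mem_ball_iff_norm, add_sub_cancel_left, norm_smul, Real.norm_of_nonneg b.nonneg]
    by_cases hy : dist y x < r / 2
    · have h1 := b.le_one (x := y)
      rw [dist_eq_norm] at hy
      have := mul_le_mul h1 le_rfl (norm_nonneg (y - x)) zero_le_one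
      linarith
    · rw [b.zero_of_le_dist (not_lt.1 hy)]
      simpa using hr
  · filter_upwards [b.eventuallyEq_one] with y hy
    simp only [hy, Pi.one_apply, one_smul, id]
    abel

/-- The diffeology of a manifold: the plots are the smooth maps. -/
abbrev manifoldDiffeology (E : Type*) [NormedAddCommGroup E] [NormedSpace ℝ E]
    (M : Type*) [TopologicalSpace M] [ChartedSpace E M] : DiffeologicalSpace M where
  plots n := {p | ContMDiff 𝓘(ℝ, Eucl n) 𝓘(ℝ, E) ∞ p}
  constant_plots _ := contMDiff_const
  plot_reparam hp hf := ContMDiff.comp hp hf.contMDiff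
  locality {n p} hp x := by
    obtain ⟨u, hu, hxu, h⟩ := hp x
    obtain ⟨ρ, hρ, hρu, hρx⟩ := exists_smooth_localization hu hxu
    have h1 : ContMDiff 𝓘(ℝ, Eucl n) 𝓘(ℝ, E) ∞ (p ∘ ρ) := h hρu hρ
    refine (h1 x).congr_of_eventuallyEq ?_
    filter_upwards [hρx] with y hy
    simp [hy]

/-- The subspace diffeology. -/
abbrev subspaceDiffeology {Y : Type*} (d : DiffeologicalSpace Y) (S : Set Y) :
    DiffeologicalSpace S where
  plots n := {p | (fun t => (p t : Y)) ∈ d.plots n}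
  constant_plots x := d.constant_plots (x : Y)
  plot_reparam hp hf := d.plot_reparam hp hf
  locality hp := d.locality hp

/-- The quotient diffeology of a surjection `π : Y → X`: a map is a plot of `X` if near every point
it is the composite of `π` and a plot of `Y`. -/
abbrev quotientDiffeology {Y X : Type*} (d : DiffeologicalSpace Y) (π : Y → X)
    (hπ : Function.Surjective π) : DiffeologicalSpace X where
  plots n := {p | ∀ t, ∃ P ∈ d.plots n, π ∘ P =ᶠ[𝓝 t] p}
  constant_plots x _ := by
    obtain ⟨y, rfl⟩ := hπ x
    exact ⟨fun _ => y, d.constant_plots y, Filter.EventuallyEq.rfl⟩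
  plot_reparam {n m p f} hp hf t := by
    obtain ⟨P, hP, h⟩ := hp (f t)
    exact ⟨P ∘ f, d.plot_reparam hP hf, h.comp_tendsto hf.continuous.continuousAt⟩
  locality {n p} hp x := by
    obtain ⟨u, hu, hxu, h⟩ := hp x
    obtain ⟨ρ, hρ, hρu, hρx⟩ := exists_smooth_localization hu hxu
    obtain ⟨P, hP, hPx⟩ := h hρu hρ x
    refine ⟨P, hP, hPx.trans ?_⟩
    filter_upwards [hρx] with y hy
    simp [hy]

/-- A differential `k`-form on a diffeological space: a smooth form on `ℝⁿ` for every plot,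
compatible with smooth reparametrizations. -/
structure DiffForm (k : ℕ) (X : Type*) [DiffeologicalSpace X] where
  eval : ∀ {n : ℕ} (p : Eucl n → X), IsPlot p → Eucl n → Eucl n [⋀^Fin k]→L[ℝ] ℝ
  smooth : ∀ {n : ℕ} (p : Eucl n → X) (hp : IsPlot p), ContDiff ℝ ∞ (eval p hp)
  pullback : ∀ {m n : ℕ} (p : Eucl n → X) (hp : IsPlot p) (f : Eucl m → Eucl n)
    (hf : ContDiff ℝ ∞ f) (t : Eucl m),
    eval (p ∘ f) (isPlot_reparam hp hf) t =
      (eval p hp (f t)).compContinuousLinearMap (fderiv ℝ f t)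

/-! ## Symplectic orbifolds -/

/-- `φ : ℝᵈ → X` is an orbifold chart with finite group `Γ ⊆ GL(d, ℝ)`: it induces a diffeomorphism
from `ℝᵈ / Γ` onto an open subspace of `X`. (The last condition says that smooth maps to `X` lift to
`ℝᵈ` near any point sent into the image of `φ`; it implies that this image is open.) -/
structure IsOrbifoldChart {X : Type*} [DiffeologicalSpace X] {d : ℕ}
    (Γ : Subgroup (Eucl d ≃L[ℝ] Eucl d)) (φ : Eucl d → X) : Prop where
  finite : Finite Γ
  isPlot : IsPlot φ
  fiber : ∀ u v, φ u = φ v ↔ ∃ γ ∈ Γ, γ u = v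
  lift : ∀ {n : ℕ} (p : Eucl n → X), IsPlot p → ∀ t, p t ∈ Set.range φ →
    ∃ f : Eucl n → Eucl d, ContDiff ℝ ∞ f ∧ φ ∘ f =ᶠ[𝓝 t] p

/-- `(X, Ω)` is a symplectic orbifold: `X` is Hausdorff and second countable, `Ω` is closed, and
around every point there is an orbifold chart in which `Ω` is nondegenerate. -/
structure IsSymplecticOrbifold {X : Type*} [DiffeologicalSpace X] (Ω : DiffForm 2 X) : Prop where
  t2 : @T2Space X DiffeologicalSpace.dTopology
  secondCountable : @SecondCountableTopology X DiffeologicalSpace.dTopology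
  closed : ∀ {n : ℕ} (p : Eucl n → X) (hp : IsPlot p) (t : Eucl n), extDeriv (Ω.eval p hp) t = 0
  exists_chart : ∀ x : X, ∃ (d : ℕ) (Γ : Subgroup (Eucl d ≃L[ℝ] Eucl d)) (φ : Eucl d → X)
    (hφ : IsOrbifoldChart Γ φ), x ∈ Set.range φ ∧
      ∀ u v : Eucl d, (∀ w, Ω.eval φ hφ.isPlot u ![v, w] = 0) → v = 0

/-! ## The symplectic quotient -/

section Quotient

variable {EN : Type*} [NormedAddCommGroup EN] [NormedSpace ℝ EN]
  {G : Type*} [TopologicalSpace G] [Group G]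
  (E : Type*) [NormedAddCommGroup E] [NormedSpace ℝ E]
  {M : Type*} [TopologicalSpace M] [ChartedSpace E M] [MulAction G M]
  (N : Subgroup G) [ChartedSpace EN N]
  (μN : M → Module.Dual ℝ (GroupLieAlgebra 𝓘(ℝ, EN) N))
  (c : Module.Dual ℝ (GroupLieAlgebra 𝓘(ℝ, EN) N))

variable {N} in
/-- The momentum level `μ_N⁻¹(c)`. -/
def momentumLevel : Set M := {z | μN z = c}

/-- The symplectic quotient `M //_c N = μ_N⁻¹(c) / N`, the space of `N`-orbits in the level.
(The model space `E` is recorded because it enters the smooth structure.) -/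
def SymplecticQuotient {EN : Type*} [NormedAddCommGroup EN] [NormedSpace ℝ EN]
    {G : Type*} [TopologicalSpace G] [Group G]
    (E : Type*) [NormedAddCommGroup E]
    {M : Type*} [TopologicalSpace M] [ChartedSpace E M] [MulAction G M]
    (N : Subgroup G) [ChartedSpace EN N]
    (μN : M → Module.Dual ℝ (GroupLieAlgebra 𝓘(ℝ, EN) N))
    (c : Module.Dual ℝ (GroupLieAlgebra 𝓘(ℝ, EN) N)) : Type _ :=
  Quotient ((MulAction.orbitRel N M).comap (Subtype.val : momentumLevel μN c → M))

/-- The projection `q : μ_N⁻¹(c) → M //_c N`. -/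
def symplecticQuotientMk (z : momentumLevel μN c) : SymplecticQuotient E N μN c :=
  Quotient.mk _ z

/-- The level has the smooth structure of a subspace of `M`, and the symplectic quotient has the
quotient smooth structure. -/
instance instDiffeologicalSpaceSymplecticQuotient :
    DiffeologicalSpace (SymplecticQuotient E N μN c) :=
  quotientDiffeology (subspaceDiffeology (manifoldDiffeology E M) (momentumLevel μN c))
    (symplecticQuotientMk E N μN c) Quotient.mk_surjective

/-- A smooth map to `M` with values in the level gives a plot of the symplectic quotient. -/
theorem isPlot_symplecticQuotientMk {n : ℕ} {P : Eucl n → momentumLevel μN c}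
    (hP : ContMDiff 𝓘(ℝ, Eucl n) 𝓘(ℝ, E) ∞ (fun t => (P t : M))) :
    IsPlot (fun t => symplecticQuotientMk E N μN c (P t)) :=
  fun _ => ⟨P, hP, Filter.EventuallyEq.rfl⟩

/-- `Ωc` is the reduced form of `Ω`: the pullbacks of `Ωc` and of `Ω` to the level coincide,
i.e. they give the same form on `ℝⁿ` for every smooth map from `ℝⁿ` to the level. -/
def IsReducedForm (Ω : ∀ x : M, TangentSpace 𝓘(ℝ, E) x [⋀^Fin 2]→L[ℝ] ℝ)
    (Ωc : DiffForm 2 (SymplecticQuotient E N μN c)) : Prop :=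
  ∀ {n : ℕ} (P : Eucl n → momentumLevel μN c)
    (hP : ContMDiff 𝓘(ℝ, Eucl n) 𝓘(ℝ, E) ∞ (fun t => (P t : M))) (t : Eucl n),
    Ωc.eval _ (isPlot_symplecticQuotientMk E N μN c hP) t =
      (Ω (P t)).compContinuousLinearMap
        (mfderiv 𝓘(ℝ, Eucl n) 𝓘(ℝ, E) (fun s => (P s : M)) t : Eucl n →L[ℝ] _)

end Quotient

/-! ## Hamiltonian actions of `G / N` -/

/-- The point `(a, u)` of `ℝ × ℝⁿ = ℝⁿ⁺¹`. -/
def euclCons {n : ℕ} (a : ℝ) (u : Eucl n) : Eucl (n + 1) :=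
  WithLp.toLp 2 (Fin.cons a (fun i => u i) : Fin (n + 1) → ℝ)

/-- The component in `ℝⁿ` of a point of `ℝ × ℝⁿ = ℝⁿ⁺¹`. -/
def euclTail {n : ℕ} (y : Eucl (n + 1)) : Eucl n :=
  WithLp.toLp 2 (fun i : Fin n => y i.succ)

section HamiltonianQuotient

variable (EN : Type*) [NormedAddCommGroup EN] [NormedSpace ℝ EN]
  {EG : Type*} [NormedAddCommGroup EG] [NormedSpace ℝ EG]
  {G : Type*} [TopologicalSpace G] [ChartedSpace EG G] [Group G]
  (N : Subgroup G) [N.Normal] [ChartedSpace EN N]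

/-- The quotient smooth structure of the group `G / N`. -/
abbrev quotientGroupDiffeology (EG : Type*) [NormedAddCommGroup EG] [NormedSpace ℝ EG]
    [ChartedSpace EG G] : DiffeologicalSpace (G ⧸ N) :=
  quotientDiffeology (manifoldDiffeology EG G) (QuotientGroup.mk : G → G ⧸ N)
    QuotientGroup.mk_surjective

/-- An action of `G / N` on a space `X` with a 2-form `Ω` is hamiltonian with momentum map
`ν : X → (𝔤 / 𝔫)^*`: the action is smooth and preserves `Ω`, `ν` is smooth and equivariant for the
coadjoint action, and `ι_{X_[ξ]} Ω = - d⟨ν, [ξ]⟩` for all `[ξ]` in `𝔤 / 𝔫`.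

The contraction of `Ω` with the vector field `X_[ξ]` generated by `[ξ]`, along a plot `p`, is
computed by moving `p` by a curve `γ` through `1` in `G` with velocity `ξ` (such as the
one-parameter subgroup of `ξ`): it is `v ↦ Ω(∂/∂s, v)` at `s = 0` for the plot
`(s, u) ↦ [γ s] • p u`. -/
structure IsHamiltonianQuotientAction {X : Type*} [DiffeologicalSpace X] [MulAction (G ⧸ N) X]
    (Ω : DiffForm 2 X) (ν : X → Module.Dual ℝ (QuotientLieAlgebra (EG := EG) EN N)) : Prop where
  smooth_action : ∀ {n : ℕ} (a : Eucl n → G ⧸ N) (p : Eucl n → X),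
    @IsPlot _ (quotientGroupDiffeology N EG) n a → IsPlot p → IsPlot (fun t => a t • p t)
  symplectic : ∀ (k : G ⧸ N) {n : ℕ} (p : Eucl n → X) (hp : IsPlot p),
    ∃ hkp : IsPlot (fun t => k • p t), Ω.eval _ hkp = Ω.eval p hp
  smooth : ∀ η, DSmooth (fun x => ν x η)
  equivariant : ∀ (g : G) (x : X) (ξ : GroupLieAlgebra 𝓘(ℝ, EG) G),
    ν ((g : G ⧸ N) • x) (Submodule.Quotient.mk ξ) =
      ν x (Submodule.Quotient.mk (adjointAction g⁻¹ ξ))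
  momentum : ∀ (ξ : GroupLieAlgebra 𝓘(ℝ, EG) G) (γ : ℝ → G),
    ContMDiff 𝓘(ℝ, ℝ) 𝓘(ℝ, EG) ∞ γ → γ 0 = 1 →
    (mfderiv 𝓘(ℝ, ℝ) 𝓘(ℝ, EG) γ 0 : ℝ →L[ℝ] EG) 1 = ξ →
    ∀ {n : ℕ} (p : Eucl n → X), IsPlot p →
    ∃ hP : IsPlot (fun y : Eucl (n + 1) => ((γ (y 0) : G) : G ⧸ N) • p (euclTail y)),
      ∀ u v : Eucl n,
        Ω.eval _ hP (euclCons 0 u) ![euclCons 1 0, euclCons 0 v] =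
          - fderiv ℝ (fun t => ν (p t) (Submodule.Quotient.mk ξ)) u v

end HamiltonianQuotient

end

/-!
The theorem is symplectic reduction in stages, carried out on the level `L = μ_N⁻¹(c)`, without ever
making `L` a manifold: smooth maps into `L / N` are maps that locally lift to smooth maps into `M`
with values in `L`, and all statements are reduced to statements on such lifts.

*The reduced form.* Its value on a smooth map `p` to `L / N` is the pullback of `Ω` along a local
lift of `p`. The point is that two lifts `P`, `P'` of the same map give the same pullback
(`IsHamiltonianAction.pull_eq_pull_of_orbit`). If `P' = h • P` with `h` smooth, this holds because
the orbit directions lie in the kernel of `Ω` restricted to `L`, by the momentum equation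
(`IsHamiltonianAction.pull_smul`). In general `P` and `P'` need not be related by a smooth family of
group elements, but in a slice they differ pointwise by elements of a finite group, and hence on a
dense open set locally by a fixed element; the two pullbacks, being continuous, are equal.

*Slices.* At a point `z` of `L` the stabilizer is discrete and compact, hence finite. Averaging a
chart over it gives coordinates in which it acts linearly, and correcting the chart beforehand by a
right inverse of the differential `D` of the momentum map makes the momentum map affine
(`IsHamiltonianAction.exists_linearizing_parametrization`). An invariant complement `W` of the
tangent space of the orbit gives a tube around the orbit (`IsHamiltonianAction.exists_tube`), in
which `L` is `W ∩ ker D`; compactness of `N` ensures that orbits meet a small piece of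
`W ∩ ker D` in orbits of the stabilizer (`IsHamiltonianAction.exists_slice`). Slices are the
orbifold charts. They are symplectic: a vector orthogonal to the slice within the level is orthogonal to
`ker dμ_N`, hence tangent to the orbit, by linear algebra and the momentum equation
(`IsSlice.pull_nondegenerate`).

*Topology.* By means of slices, the projection `L → L / N` is seen to be an open quotient map for
the topology of the quotient smooth structure. Hence `L / N` is second countable, and it is
Hausdorff because the orbit relation of a compact group is closed.

*The action of `G / N`.* The Lie algebra `𝔫` is invariant under the adjoint action of `G`, so that
`L` is invariant under `G`. The form is preserved because it is preserved on lifts. The function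
`μ - c'` vanishes on `𝔫` along `L`, and is `N`-invariant there because `Ad n - 1` maps `𝔤` into `𝔫`
for `n ∈ N` (`IsClosedLieSubgroup.adj_sub_self`); so it descends to `L / N` with values in
`(𝔤 / 𝔫)^*`. The momentum equation for it is that of `μ`, evaluated on a lift.
-/

noncomputable section

/-! ### Derivatives of maps between manifolds and the inverse function theorem -/

section Calculus

variable {E₁ : Type*} [NormedAddCommGroup E₁] [NormedSpace ℝ E₁]
  {M₁ : Type*} [TopologicalSpace M₁] [ChartedSpace E₁ M₁]
  {E₂ : Type*} [NormedAddCommGroup E₂] [NormedSpace ℝ E₂]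
  {M₂ : Type*} [TopologicalSpace M₂] [ChartedSpace E₂ M₂]
  {E₃ : Type*} [NormedAddCommGroup E₃] [NormedSpace ℝ E₃]
  {M₃ : Type*} [TopologicalSpace M₃] [ChartedSpace E₃ M₃]

variable (E₁ E₂) in
/-- The derivative of a map between manifolds, as a linear map between the model spaces (to which
the tangent spaces are definitionally equal). -/
def tder (f : M₁ → M₂) (x : M₁) : E₁ →L[ℝ] E₂ :=
  (mfderiv 𝓘(ℝ, E₁) 𝓘(ℝ, E₂) f x : E₁ →L[ℝ] E₂)

theorem tder_eq_fderiv (f : E₁ → E₂) (x : E₁) : tder E₁ E₂ f x = fderiv ℝ f x :=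
  mfderiv_eq_fderiv

theorem tder_congr {f g : M₁ → M₂} {x : M₁} (h : f =ᶠ[𝓝 x] g) :
    tder E₁ E₂ f x = tder E₁ E₂ g x :=
  h.mfderiv_eq

theorem tder_comp {g : M₂ → M₃} {f : M₁ → M₂} {x : M₁}
    (hg : MDifferentiableAt 𝓘(ℝ, E₂) 𝓘(ℝ, E₃) g (f x))
    (hf : MDifferentiableAt 𝓘(ℝ, E₁) 𝓘(ℝ, E₂) f x) :
    tder E₁ E₃ (fun y => g (f y)) x = (tder E₂ E₃ g (f x)).comp (tder E₁ E₂ f x) :=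
  mfderiv_comp x hg hf

theorem tder_comp_apply {g : M₂ → M₃} {f : M₁ → M₂} {x : M₁}
    (hg : MDifferentiableAt 𝓘(ℝ, E₂) 𝓘(ℝ, E₃) g (f x))
    (hf : MDifferentiableAt 𝓘(ℝ, E₁) 𝓘(ℝ, E₂) f x) (v : E₁) :
    tder E₁ E₃ (fun y => g (f y)) x v = tder E₂ E₃ g (f x) (tder E₁ E₂ f x v) := by
  rw [tder_comp hg hf]; rfl

theorem tder_const (c : M₂) (x : M₁) : tder E₁ E₂ (fun _ : M₁ => c) x = 0 :=
  mfderiv_const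

theorem tder_id (x : M₁) : tder E₁ E₁ (fun y : M₁ => y) x = ContinuousLinearMap.id ℝ E₁ :=
  mfderiv_id

theorem tder_clm (L : E₁ →L[ℝ] E₂) (x : E₁) : tder E₁ E₂ (fun y => L y) x = L := by
  rw [tder_eq_fderiv]; exact L.fderiv

/-- The chain rule for a map of two variables. -/
theorem tder_comp₂ {F : M₁ × M₂ → M₃} {E₀ : Type*} [NormedAddCommGroup E₀] [NormedSpace ℝ E₀]
    {M₀ : Type*} [TopologicalSpace M₀] [ChartedSpace E₀ M₀] {a : M₀ → M₁} {b : M₀ → M₂} {x : M₀}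
    (hF : MDifferentiableAt (𝓘(ℝ, E₁).prod 𝓘(ℝ, E₂)) 𝓘(ℝ, E₃) F (a x, b x))
    (ha : MDifferentiableAt 𝓘(ℝ, E₀) 𝓘(ℝ, E₁) a x)
    (hb : MDifferentiableAt 𝓘(ℝ, E₀) 𝓘(ℝ, E₂) b x) (v : E₀) :
    tder E₀ E₃ (fun y => F (a y, b y)) x v =
      tder E₁ E₃ (fun m => F (m, b x)) (a x) (tder E₀ E₁ a x v) +
        tder E₂ E₃ (fun m => F (a x, m)) (b x) (tder E₀ E₂ b x v) := by
  have h1 := mfderiv_comp x hF (ha.prodMk hb)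
  have h2 := mfderiv_prodMk ha hb
  have h3 : tder E₀ E₃ (fun y => F (a y, b y)) x v =
      mfderiv (𝓘(ℝ, E₁).prod 𝓘(ℝ, E₂)) 𝓘(ℝ, E₃) F (a x, b x)
        (tder E₀ E₁ a x v, tder E₀ E₂ b x v) := by
    have h4 := congrArg (fun L => L v) h1
    rw [h2] at h4
    exact h4
  rw [h3]
  exact mfderiv_prod_eq_add_apply hF

variable [FiniteDimensional ℝ E₁] [IsManifold 𝓘(ℝ, E₁) ∞ M₁] [IsManifold 𝓘(ℝ, E₂) ∞ M₂]

/-- The inverse function theorem in vector spaces, with a smooth inverse on a whole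
neighbourhood. -/
theorem exists_local_inverse_of_fderiv_bijective {f : E₁ → E₂} {x : E₁}
    (hf : ∀ᶠ y in 𝓝 x, ContDiffAt ℝ ∞ f y) (hb : Function.Bijective (fderiv ℝ f x)) :
    ∃ g : E₂ → E₁, g (f x) = x ∧ (∀ᶠ y in 𝓝 (f x), ContDiffAt ℝ ∞ g y) ∧
      (∀ᶠ y in 𝓝 (f x), f (g y) = y) ∧ ∀ᶠ y in 𝓝 x, g (f y) = y := by
  let L : E₁ ≃L[ℝ] E₂ :=
    (LinearEquiv.ofBijective (fderiv ℝ f x).toLinearMap hb).toContinuousLinearEquiv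
  have hL : (L : E₁ →L[ℝ] E₂) = fderiv ℝ f x := by ext v; rfl
  have hfx : ContDiffAt ℝ ∞ f x := hf.self_of_nhds
  have hd : HasFDerivAt f (L : E₁ →L[ℝ] E₂) x := by
    rw [hL]; exact (hfx.differentiableAt (by simp)).hasFDerivAt
  let e := hfx.toOpenPartialHomeomorph f hd (by simp)
  have hxs : x ∈ e.source := hfx.mem_toOpenPartialHomeomorph_source hd (by simp)
  have hxt : f x ∈ e.target := hfx.image_mem_toOpenPartialHomeomorph_target hd (by simp)
  have hef : ∀ y, e y = f y := fun y => rfl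
  have hgx : e.symm (f x) = x := e.left_inv hxs
  refine ⟨e.symm, hgx, ?_, ?_, ?_⟩
  · have hinv : ∀ᶠ y in 𝓝 x, (fderiv ℝ f y).IsInvertible := by
      have hc : ContinuousAt (fderiv ℝ f) x := (hfx.fderiv_right (m := 0) (by simp)).continuousAt
      have := hc.eventually_mem (hL ▸ ContinuousLinearEquiv.nhds L)
      filter_upwards [this] with y hy
      obtain ⟨K, hK⟩ := hy
      exact ⟨K, hK⟩
    have hc : Filter.Tendsto e.symm (𝓝 (f x)) (𝓝 x) := by
      have := e.symm.continuousAt (x := f x) hxt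
      rwa [ContinuousAt, hgx] at this
    filter_upwards [hc.eventually (hinv.and hf), e.open_target.mem_nhds hxt] with y hy hyt
    obtain ⟨⟨K, hK⟩, hs⟩ := hy
    exact e.contDiffAt_symm (f₀' := K) hyt
      (by rw [hK]; exact (hs.differentiableAt (by simp)).hasFDerivAt) hs
  · filter_upwards [e.open_target.mem_nhds hxt] with y hy using e.right_inv hy
  · filter_upwards [e.open_source.mem_nhds hxs] with y hy using e.left_inv hy

/-- The inverse function theorem on manifolds. -/
theorem exists_local_inverse_of_tder_bijective {f : M₁ → M₂} {x : M₁}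
    (hf : ∀ᶠ y in 𝓝 x, ContMDiffAt 𝓘(ℝ, E₁) 𝓘(ℝ, E₂) ∞ f y)
    (hb : Function.Bijective (tder E₁ E₂ f x)) :
    ∃ g : M₂ → M₁, g (f x) = x ∧
      (∀ᶠ y in 𝓝 (f x), ContMDiffAt 𝓘(ℝ, E₂) 𝓘(ℝ, E₁) ∞ g y) ∧
      (∀ᶠ y in 𝓝 (f x), f (g y) = y) ∧ ∀ᶠ y in 𝓝 x, g (f y) = y := by
  set φ := extChartAt 𝓘(ℝ, E₁) x with hφ
  set ψ := extChartAt 𝓘(ℝ, E₂) (f x) with hψ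
  have hxs : x ∈ φ.source := mem_extChartAt_source x
  have hys : f x ∈ ψ.source := mem_extChartAt_source (f x)
  have hφx : φ.symm (φ x) = x := φ.left_inv hxs
  have hφc : Filter.Tendsto φ.symm (𝓝 (φ x)) (𝓝 x) := by
    have := continuousAt_extChartAt_symm (I := 𝓘(ℝ, E₁)) x
    rwa [ContinuousAt, ← hφ, hφx] at this
  have hfx := hf.self_of_nhds
  have hfc := hfx.continuousAt
  have hφs : ∀ y ∈ φ.target, ContMDiffAt 𝓘(ℝ, E₁) 𝓘(ℝ, E₁) ∞ φ.symm y := fun y hy =>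
    (contMDiffOn_extChartAt_symm x).contMDiffAt ((isOpen_extChartAt_target x).mem_nhds hy)
  have hψs : ∀ y ∈ ψ.target, ContMDiffAt 𝓘(ℝ, E₂) 𝓘(ℝ, E₂) ∞ ψ.symm y := fun y hy =>
    (contMDiffOn_extChartAt_symm (f x)).contMDiffAt ((isOpen_extChartAt_target (f x)).mem_nhds hy)
  have hφ' : ∀ y ∈ φ.source, ContMDiffAt 𝓘(ℝ, E₁) 𝓘(ℝ, E₁) ∞ φ y := fun y hy =>
    contMDiffAt_extChartAt' (by simpa [hφ] using hy)
  have hψ' : ∀ y ∈ ψ.source, ContMDiffAt 𝓘(ℝ, E₂) 𝓘(ℝ, E₂) ∞ ψ y := fun y hy =>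
    contMDiffAt_extChartAt' (by simpa [hψ] using hy)
  have hxt : φ x ∈ φ.target := φ.map_source hxs
  have hyt : ψ (f x) ∈ ψ.target := ψ.map_source hys
  -- the map in charts
  let F : E₁ → E₂ := fun u => ψ (f (φ.symm u))
  have hFx : F (φ x) = ψ (f x) := by simp only [F, hφx]
  have hF : ∀ᶠ u in 𝓝 (φ x), ContDiffAt ℝ ∞ F u := by
    filter_upwards [hφc.eventually hf, (isOpen_extChartAt_target x).mem_nhds hxt,
      (hfc.tendsto.comp hφc).eventually ((isOpen_extChartAt_source (f x)).mem_nhds hys)]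
      with u h1 h2 h3
    rw [← contMDiffAt_iff_contDiffAt]
    exact (hψ' _ h3).comp u (h1.comp u (hφs u h2))
  have hFd : fderiv ℝ F (φ x) =
      (tder E₂ E₂ ψ (f x)).comp ((tder E₁ E₂ f x).comp (tder E₁ E₁ φ.symm (φ x))) := by
    have d1 : MDifferentiableAt 𝓘(ℝ, E₁) 𝓘(ℝ, E₁) φ.symm (φ x) :=
      (hφs _ hxt).mdifferentiableAt (by simp)
    have d2 : MDifferentiableAt 𝓘(ℝ, E₁) 𝓘(ℝ, E₂) f (φ.symm (φ x)) := by
      rw [hφx]; exact hfx.mdifferentiableAt (by simp)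
    have d3 : MDifferentiableAt 𝓘(ℝ, E₂) 𝓘(ℝ, E₂) ψ (f (φ.symm (φ x))) := by
      rw [hφx]; exact (hψ' _ hys).mdifferentiableAt (by simp)
    have e1 := tder_comp (g := ψ) (f := fun u => f (φ.symm u)) (x := φ x) d3 (d2.comp _ d1)
    have e2 := tder_comp (g := f) (f := φ.symm) (x := φ x) d2 d1
    rw [← tder_eq_fderiv, e1, e2, hφx]
  have hbF : Function.Bijective (fderiv ℝ F (φ x)) := by
    have i1 : Function.Bijective (tder E₂ E₂ ψ (f x)) := by
      obtain ⟨K, hK⟩ := isInvertible_mfderiv_extChartAt (I := 𝓘(ℝ, E₂)) (x := f x) hys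
      have hK' := K.bijective
      rw [← ContinuousLinearEquiv.coe_coe, hK] at hK'
      exact hK'
    have i2 : Function.Bijective (tder E₁ E₁ φ.symm (φ x)) := by
      obtain ⟨K, hK⟩ := isInvertible_mfderivWithin_extChartAt_symm (I := 𝓘(ℝ, E₁)) (x := x) hxt
      rw [mfderivWithin_eq_mfderiv] at hK
      · have hK' := K.bijective
        rw [← ContinuousLinearEquiv.coe_coe, hK] at hK'
        exact hK'
      · simp [uniqueMDiffWithinAt_univ]
      · exact (hφs _ hxt).mdifferentiableAt (by simp)
    rw [hFd]
    exact i1.comp (hb.comp i2)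
  obtain ⟨g, g1, g2, g3, g4⟩ := exists_local_inverse_of_fderiv_bijective hF hbF
  rw [hFx] at g1 g2 g3
  have hψc : Filter.Tendsto ψ (𝓝 (f x)) (𝓝 (ψ (f x))) := (hψ' _ hys).continuousAt
  have hgc : Filter.Tendsto (fun y => g (ψ y)) (𝓝 (f x)) (𝓝 (φ x)) := by
    have := g2.self_of_nhds.continuousAt
    rw [ContinuousAt, g1] at this
    exact this.comp hψc
  refine ⟨fun y => φ.symm (g (ψ y)), by simp only [g1, hφx], ?_, ?_, ?_⟩
  · filter_upwards [hψc.eventually g2, (isOpen_extChartAt_source (f x)).mem_nhds hys,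
      hgc.eventually ((isOpen_extChartAt_target x).mem_nhds hxt)] with y h1 h2 h3
    exact (hφs _ h3).comp y (h1.contMDiffAt.comp y (hψ' _ h2))
  · have hfc' : Filter.Tendsto (fun y => f (φ.symm (g (ψ y)))) (𝓝 (f x)) (𝓝 (f x)) :=
      hfc.tendsto.comp (hφc.comp hgc)
    filter_upwards [hψc.eventually g3, (isOpen_extChartAt_source (f x)).mem_nhds hys,
      hfc'.eventually ((isOpen_extChartAt_source (f x)).mem_nhds hys)] with y h1 h2 h3
    exact ψ.injOn h3 h2 h1
  · have hφc' : Filter.Tendsto φ (𝓝 x) (𝓝 (φ x)) := (hφ' _ hxs).continuousAt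
    filter_upwards [hφc'.eventually g4, (isOpen_extChartAt_source x).mem_nhds hxs] with y h1 h2
    simp only [F, φ.left_inv h2] at h1
    simp only [h1, φ.left_inv h2]

end Calculus

/-! ### Pulling back differential forms to vector spaces -/

section Forms

/-- A family of alternating maps on a finite-dimensional space is smooth if its values on constant
vectors are. -/
theorem contDiffAt_alternatingMap_of_apply {X F : Type*} [NormedAddCommGroup X] [NormedSpace ℝ X]
    [NormedAddCommGroup F] [NormedSpace ℝ F] [FiniteDimensional ℝ F] {k : ℕ}
    {f : X → F [⋀^Fin k]→L[ℝ] ℝ} {x : X}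
    (h : ∀ v : Fin k → F, ContDiffAt ℝ ∞ (fun y => f y v) x) : ContDiffAt ℝ ∞ f x := by
  let b := Module.finBasis ℝ F
  -- the values on the vectors of a basis determine the form, linearly and so smoothly
  let T : (F [⋀^Fin k]→L[ℝ] ℝ) →ₗ[ℝ] ((Fin k → Fin (Module.finrank ℝ F)) → ℝ) :=
    { toFun := fun α s => α (fun i => b (s i))
      map_add' := fun _ _ => rfl
      map_smul' := fun _ _ => rfl }
  have hT : LinearMap.ker T = ⊥ := by
    rw [LinearMap.ker_eq_bot]
    intro α η hαη
    apply ContinuousAlternatingMap.toAlternatingMap_injective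
    refine Module.Basis.ext_alternating b (fun s _ => ?_)
    exact congrFun hαη s
  obtain ⟨S, hS⟩ := T.exists_leftInverse_of_injective hT
  have h1 : f = fun y => S.toContinuousLinearMap (T (f y)) := by
    funext y
    exact (LinearMap.congr_fun hS (f y)).symm
  rw [h1]
  refine S.toContinuousLinearMap.contDiff.contDiffAt.comp x ?_
  rw [contDiffAt_pi]
  exact fun s => h _

theorem ContDiffAt.compContinuousLinearMap_alternating {X F F' : Type*} [NormedAddCommGroup X]
    [NormedSpace ℝ X] [NormedAddCommGroup F] [NormedSpace ℝ F] [NormedAddCommGroup F']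
    [NormedSpace ℝ F'] [FiniteDimensional ℝ F'] {k : ℕ}
    {α : X → F [⋀^Fin k]→L[ℝ] ℝ} {L : X → F' →L[ℝ] F} {x : X}
    (hα : ContDiffAt ℝ ∞ α x) (hL : ContDiffAt ℝ ∞ L x) :
    ContDiffAt ℝ ∞ (fun y => (α y).compContinuousLinearMap (L y)) x := by
  refine contDiffAt_alternatingMap_of_apply fun v => ?_
  have h1 : ContDiffAt ℝ ∞ (fun y => (α y).toContinuousMultilinearMap) x :=
    (ContinuousAlternatingMap.toContinuousMultilinearMapCLM (𝕜 := ℝ) (E := F) (F := ℝ)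
      (ι := Fin k) ℝ).contDiff.contDiffAt.comp x hα
  have h2 : ContDiffAt ℝ ∞ (fun p : (Fin k → F' →L[ℝ] F) ×
      ContinuousMultilinearMap ℝ (fun _ : Fin k => F) ℝ => p.2.compContinuousLinearMap p.1)
      ((fun _ => L x), (α x).toContinuousMultilinearMap) :=
    ContinuousMultilinearMap.cpolynomialAt_uncurry_compContinuousLinearMap.contDiffAt
  have h3 : ContDiffAt ℝ ∞ (fun y => (((fun _ => L y), (α y).toContinuousMultilinearMap) :
      (Fin k → F' →L[ℝ] F) × ContinuousMultilinearMap ℝ (fun _ : Fin k => F) ℝ)) x :=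
    (contDiffAt_pi.2 fun _ => hL).prodMk h1
  exact (ContinuousMultilinearMap.apply ℝ (fun _ : Fin k => F') ℝ v).contDiff.contDiffAt.comp x
    (h2.comp x h3)

variable {E : Type*} [NormedAddCommGroup E] [NormedSpace ℝ E]
  {M : Type*} [TopologicalSpace M] [ChartedSpace E M]
  {F : Type*} [NormedAddCommGroup F] [NormedSpace ℝ F]
  {F' : Type*} [NormedAddCommGroup F'] [NormedSpace ℝ F']

/-- The value at `x` of a form on a manifold, as an alternating map on the model space. -/
def formAt {k : ℕ} (Ω : ∀ x : M, TangentSpace 𝓘(ℝ, E) x [⋀^Fin k]→L[ℝ] ℝ) (x : M) :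
    E [⋀^Fin k]→L[ℝ] ℝ := Ω x

/-- The pullback of a form on a manifold along a map from a vector space. -/
def pull {k : ℕ} (Ω : ∀ x : M, TangentSpace 𝓘(ℝ, E) x [⋀^Fin k]→L[ℝ] ℝ) (P : F → M) (t : F) :
    F [⋀^Fin k]→L[ℝ] ℝ :=
  (formAt Ω (P t)).compContinuousLinearMap (tder F E P t)

variable {k : ℕ} {Ω : ∀ x : M, TangentSpace 𝓘(ℝ, E) x [⋀^Fin k]→L[ℝ] ℝ}

theorem pull_apply (P : F → M) (t : F) (v : Fin k → F) :
    pull Ω P t v = formAt Ω (P t) (fun i => tder F E P t (v i)) := rfl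

theorem pull_pair (Ω : ∀ x : M, TangentSpace 𝓘(ℝ, E) x [⋀^Fin 2]→L[ℝ] ℝ) (P : F → M) (t a b : F) :
    pull Ω P t ![a, b] = formAt Ω (P t) ![tder F E P t a, tder F E P t b] := by
  rw [pull_apply]
  congr 1
  funext i; fin_cases i <;> rfl

theorem pull_congr {P P' : F → M} {t : F} (h : P =ᶠ[𝓝 t] P') : pull Ω P t = pull Ω P' t := by
  unfold pull
  rw [tder_congr h, h.self_of_nhds]

theorem pull_comp {P : F → M} {f : F' → F} {t : F'}
    (hP : MDifferentiableAt 𝓘(ℝ, F) 𝓘(ℝ, E) P (f t)) (hf : DifferentiableAt ℝ f t) :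
    pull Ω (fun s => P (f s)) t = (pull Ω P (f t)).compContinuousLinearMap (fderiv ℝ f t) := by
  unfold pull
  rw [tder_comp hP hf.mdifferentiableAt, tder_eq_fderiv]
  rfl

/-- Near a point, the pullback along `P` is the pullback of the expression of the form in a chart
along the expression of `P` in that chart. -/
theorem pull_eventuallyEq_formInChart [IsManifold 𝓘(ℝ, E) ∞ M] {P : F → M}
    (hP : ContMDiff 𝓘(ℝ, F) 𝓘(ℝ, E) ∞ P) (t : F) :
    pull Ω P =ᶠ[𝓝 t] fun s =>
      (formInChart Ω (P t) (extChartAt 𝓘(ℝ, E) (P t) (P s))).compContinuousLinearMap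
        (fderiv ℝ (fun s => extChartAt 𝓘(ℝ, E) (P t) (P s)) s) := by
  set φ := extChartAt 𝓘(ℝ, E) (P t) with hφ
  have hsrc : ∀ᶠ s in 𝓝 t, P s ∈ φ.source :=
    hP.continuous.continuousAt.eventually_mem (extChartAt_source_mem_nhds (P t))
  filter_upwards [hsrc.eventually_nhds] with s hs
  have hs0 := hs.self_of_nhds
  have h1 : P =ᶠ[𝓝 s] fun s => φ.symm (φ (P s)) := by
    filter_upwards [hs] with y hy using (φ.left_inv hy).symm
  have d1 : MDifferentiableAt 𝓘(ℝ, F) 𝓘(ℝ, E) (fun s => φ (P s)) s :=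
    ((contMDiffAt_extChartAt' (n := ∞) (by simpa [hφ] using hs0)).comp s
      hP.contMDiffAt).mdifferentiableAt (by simp)
  have d2 : MDifferentiableAt 𝓘(ℝ, E) 𝓘(ℝ, E) φ.symm (φ (P s)) :=
    ((contMDiffOn_extChartAt_symm (n := ∞) (P t)).contMDiffAt
      ((isOpen_extChartAt_target (P t)).mem_nhds (φ.map_source hs0))).mdifferentiableAt (by simp)
  rw [pull_congr h1,
    pull_comp (F := E) (P := φ.symm) (f := fun s => φ (P s)) d2 d1.differentiableAt]
  rfl

theorem contDiff_pull [FiniteDimensional ℝ F] [IsManifold 𝓘(ℝ, E) ∞ M] {P : F → M}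
    (hΩ : ∀ x₀ : M, ContDiffOn ℝ ∞ (formInChart Ω x₀) (extChartAt 𝓘(ℝ, E) x₀).target)
    (hP : ContMDiff 𝓘(ℝ, F) 𝓘(ℝ, E) ∞ P) : ContDiff ℝ ∞ (pull Ω P) := by
  rw [contDiff_iff_contDiffAt]
  intro t
  have h0 : ContDiffAt ℝ ∞ (fun s => extChartAt 𝓘(ℝ, E) (P t) (P s)) t := by
    rw [← contMDiffAt_iff_contDiffAt]
    exact contMDiffAt_extChartAt.comp t hP.contMDiffAt
  refine ContDiffAt.congr_of_eventuallyEq ?_ (pull_eventuallyEq_formInChart hP t)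
  refine ContDiffAt.compContinuousLinearMap_alternating ?_ (h0.fderiv_right (by simp))
  exact ((hΩ (P t)).contDiffAt (extChartAt_target_mem_nhds (P t))).comp t h0

/-- The pullback of a closed form is closed. -/
theorem extDeriv_pull [IsManifold 𝓘(ℝ, E) ∞ M] {P : F → M}
    (hΩ : ∀ x₀ : M, ContDiffOn ℝ ∞ (formInChart Ω x₀) (extChartAt 𝓘(ℝ, E) x₀).target)
    (hc : ∀ x₀ : M, ∀ y ∈ (extChartAt 𝓘(ℝ, E) x₀).target, extDeriv (formInChart Ω x₀) y = 0)
    (hP : ContMDiff 𝓘(ℝ, F) 𝓘(ℝ, E) ∞ P) (t : F) : extDeriv (pull Ω P) t = 0 := by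
  have h0 : ContDiffAt ℝ ∞ (fun s => extChartAt 𝓘(ℝ, E) (P t) (P s)) t := by
    rw [← contMDiffAt_iff_contDiffAt]
    exact contMDiffAt_extChartAt.comp t hP.contMDiffAt
  rw [(pull_eventuallyEq_formInChart hP t).extDeriv_eq]
  have h1 := extDeriv_pullback
    (f := fun s => extChartAt 𝓘(ℝ, E) (P t) (P s)) (x := t)
    (((hΩ (P t)).contDiffAt (extChartAt_target_mem_nhds (P t))).differentiableAt (by simp)) h0
    (r := ∞) (by
      rw [minSmoothness_of_isRCLikeNormedField]
      exact WithTop.coe_le_coe.2 (le_top : (2 : ℕ∞) ≤ ⊤))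
  rw [h1, hc _ _ (mem_extChartAt_target (P t))]
  rfl

end Forms

/-! ### Algebra of 2-forms -/

section TwoForm

variable {E : Type*} [NormedAddCommGroup E] [NormedSpace ℝ E] (α : E [⋀^Fin 2]→L[ℝ] ℝ)

theorem twoForm_add_left (u v w : E) : α ![u + v, w] = α ![u, w] + α ![v, w] := by
  have h : ∀ x, Function.update ![u, w] 0 x = ![x, w] := fun x => by
    funext i; fin_cases i <;> rfl
  have := α.toMultilinearMap.map_update_add ![u, w] 0 u v
  rw [h, h, h] at this
  exact this

theorem twoForm_swap (u v : E) : α ![u, v] = - α ![v, u] := by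
  have := α.toAlternatingMap.map_swap ![v, u] (i := 0) (j := 1) (by decide)
  rw [show (![v, u] ∘ Equiv.swap (0 : Fin 2) 1) = ![u, v] by
    funext i; fin_cases i <;> simp] at this
  exact this

theorem twoForm_add_right (u v w : E) : α ![u, v + w] = α ![u, v] + α ![u, w] := by
  rw [twoForm_swap, twoForm_add_left, twoForm_swap α v u, twoForm_swap α w u]; ring

theorem twoForm_ext {α β : E [⋀^Fin 2]→L[ℝ] ℝ} (h : ∀ u v, α ![u, v] = β ![u, v]) : α = β := by
  ext v
  have : v = ![v 0, v 1] := by funext i; fin_cases i <;> rfl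
  rw [this]; exact h _ _

end TwoForm

/-! ### Infinitesimal action and momentum map -/

section Action

variable {EH : Type*} [NormedAddCommGroup EH] [NormedSpace ℝ EH]
  {H : Type*} [TopologicalSpace H] [ChartedSpace EH H] [Group H]
  {E : Type*} [NormedAddCommGroup E] [NormedSpace ℝ E]
  {M : Type*} [TopologicalSpace M] [ChartedSpace E M] [MulAction H M]

variable (EH H E) in
/-- The infinitesimal action at `x`: the linear map `ξ ↦ X_ξ(x)`. -/
def infAction (x : M) : EH →L[ℝ] E := tder EH E (fun g : H => g • x) 1

variable {Ω : ∀ x : M, TangentSpace 𝓘(ℝ, E) x [⋀^Fin 2]→L[ℝ] ℝ}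
  {μ : M → Module.Dual ℝ (GroupLieAlgebra 𝓘(ℝ, EH) H)}

/-- The differential at `x` of the component of `μ` along `ξ`. The argument `ξ` is taken in the
model space of the group, to which the Lie algebra is definitionally equal. -/
def momentDeriv (μ : M → Module.Dual ℝ (GroupLieAlgebra 𝓘(ℝ, EH) H)) (x : M) (ξ : EH) :
    E →L[ℝ] ℝ := tder E ℝ (fun y => μ y ξ) x

theorem IsHamiltonianAction.form_infAction (hμ : IsHamiltonianAction Ω μ) (x : M) (ξ : EH)
    (v : E) : formAt Ω x ![infAction EH H E x ξ, v] = - momentDeriv μ x ξ v :=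
  hμ.momentum ξ x v

theorem IsHamiltonianAction.mdifferentiable_moment (hμ : IsHamiltonianAction Ω μ) (ξ : EH) (x : M) :
    MDifferentiableAt 𝓘(ℝ, E) 𝓘(ℝ, ℝ) (fun y => μ y ξ) x :=
  (hμ.smooth ξ x).mdifferentiableAt (by simp)

theorem IsHamiltonianAction.mdifferentiable_action (hμ : IsHamiltonianAction Ω μ) (p : H × M) :
    MDifferentiableAt (𝓘(ℝ, EH).prod 𝓘(ℝ, E)) 𝓘(ℝ, E) (fun p : H × M => p.1 • p.2) p :=
  (hμ.smooth_action p).mdifferentiableAt (by simp)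

variable {E₀ : Type*} [NormedAddCommGroup E₀] [NormedSpace ℝ E₀]
  {M₀ : Type*} [TopologicalSpace M₀] [ChartedSpace E₀ M₀]

theorem IsHamiltonianAction.contMDiffAt_smul (hμ : IsHamiltonianAction Ω μ) {h : M₀ → H}
    {Q : M₀ → M} {t : M₀} (hh : ContMDiffAt 𝓘(ℝ, E₀) 𝓘(ℝ, EH) ∞ h t)
    (hQ : ContMDiffAt 𝓘(ℝ, E₀) 𝓘(ℝ, E) ∞ Q t) :
    ContMDiffAt 𝓘(ℝ, E₀) 𝓘(ℝ, E) ∞ (fun s => h s • Q s) t :=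
  (hμ.smooth_action (h t, Q t)).comp t (hh.prodMk hQ)

theorem IsHamiltonianAction.contMDiff_const_smul (hμ : IsHamiltonianAction Ω μ) (g : H) :
    ContMDiff 𝓘(ℝ, E) 𝓘(ℝ, E) ∞ (fun x : M => g • x) := fun _ =>
  hμ.contMDiffAt_smul contMDiffAt_const contMDiffAt_id

theorem IsHamiltonianAction.mdifferentiable_const_smul (hμ : IsHamiltonianAction Ω μ) (g : H)
    (x : M) : MDifferentiableAt 𝓘(ℝ, E) 𝓘(ℝ, E) (fun x : M => g • x) x :=
  (hμ.contMDiff_const_smul g x).mdifferentiableAt (by simp)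

theorem IsHamiltonianAction.mdifferentiable_smul_const (hμ : IsHamiltonianAction Ω μ) (g : H)
    (x : M) : MDifferentiableAt 𝓘(ℝ, EH) 𝓘(ℝ, E) (fun g : H => g • x) g :=
  (hμ.contMDiffAt_smul contMDiffAt_id contMDiffAt_const).mdifferentiableAt (by simp)

theorem IsHamiltonianAction.continuousSMul (hμ : IsHamiltonianAction Ω μ) :
    ContinuousSMul H M := ⟨hμ.smooth_action.continuous⟩

/-- The derivative of `s ↦ h s • Q s` where `h` takes the value `1`. -/
theorem IsHamiltonianAction.tder_smul_of_eq_one (hμ : IsHamiltonianAction Ω μ) {h : M₀ → H}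
    {Q : M₀ → M} {t : M₀} (hh : MDifferentiableAt 𝓘(ℝ, E₀) 𝓘(ℝ, EH) h t)
    (hQ : MDifferentiableAt 𝓘(ℝ, E₀) 𝓘(ℝ, E) Q t) (h1 : h t = 1) (v : E₀) :
    tder E₀ E (fun s => h s • Q s) t v =
      infAction EH H E (Q t) (tder E₀ EH h t v) + tder E₀ E Q t v := by
  have := tder_comp₂ (F := fun p : H × M => p.1 • p.2)
    (hμ.mdifferentiable_action (h t, Q t)) hh hQ v
  simp only [h1, one_smul, tder_id] at this
  exact this

/-- The derivative of `μ` along the orbits vanishes on an invariant level. -/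
theorem IsHamiltonianAction.momentDeriv_infAction (hμ : IsHamiltonianAction Ω μ)
    {c : Module.Dual ℝ (GroupLieAlgebra 𝓘(ℝ, EH) H)} {x : M}
    (hx : ∀ g : H, μ (g • x) = c) (ξ η : EH) :
    momentDeriv μ x ξ (infAction EH H E x η) = 0 := by
  have h1 := tder_comp_apply (g := fun y => μ y ξ) (f := fun g : H => g • x) (x := 1)
    (hμ.mdifferentiable_moment ξ _) (hμ.mdifferentiable_smul_const 1 x) η
  simp only [hx, one_smul, tder_const] at h1
  exact h1.symm

/-- The derivative of `μ` vanishes on tangent vectors of maps with values in a level. -/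
theorem momentDeriv_tder_of_eventually (hμ : IsHamiltonianAction Ω μ)
    {c : Module.Dual ℝ (GroupLieAlgebra 𝓘(ℝ, EH) H)} {Q : M₀ → M} {t : M₀}
    (hQ : MDifferentiableAt 𝓘(ℝ, E₀) 𝓘(ℝ, E) Q t) (hc : ∀ᶠ s in 𝓝 t, μ (Q s) = c) (ξ : EH)
    (v : E₀) : momentDeriv μ (Q t) ξ (tder E₀ E Q t v) = 0 := by
  have h1 := tder_comp_apply (g := fun y => μ y ξ) (hμ.mdifferentiable_moment ξ _) hQ v
  have h2 : (fun s => μ (Q s) ξ) =ᶠ[𝓝 t] fun _ => c ξ := by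
    filter_upwards [hc] with s hs using by rw [hs]
  rw [tder_congr h2, tder_const] at h1
  exact h1.symm

/-- At a regular point the infinitesimal action is injective: if `X_ξ(x) = 0`, then `d⟨μ, ξ⟩`
vanishes at `x`, whereas some tangent vector has nonzero image under it unless `ξ = 0`. -/
theorem IsHamiltonianAction.infAction_injective (hμ : IsHamiltonianAction Ω μ)
    [FiniteDimensional ℝ EH]
    {c : Module.Dual ℝ (GroupLieAlgebra 𝓘(ℝ, EH) H)} (hreg : IsRegularValue (E := E) μ c) {x : M}
    (hx : μ x = c) : Function.Injective (infAction EH H E x) := by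
  rw [injective_iff_map_eq_zero]
  intro ξ hξ
  by_contra hne
  obtain ⟨l, hl⟩ : ∃ l : Module.Dual ℝ EH, l ξ ≠ 0 := by
    by_contra! h
    exact hne ((Module.forall_dual_apply_eq_zero_iff ℝ ξ).1 h)
  obtain ⟨v, hv⟩ : ∃ v : E, ∀ ζ : EH, momentDeriv μ x ζ v = l ζ := hreg x hx l
  have h1 := hμ.form_infAction x ξ v
  have h2 : momentDeriv μ x ξ v = l ξ := hv ξ
  rw [hξ, h2] at h1
  have h3 : formAt Ω x ![0, v] = 0 :=
    (formAt Ω x).map_coord_zero 0 rfl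
  rw [h3] at h1
  exact hl (by linarith)

variable {F : Type*} [NormedAddCommGroup F] [NormedSpace ℝ F]

/-- Acting by a symplectomorphism does not change the pullback of the form. -/
theorem IsHamiltonianAction.pull_const_smul (hμ : IsHamiltonianAction Ω μ) (g : H) {P : F → M}
    {t : F} (hP : MDifferentiableAt 𝓘(ℝ, F) 𝓘(ℝ, E) P t) :
    pull Ω (fun s => g • P s) t = pull Ω P t := by
  ext v
  have h1 := tder_comp (hμ.mdifferentiable_const_smul g (P t)) hP
  have h2 := congrArg (fun α : E [⋀^Fin 2]→L[ℝ] ℝ => α (fun i => tder F E P t (v i)))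
    (hμ.symplectic g (P t))
  rw [pull_apply, h1]
  exact h2

/-- Moving the points of an invariant level along their orbits does not change the pullback of the
form: by the momentum equation the orbit directions lie in the kernel of the restriction of the form
to the level. -/
theorem IsHamiltonianAction.pull_smul (hμ : IsHamiltonianAction Ω μ) [LieGroup 𝓘(ℝ, EH) ∞ H]
    {c : Module.Dual ℝ (GroupLieAlgebra 𝓘(ℝ, EH) H)} (hinv : ∀ (g : H) x, μ x = c → μ (g • x) = c)
    {h : F → H} {Q : F → M} {t : F}
    (hh : MDifferentiableAt 𝓘(ℝ, F) 𝓘(ℝ, EH) h t)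
    (hQ : MDifferentiableAt 𝓘(ℝ, F) 𝓘(ℝ, E) Q t) (hc : ∀ᶠ s in 𝓝 t, μ (Q s) = c) :
    pull Ω (fun s => h s • Q s) t = pull Ω Q t := by
  -- translate by `h t`, which reduces to the case `h t = 1`
  have hk : MDifferentiableAt 𝓘(ℝ, F) 𝓘(ℝ, EH) (fun s => (h t)⁻¹ * h s) t :=
    (((contMDiff_mul_left (I := 𝓘(ℝ, EH)) (n := ∞) (a := (h t)⁻¹)) (h t)).mdifferentiableAt
      (by simp)).comp t hh
  have hx : μ (Q t) = c := hc.self_of_nhds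
  have h0 : (fun s => h s • Q s) = fun s => h t • (((h t)⁻¹ * h s) • Q s) := by
    funext s; rw [smul_smul, mul_inv_cancel_left]
  have hkQ : MDifferentiableAt 𝓘(ℝ, F) 𝓘(ℝ, E) (fun s => ((h t)⁻¹ * h s) • Q s) t :=
    (hμ.mdifferentiable_action (((h t)⁻¹ * h t), Q t)).comp t (hk.prodMk hQ)
  rw [h0, hμ.pull_const_smul (h t) hkQ]
  refine twoForm_ext fun u v => ?_
  have hd := hμ.tder_smul_of_eq_one hk hQ (by simp)
  have e1 : ∀ a ξ, formAt Ω (Q t)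
      ![infAction EH H E (Q t) ξ, tder F E Q t a] = 0 := fun a ξ => by
    rw [hμ.form_infAction, momentDeriv_tder_of_eventually hμ hQ hc, neg_zero]
  have e2 : ∀ ξ η, formAt Ω (Q t)
      ![infAction EH H E (Q t) ξ, infAction EH H E (Q t) η] = 0 := fun ξ η => by
    rw [hμ.form_infAction, hμ.momentDeriv_infAction (fun g => hinv g _ hx), neg_zero]
  rw [pull_pair, pull_pair, hd u, hd v]
  have h1 : ((h t)⁻¹ * h t) • Q t = Q t := by simp
  rw [h1, twoForm_add_left, twoForm_add_right, twoForm_add_right, e1, e2,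
    twoForm_swap _ (tder F E Q t u), e1]
  simp

end Action

/-! ### Linear actions of finite groups -/

section FiniteGroup

variable {Γ : Type*} [Group Γ] [Finite Γ] {V : Type*} [NormedAddCommGroup V] [NormedSpace ℝ V]

/-- Maschke's theorem for a finite group of continuous linear maps: average a projection. -/
theorem exists_invariant_isCompl (ρ : Γ →* (V →L[ℝ] V)) (O : Submodule ℝ V)
    (hO : ∀ γ, ∀ v ∈ O, ρ γ v ∈ O) :
    ∃ W : Submodule ℝ V, IsCompl O W ∧ ∀ γ, ∀ w ∈ W, ρ γ w ∈ W := by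
  have := Fintype.ofFinite Γ
  obtain ⟨W₀, hW₀⟩ := O.exists_isCompl
  let p := O.projectionOnto W₀ hW₀
  -- the sum of the conjugates of the projection: equivariant, and `|Γ|` times the identity on `O`
  let P : V →ₗ[ℝ] V := ∑ γ : Γ, (ρ γ).toLinearMap ∘ₗ O.subtype ∘ₗ p ∘ₗ (ρ γ⁻¹).toLinearMap
  have hP : ∀ v, P v = ∑ γ : Γ, ρ γ (p (ρ γ⁻¹ v)) := fun v => by
    simp [P, LinearMap.sum_apply]
  have hmul : ∀ (a b : Γ) (v : V), ρ a (ρ b v) = ρ (a * b) v := fun a b v => by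
    rw [map_mul]; rfl
  have hPO : ∀ v, P v ∈ O := fun v => by
    rw [hP]; exact Submodule.sum_mem _ fun γ _ => hO γ _ (p _).2
  have hPid : ∀ v ∈ O, P v = (Fintype.card Γ : ℝ) • v := fun v hv => by
    have : ∀ γ : Γ, ρ γ (p (ρ γ⁻¹ v)) = v := fun γ => by
      have h1 : ((p (ρ γ⁻¹ v) : O) : V) = ρ γ⁻¹ v :=
        congrArg Subtype.val (Submodule.projectionOnto_apply_left hW₀ ⟨_, hO γ⁻¹ v hv⟩)
      rw [h1, hmul, mul_inv_cancel, map_one]; rfl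
    rw [hP, Finset.sum_congr rfl fun γ _ => this γ, Finset.sum_const, Finset.card_univ,
      Nat.cast_smul_eq_nsmul]
  have hcard : (Fintype.card Γ : ℝ) ≠ 0 := by simp
  have hcomm : ∀ (a : Γ) v, P (ρ a v) = ρ a (P v) := fun a v => by
    rw [hP, hP, map_sum, ← Equiv.sum_comp (Equiv.mulLeft a)]
    refine Finset.sum_congr rfl fun γ _ => ?_
    rw [hmul, hmul]
    simp
  refine ⟨LinearMap.ker P, ⟨?_, ?_⟩, fun γ w hw => ?_⟩
  · rw [Submodule.disjoint_def]
    intro v hv hv'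
    have h1 := hPid v hv
    rw [LinearMap.mem_ker.1 hv'] at h1
    exact (smul_eq_zero.1 h1.symm).resolve_left hcard
  · rw [codisjoint_iff, Submodule.eq_top_iff']
    intro v
    rw [Submodule.mem_sup]
    refine ⟨(Fintype.card Γ : ℝ)⁻¹ • P v, O.smul_mem _ (hPO v),
      v - (Fintype.card Γ : ℝ)⁻¹ • P v, ?_, by abel⟩
    rw [LinearMap.mem_ker, map_sub, map_smul, hPid _ (hPO v), smul_smul, inv_mul_cancel₀ hcard,
      one_smul, sub_self]
  · rw [LinearMap.mem_ker, hcomm, LinearMap.mem_ker.1 hw, map_zero]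

/-- A diffeomorphism, equivariant for a finite linear group, of `ℝᵈ` onto a neighbourhood of `0` in
the ball of radius `r`. With an invariant quadratic form `B` it is `u ↦ r u / √(1 + B u)`. -/
theorem exists_equivariant_shrinking {d : ℕ} (ρ : Γ →* (Eucl d →L[ℝ] Eucl d)) {r : ℝ}
    (hr : 0 < r) : ∃ s t : Eucl d → Eucl d, ContDiff ℝ ∞ s ∧ s 0 = 0 ∧ (∀ u, ‖s u‖ < r) ∧
      (∀ u, t (s u) = u) ∧ (∀ u, ∀ᶠ w in 𝓝 (s u), ContDiffAt ℝ ∞ t w ∧ s (t w) = w) ∧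
      ∀ γ u, s (ρ γ u) = ρ γ (s u) := by
  have := Fintype.ofFinite Γ
  let B : Eucl d → ℝ := fun u => ∑ γ : Γ, ‖ρ γ u‖ ^ 2
  have hB0 : ∀ u, 0 ≤ B u := fun u => Finset.sum_nonneg fun γ _ => by positivity
  have hB1 : ∀ u, ‖u‖ ^ 2 ≤ B u := fun u => by
    have h1 := Finset.single_le_sum (f := fun γ : Γ => ‖ρ γ u‖ ^ 2)
      (fun γ _ => by positivity) (Finset.mem_univ 1)
    simpa using h1
  have hBs : ∀ (a : ℝ) u, B (a • u) = a ^ 2 * B u := fun a u => by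
    simp only [B, map_smul, norm_smul, mul_pow, Finset.mul_sum, Real.norm_eq_abs, sq_abs]
  have hBinv : ∀ γ u, B (ρ γ u) = B u := fun γ u => by
    simp only [B]
    rw [← Equiv.sum_comp (Equiv.mulRight γ) (fun a : Γ => ‖ρ a u‖ ^ 2)]
    refine Finset.sum_congr rfl fun a _ => ?_
    simp [map_mul]
  have hBc : ContDiff ℝ ∞ B := ContDiff.sum fun γ _ => (ρ γ).contDiff.norm_sq ℝ
  have hpos : ∀ u, 0 < 1 + B u := fun u => by linarith [hB0 u]
  -- `t` is the inverse of `s` where `B w < r²`, and `B (s u) = r² B u / (1 + B u) < r²`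
  let s : Eucl d → Eucl d := fun u => (r / √(1 + B u)) • u
  let t : Eucl d → Eucl d := fun w => (1 / √(r ^ 2 - B w)) • w
  have hBsu : ∀ u, r ^ 2 - B (s u) = r ^ 2 / (1 + B u) := fun u => by
    have := (hpos u).ne'
    rw [hBs, div_pow, Real.sq_sqrt (hpos u).le]
    field_simp
    ring
  have hlt : ∀ u, 0 < r ^ 2 - B (s u) := fun u => by
    rw [hBsu]; have := hpos u; positivity
  refine ⟨s, t, ?_, by simp [s], fun u => ?_, fun u => ?_, fun u => ?_, fun γ u => ?_⟩
  · have h : ContDiff ℝ ∞ fun u => r / √(1 + B u) := contDiff_const.div ?_ fun u => ?_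
    · exact h.smul contDiff_id
    · exact (contDiff_const.add hBc).sqrt fun u => (hpos u).ne'
    · exact (Real.sqrt_pos.2 (hpos u)).ne'
  · have h1 := hB1 (s u)
    have h2 := hlt u
    exact lt_of_pow_lt_pow_left₀ 2 hr.le (by linarith)
  · have h1 := Real.sqrt_pos.2 (hpos u)
    simp only [t]
    rw [hBsu, Real.sqrt_div (by positivity), Real.sqrt_sq hr.le]
    simp only [s]
    rw [smul_smul]
    have : 1 / (r / √(1 + B u)) * (r / √(1 + B u)) = 1 := by field_simp
    rw [this, one_smul]
  · have hev : ∀ᶠ w in 𝓝 (s u), 0 < r ^ 2 - B w :=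
      (continuous_const.sub hBc.continuous).continuousAt.eventually (lt_mem_nhds (hlt u))
    filter_upwards [hev] with w hw
    constructor
    · have h : ContDiffAt ℝ ∞ (fun w => 1 / √(r ^ 2 - B w)) w := contDiffAt_const.div ?_ ?_
      · exact h.smul contDiffAt_id
      · exact (contDiffAt_const.sub hBc.contDiffAt).sqrt hw.ne'
      · exact (Real.sqrt_pos.2 hw).ne'
    · have h0 : 1 + B (t w) = r ^ 2 / (r ^ 2 - B w) := by
        simp only [t]
        rw [hBs, div_pow, Real.sq_sqrt hw.le]
        field_simp
        ring
      have h1 := Real.sqrt_pos.2 hw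
      simp only [s]
      rw [h0, Real.sqrt_div (by positivity), Real.sqrt_sq hr.le]
      simp only [t]
      rw [smul_smul]
      have : r / (r / √(r ^ 2 - B w)) * (1 / √(r ^ 2 - B w)) = 1 := by field_simp
      rw [this, one_smul]
  · simp only [s, hBinv, map_smul]

end FiniteGroup

/-! ### Derivatives of vector-valued maps on manifolds -/

section VectorValued

variable {E : Type*} [NormedAddCommGroup E] [NormedSpace ℝ E]
  {M : Type*} [TopologicalSpace M] [ChartedSpace E M]
  {F : Type*} [NormedAddCommGroup F] [NormedSpace ℝ F]

theorem tder_clm_comp {F' : Type*} [NormedAddCommGroup F'] [NormedSpace ℝ F'] (L : F →L[ℝ] F')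
    {f : M → F} {x : M} (hf : MDifferentiableAt 𝓘(ℝ, E) 𝓘(ℝ, F) f x) (v : E) :
    tder E F' (fun y => L (f y)) x v = L (tder E F f x v) := by
  rw [tder_comp_apply (g := fun y => L y) L.differentiableAt.mdifferentiableAt hf, tder_clm]

theorem tder_pi_apply {ι : Type*} [Fintype ι] {f : M → ι → F} {x : M}
    (hf : MDifferentiableAt 𝓘(ℝ, E) 𝓘(ℝ, ι → F) f x) (v : E) (i : ι) :
    tder E (ι → F) f x v i = tder E F (fun y => f y i) x v :=
  (tder_clm_comp (ContinuousLinearMap.proj (R := ℝ) (φ := fun _ : ι => F) i) hf v).symm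

theorem tder_add {f g : M → F} {x : M} (hf : MDifferentiableAt 𝓘(ℝ, E) 𝓘(ℝ, F) f x)
    (hg : MDifferentiableAt 𝓘(ℝ, E) 𝓘(ℝ, F) g x) :
    tder E F (fun y => f y + g y) x = tder E F f x + tder E F g x :=
  mfderiv_add hf hg

theorem tder_sub {f g : M → F} {x : M} (hf : MDifferentiableAt 𝓘(ℝ, E) 𝓘(ℝ, F) f x)
    (hg : MDifferentiableAt 𝓘(ℝ, E) 𝓘(ℝ, F) g x) :
    tder E F (fun y => f y - g y) x = tder E F f x - tder E F g x :=
  mfderiv_sub hf hg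

/-- A map into the dual of a finite-dimensional space `V`, smooth in the weak sense, becomes smooth
when composed with a linear map; the derivative of the composite vanishes where the weak
derivative does. -/
theorem contMDiffAt_dual_comp {V : Type*} [AddCommGroup V] [Module ℝ V]
    [FiniteDimensional ℝ V] (R : Module.Dual ℝ V →ₗ[ℝ] F) {f : M → Module.Dual ℝ V} {x : M}
    (hf : ∀ ζ, ContMDiffAt 𝓘(ℝ, E) 𝓘(ℝ, ℝ) ∞ (fun y => f y ζ) x) :
    ContMDiffAt 𝓘(ℝ, E) 𝓘(ℝ, F) ∞ (fun y => R (f y)) x ∧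
      ((∀ ζ, tder E ℝ (fun y => f y ζ) x = 0) → tder E F (fun y => R (f y)) x = 0) := by
  let b := Module.finBasis ℝ V
  let S : (Fin (Module.finrank ℝ V) → ℝ) →L[ℝ] F :=
    (R ∘ₗ (b.constr ℝ).toLinearMap).toContinuousLinearMap
  have hS : (fun y => R (f y)) = fun y => S (fun i => f y (b i)) := by
    funext y
    change _ = R (b.constr ℝ fun i => f y (b i))
    congr 1
    refine b.ext fun i => ?_
    rw [b.constr_basis]
  have h1 : ContMDiffAt 𝓘(ℝ, E) 𝓘(ℝ, Fin (Module.finrank ℝ V) → ℝ) ∞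
      (fun y i => f y (b i)) x := contMDiffAt_pi_space.2 fun i => hf (b i)
  rw [hS]
  refine ⟨S.contDiff.contMDiff.contMDiffAt.comp x h1, fun h0 => ?_⟩
  ext v
  rw [tder_clm_comp S (h1.mdifferentiableAt (by simp))]
  have : tder E (Fin (Module.finrank ℝ V) → ℝ) (fun y i => f y (b i)) x v = 0 := by
    funext i
    rw [tder_pi_apply (h1.mdifferentiableAt (by simp)), h0]; rfl
  rw [this, map_zero]; rfl

end VectorValued

/-! ### Linearization of the action at a point with finite stabilizer -/

section Isotropy

variable {EH : Type*} [NormedAddCommGroup EH] [NormedSpace ℝ EH]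
  {H : Type*} [TopologicalSpace H] [ChartedSpace EH H] [Group H]
  {E : Type*} [NormedAddCommGroup E] [NormedSpace ℝ E]
  {M : Type*} [TopologicalSpace M] [ChartedSpace E M] [MulAction H M]
  {Ω : ∀ x : M, TangentSpace 𝓘(ℝ, E) x [⋀^Fin 2]→L[ℝ] ℝ}
  {μ : M → Module.Dual ℝ (GroupLieAlgebra 𝓘(ℝ, EH) H)}

/-- The isotropy representation of the stabilizer of `z` on the tangent space at `z`. -/
def IsHamiltonianAction.isotropyRep (hμ : IsHamiltonianAction Ω μ) (z : M) :
    MulAction.stabilizer H z →* (E →L[ℝ] E) where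
  toFun γ := tder E E (fun x : M => (γ : H) • x) z
  map_one' := by
    simp only [OneMemClass.coe_one, one_smul]
    exact tder_id z
  map_mul' a b := by
    have hb : (b : H) • z = z := b.2
    have h := tder_comp (g := fun x : M => (a : H) • x) (f := fun x : M => (b : H) • x) (x := z)
      (hμ.mdifferentiable_const_smul _ _) (hμ.mdifferentiable_const_smul _ _)
    simp only [smul_smul, hb] at h
    exact h

theorem IsHamiltonianAction.isotropyRep_apply (hμ : IsHamiltonianAction Ω μ) (z : M)
    (γ : MulAction.stabilizer H z) :
    hμ.isotropyRep z γ = tder E E (fun x : M => (γ : H) • x) z := rfl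

theorem IsHamiltonianAction.isotropyRep_mul_apply (hμ : IsHamiltonianAction Ω μ) (z : M)
    (a b : MulAction.stabilizer H z) (v : E) :
    hμ.isotropyRep z a (hμ.isotropyRep z b v) = hμ.isotropyRep z (a * b) v := by
  rw [map_mul]; rfl

variable (EH) in
/-- The adjoint action on the model space of the group. -/
def adj (g : H) : EH →L[ℝ] EH := adjointAction g

theorem adj_eq (g : H) : adj EH g = tder EH EH (fun x : H => g * x * g⁻¹) 1 := rfl

theorem IsHamiltonianAction.moment_smul (hμ : IsHamiltonianAction Ω μ) (g : H) (x : M) (ζ : EH) :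
    μ (g • x) ζ = μ x (adj EH g⁻¹ ζ) := hμ.equivariant g x ζ

/-- The differential of the momentum map intertwines the isotropy and coadjoint representations. -/
theorem IsHamiltonianAction.momentDeriv_isotropyRep (hμ : IsHamiltonianAction Ω μ) (z : M)
    (γ : MulAction.stabilizer H z) (ζ : EH) (w : E) :
    momentDeriv μ z ζ (hμ.isotropyRep z γ w) = momentDeriv μ z (adj EH (γ : H)⁻¹ ζ) w := by
  have hz : (γ : H) • z = z := γ.2
  have h := tder_comp_apply (g := fun x => μ x ζ) (f := fun x : M => (γ : H) • x) (x := z)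
    (hμ.mdifferentiable_moment ζ _) (hμ.mdifferentiable_const_smul _ _) w
  simp only [hz] at h
  rw [isotropyRep_apply]
  refine h.symm.trans ?_
  have h2 : (fun y : M => μ ((γ : H) • y) ζ) = fun y => μ y (adj EH (γ : H)⁻¹ ζ) :=
    funext fun y => hμ.moment_smul _ _ _
  rw [h2]; rfl

theorem contMDiff_conj [LieGroup 𝓘(ℝ, EH) ∞ H] (g : H) :
    ContMDiff 𝓘(ℝ, EH) 𝓘(ℝ, EH) ∞ (fun x : H => g * x * g⁻¹) :=
  (contMDiff_mul_right (a := g⁻¹)).comp (contMDiff_mul_left (a := g))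

/-- The infinitesimal action intertwines the adjoint and isotropy representations. -/
theorem IsHamiltonianAction.isotropyRep_infAction (hμ : IsHamiltonianAction Ω μ)
    [LieGroup 𝓘(ℝ, EH) ∞ H] (z : M) (γ : MulAction.stabilizer H z) (ζ : EH) :
    hμ.isotropyRep z γ (infAction EH H E z ζ) = infAction EH H E z (adj EH (γ : H) ζ) := by
  have hz : (γ : H)⁻¹ • z = z := (γ⁻¹).2
  have h1 := tder_comp_apply (g := fun x : M => (γ : H) • x) (f := fun g : H => g • z) (x := 1)
    (hμ.mdifferentiable_const_smul _ _) (hμ.mdifferentiable_smul_const _ _) ζ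
  have h2 := tder_comp_apply (g := fun g : H => g • z) (f := fun x : H => (γ : H) * x * (γ : H)⁻¹)
    (x := 1) (hμ.mdifferentiable_smul_const _ _)
    ((contMDiff_conj (EH := EH) (γ : H) 1).mdifferentiableAt (by simp)) ζ
  simp only [one_smul] at h1
  simp only [mul_one, mul_inv_cancel] at h2
  rw [isotropyRep_apply, adj_eq]
  refine h1.symm.trans (Eq.trans ?_ h2)
  congr 2
  funext y
  simp only [mul_smul, hz]

variable (EH) in
/-- The differential of the momentum map at `z`, with values in the dual of the Lie algebra. -/
def IsHamiltonianAction.momentDual (hμ : IsHamiltonianAction Ω μ) (z : M) :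
    E →ₗ[ℝ] Module.Dual ℝ EH where
  toFun w :=
    { toFun := fun ζ => momentDeriv μ z ζ w
      map_add' := fun ζ η => by
        have h : (fun y => μ y (ζ + η : EH)) = fun y => μ y ζ + μ y η :=
          funext fun y => map_add (μ y) ζ η
        unfold momentDeriv
        rw [h, tder_add (hμ.mdifferentiable_moment ζ z) (hμ.mdifferentiable_moment η z)]
        rfl
      map_smul' := fun a ζ => by
        have h : (fun y => μ y (a • ζ : EH)) =
            fun y => (a • ContinuousLinearMap.id ℝ ℝ) (μ y ζ) :=
          funext fun y => map_smul (μ y) a ζ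
        unfold momentDeriv
        rw [h, tder_clm_comp _ (hμ.mdifferentiable_moment ζ z)]
        rfl }
  map_add' v w := by ext ζ; exact map_add (momentDeriv μ z ζ) v w
  map_smul' a v := by ext ζ; exact map_smul (momentDeriv μ z ζ) a v

theorem IsHamiltonianAction.momentDual_apply (hμ : IsHamiltonianAction Ω μ) (z : M) (w : E)
    (ζ : EH) : hμ.momentDual EH z w ζ = momentDeriv μ z ζ w := rfl

/-- Near a point `z` of an invariant regular level with finite stabilizer there are coordinates,
centred at `z`, in which the stabilizer acts linearly and the momentum map is affine: correct a
chart by a right inverse of the differential of the momentum map, then average over the stabilizer. -/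
theorem IsHamiltonianAction.exists_linearizing_parametrization [FiniteDimensional ℝ EH]
    [FiniteDimensional ℝ E]
    [IsManifold 𝓘(ℝ, E) ∞ M] (hμ : IsHamiltonianAction Ω μ)
    {c : Module.Dual ℝ (GroupLieAlgebra 𝓘(ℝ, EH) H)}
    (hc : ∀ (g : H) (ξ : EH), c (adj EH g ξ) = c ξ)
    (hreg : IsRegularValue (E := E) μ c) {z : M} (hz : μ z = c)
    [Finite (MulAction.stabilizer H z)] :
    ∃ A : E → M, A 0 = z ∧ tder E E A 0 = ContinuousLinearMap.id ℝ E ∧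
      (∀ᶠ y in 𝓝 0, ContMDiffAt 𝓘(ℝ, E) 𝓘(ℝ, E) ∞ A y) ∧
      (∀ γ : MulAction.stabilizer H z, ∀ᶠ y in 𝓝 (0 : E),
        A (hμ.isotropyRep z γ y) = (γ : H) • A y) ∧
      ∀ᶠ y in 𝓝 (0 : E), ∀ ζ : EH, μ (A y) ζ = c ζ + momentDeriv μ z ζ y := by
  have := Fintype.ofFinite (MulAction.stabilizer H z)
  set Γ := MulAction.stabilizer H z with hΓ
  have hγz : ∀ γ : Γ, (γ : H) • z = z := fun γ => γ.2
  set ρ := hμ.isotropyRep z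
  let D := hμ.momentDual EH z
  let m : M → Module.Dual ℝ EH := μ
  let c₀ : Module.Dual ℝ EH := c
  have hmz : m z = c₀ := hz
  have hD : Function.Surjective D := fun l => by
    obtain ⟨v, hv⟩ : ∃ v : E, ∀ ζ : EH, momentDeriv μ z ζ v = l ζ := hreg z hz l
    exact ⟨v, LinearMap.ext hv⟩
  obtain ⟨R, hR⟩ := D.exists_rightInverse_of_surjective (LinearMap.range_eq_top.2 hD)
  have hDR : ∀ l, D (R l) = l := fun l => LinearMap.congr_fun hR l
  let φ := extChartAt 𝓘(ℝ, E) z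
  have hφs : ∀ y ∈ φ.source, ContMDiffAt 𝓘(ℝ, E) 𝓘(ℝ, E) ∞ φ y := fun y hy =>
    contMDiffAt_extChartAt' (by simpa [φ] using hy)
  have hzs : z ∈ φ.source := mem_extChartAt_source z
  obtain ⟨K, hK⟩ : ∃ K : E ≃L[ℝ] E, (K : E →L[ℝ] E) = tder E E φ z :=
    isInvertible_mfderiv_extChartAt (I := 𝓘(ℝ, E)) (x := z) hzs
  -- a chart at `z` with derivative the identity
  let ψ : M → E := fun x => (K.symm : E →L[ℝ] E) (φ x - φ z)
  have hψ : ∀ y ∈ φ.source, ContMDiffAt 𝓘(ℝ, E) 𝓘(ℝ, E) ∞ ψ y := fun y hy =>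
    (K.symm : E →L[ℝ] E).contDiff.contMDiff.contMDiffAt.comp y
      ((hφs y hy).sub contMDiffAt_const)
  have hψz : ψ z = 0 := by simp [ψ]
  have hψd : tder E E ψ z = ContinuousLinearMap.id ℝ E := by
    ext v
    have h0 := (hφs z hzs).mdifferentiableAt (by simp)
    rw [tder_clm_comp (f := fun x => φ x - φ z) _ (h0.sub mdifferentiableAt_const),
      tder_sub h0 mdifferentiableAt_const, tder_const, ← hK]
    simp
  -- its correction, in which the momentum map is affine
  let f : M → Module.Dual ℝ EH := fun x => m x - c₀ - D (ψ x)
  have hf : ∀ y ∈ φ.source, ∀ ζ, ContMDiffAt 𝓘(ℝ, E) 𝓘(ℝ, ℝ) ∞ (fun x => f x ζ) y := by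
    intro y hy ζ
    have h1 : ContMDiffAt 𝓘(ℝ, E) 𝓘(ℝ, ℝ) ∞ (fun x => momentDeriv μ z ζ (ψ x)) y :=
      (momentDeriv μ z ζ).contDiff.contMDiff.contMDiffAt.comp y (hψ y hy)
    exact ((hμ.smooth ζ y).sub contMDiffAt_const).sub h1
  have hfd : ∀ ζ, tder E ℝ (fun x => f x ζ) z = 0 := by
    intro ζ
    have h0 := (hψ z hzs).mdifferentiableAt (n := ∞) (by simp)
    have h1 : MDifferentiableAt 𝓘(ℝ, E) 𝓘(ℝ, ℝ) (fun x => momentDeriv μ z ζ (ψ x)) z :=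
      ((momentDeriv μ z ζ).differentiableAt.mdifferentiableAt).comp z h0
    have h2 : MDifferentiableAt 𝓘(ℝ, E) 𝓘(ℝ, ℝ) (fun x => μ x ζ - c ζ) z :=
      (hμ.mdifferentiable_moment ζ z).sub mdifferentiableAt_const
    have h3 : (fun x => f x ζ) = fun x => (μ x ζ - c ζ) - momentDeriv μ z ζ (ψ x) := rfl
    rw [h3, tder_sub h2 h1, tder_sub (hμ.mdifferentiable_moment ζ z) mdifferentiableAt_const,
      tder_const]
    ext v
    simp only [sub_apply]
    rw [tder_clm_comp _ h0, hψd]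
    simp [momentDeriv]
  let ψ' : M → E := fun x => ψ x + R (f x)
  have hψ' : ∀ y ∈ φ.source, ContMDiffAt 𝓘(ℝ, E) 𝓘(ℝ, E) ∞ ψ' y := fun y hy =>
    (hψ y hy).add (contMDiffAt_dual_comp R (hf y hy)).1
  have hψ'd : tder E E ψ' z = ContinuousLinearMap.id ℝ E := by
    have h0 := contMDiffAt_dual_comp R (hf z hzs)
    rw [tder_add ((hψ z hzs).mdifferentiableAt (by simp)) (h0.1.mdifferentiableAt (by simp)), hψd,
      h0.2 hfd, add_zero]
  have hDψ' : ∀ x, D (ψ' x) = m x - c₀ := fun x => by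
    simp only [ψ', map_add, hDR, f]; abel
  have hψ'z : ψ' z = 0 := by
    have : f z = 0 := by
      simp only [f, hψz, map_zero, hmz, sub_self]
    simp only [ψ', hψz, this, map_zero, add_zero]
  -- the average over the stabilizer
  have hcard : (Fintype.card Γ : ℝ) ≠ 0 := by simp
  let S : (Γ → E) →L[ℝ] E := (Fintype.card Γ : ℝ)⁻¹ •
    ∑ γ : Γ, (ρ γ⁻¹).comp (ContinuousLinearMap.proj (R := ℝ) (φ := fun _ : Γ => E) γ)
  have hS : ∀ v : Γ → E, S v = (Fintype.card Γ : ℝ)⁻¹ • ∑ γ : Γ, ρ γ⁻¹ (v γ) := fun v => by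
    simp [S, sum_apply]
  let Φ : M → Γ → E := fun x γ => ψ' ((γ : H) • x)
  let Ψ : M → E := fun x => S (Φ x)
  have hΦ : ∀ᶠ x in 𝓝 z, ContMDiffAt 𝓘(ℝ, E) 𝓘(ℝ, Γ → E) ∞ Φ x := by
    have : ∀ᶠ x in 𝓝 z, ∀ γ : Γ, (γ : H) • x ∈ φ.source := by
      rw [Filter.eventually_all]
      intro γ
      have h1 := (hμ.contMDiff_const_smul (γ : H)).continuous.continuousAt (x := z)
      rw [ContinuousAt, hγz] at h1
      exact h1.eventually_mem (extChartAt_source_mem_nhds z)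
    filter_upwards [this] with x hx
    rw [contMDiffAt_pi_space]
    exact fun γ => (hψ' _ (hx γ)).comp x (hμ.contMDiff_const_smul (γ : H) x)
  have hΨ : ∀ᶠ x in 𝓝 z, ContMDiffAt 𝓘(ℝ, E) 𝓘(ℝ, E) ∞ Ψ x := by
    filter_upwards [hΦ] with x hx using S.contDiff.contMDiff.contMDiffAt.comp x hx
  have hΨd : tder E E Ψ z = ContinuousLinearMap.id ℝ E := by
    ext v
    have h0 := hΦ.self_of_nhds.mdifferentiableAt (by simp)
    rw [tder_clm_comp S h0]
    have h1 : tder E (Γ → E) Φ z v = fun γ => ρ γ v := by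
      funext γ
      rw [tder_pi_apply h0]
      have h2 := tder_comp_apply (g := ψ') (f := fun x : M => (γ : H) • x) (x := z)
        (by rw [hγz]; exact (hψ' z hzs).mdifferentiableAt (by simp))
        (hμ.mdifferentiable_const_smul _ _) v
      rw [hγz, hψ'd] at h2
      exact h2
    rw [h1, hS]
    have h2 : ∀ γ : Γ, ρ γ⁻¹ (ρ γ v) = v := fun γ => by
      rw [hμ.isotropyRep_mul_apply, inv_mul_cancel, map_one]; rfl
    rw [Finset.sum_congr rfl fun γ _ => h2 γ, Finset.sum_const, Finset.card_univ,
      ← Nat.cast_smul_eq_nsmul ℝ, smul_smul, inv_mul_cancel₀ hcard, one_smul]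
    rfl
  have hΨz : Ψ z = 0 := by
    simp only [Ψ, hS, Φ, hγz, hψ'z, map_zero, Finset.sum_const_zero, smul_zero]
  have hΨeq : ∀ (a : Γ) x, Ψ ((a : H) • x) = ρ a (Ψ x) := fun a x => by
    simp only [Ψ, hS, Φ, map_smul, map_sum]
    congr 1
    rw [← Equiv.sum_comp (Equiv.mulRight a) (fun γ : Γ => ρ a (ρ γ⁻¹ (ψ' ((γ : H) • x))))]
    refine Finset.sum_congr rfl fun γ _ => ?_
    rw [hμ.isotropyRep_mul_apply, smul_smul]
    simp
    rfl
  have hDΨ : ∀ x, D (Ψ x) = m x - c₀ := fun x => by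
    have h1 : ∀ γ : Γ, D (ρ γ⁻¹ (ψ' ((γ : H) • x))) = m x - c₀ := fun γ => by
      ext ζ
      rw [momentDual_apply, hμ.momentDeriv_isotropyRep]
      have h2 := LinearMap.congr_fun (hDψ' ((γ : H) • x)) (adj EH ((γ⁻¹ : Γ) : H)⁻¹ ζ)
      rw [momentDual_apply] at h2
      rw [h2]
      have h3 := hμ.moment_smul ((γ⁻¹ : Γ) : H) ((γ : H) • x) ζ
      have h4 : ((γ⁻¹ : Γ) : H) • (γ : H) • x = x := by simp
      rw [h4] at h3
      have h5 := hc ((γ⁻¹ : Γ) : H)⁻¹ ζ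
      exact congrArg₂ (· - ·) h3.symm h5
    simp only [Ψ, hS, Φ, map_smul, map_sum]
    rw [Finset.sum_congr rfl fun γ _ => h1 γ, Finset.sum_const, Finset.card_univ,
      ← Nat.cast_smul_eq_nsmul ℝ, smul_smul, inv_mul_cancel₀ hcard, one_smul]
  obtain ⟨A, hA0, hAs, hΨA, hAΨ⟩ := exists_local_inverse_of_tder_bijective hΨ
    (by rw [hΨd]; exact Function.bijective_id)
  rw [hΨz] at hA0 hAs hΨA
  have hAc : Filter.Tendsto A (𝓝 0) (𝓝 z) := by
    have := hAs.self_of_nhds.continuousAt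
    rwa [ContinuousAt, hA0] at this
  refine ⟨A, hA0, ?_, hAs, fun γ => ?_, ?_⟩
  · ext v
    have h1 := tder_comp_apply (g := Ψ) (f := A) (x := 0)
      (by rw [hA0]; exact hΨ.self_of_nhds.mdifferentiableAt (by simp))
      (hAs.self_of_nhds.mdifferentiableAt (by simp)) v
    rw [hA0, hΨd, tder_congr (g := fun y => y) hΨA, tder_id] at h1
    exact h1.symm
  · have h1 : Filter.Tendsto (fun y => (γ : H) • A y) (𝓝 0) (𝓝 z) := by
      have := (hμ.contMDiff_const_smul (γ : H)).continuous.continuousAt (x := z)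
      rw [ContinuousAt, hγz] at this
      exact this.comp hAc
    filter_upwards [hΨA, h1.eventually hAΨ] with y h2 h3
    rw [hΨeq, h2] at h3
    exact h3
  · filter_upwards [hΨA] with y hy ζ
    have h1 := LinearMap.congr_fun (hDΨ (A y)) ζ
    rw [hy, momentDual_apply] at h1
    rw [h1]
    exact (add_sub_cancel (c₀ ζ) (m (A y) ζ)).symm

end Isotropy

/-! ### Tubular coordinates around an orbit -/

section Tube

variable {EH : Type*} [NormedAddCommGroup EH] [NormedSpace ℝ EH] [FiniteDimensional ℝ EH]
  {H : Type*} [TopologicalSpace H] [ChartedSpace EH H] [Group H]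
  {E : Type*} [NormedAddCommGroup E] [NormedSpace ℝ E] [FiniteDimensional ℝ E]
  {M : Type*} [TopologicalSpace M] [ChartedSpace E M] [MulAction H M]
  {Ω : ∀ x : M, TangentSpace 𝓘(ℝ, E) x [⋀^Fin 2]→L[ℝ] ℝ}
  {μ : M → Module.Dual ℝ (GroupLieAlgebra 𝓘(ℝ, EH) H)}

/-- Tubular coordinates around the orbit of `z`: a parametrization `A` of a neighbourhood of `z`,
restricted to a complement `W` of the tangent space of the orbit, makes `(n, w) ↦ n • A w` a local
diffeomorphism at `(1, 0)`, with local inverse `x ↦ (h x, f x)`. -/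
theorem IsHamiltonianAction.exists_tube [LieGroup 𝓘(ℝ, EH) ∞ H] [IsManifold 𝓘(ℝ, E) ∞ M]
    (hμ : IsHamiltonianAction Ω μ) {z : M}
    (hinj : Function.Injective (infAction EH H E z)) {A : E → M} (hA0 : A 0 = z)
    (hAd : tder E E A 0 = ContinuousLinearMap.id ℝ E)
    (hA : ∀ᶠ y in 𝓝 0, ContMDiffAt 𝓘(ℝ, E) 𝓘(ℝ, E) ∞ A y) {W : Submodule ℝ E}
    (hW : IsCompl (LinearMap.range (infAction EH H E z).toLinearMap) W) :
    ∃ (h : M → H) (f : M → W), f z = 0 ∧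
      (∀ᶠ x in 𝓝 z, ContMDiffAt 𝓘(ℝ, E) 𝓘(ℝ, EH) ∞ h x ∧ ContMDiffAt 𝓘(ℝ, E) 𝓘(ℝ, W) ∞ f x ∧
        h x • A (f x) = x) ∧
      ∀ᶠ p : H × W in 𝓝 (1, 0), h (p.1 • A p.2) = p.1 ∧ f (p.1 • A p.2) = p.2 := by
  have : IsManifold 𝓘(ℝ, EH) ∞ H := inferInstance
  let φ := extChartAt 𝓘(ℝ, EH) (1 : H)
  have h1s : (1 : H) ∈ φ.source := mem_extChartAt_source 1
  have h1t : φ 1 ∈ φ.target := φ.map_source h1s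
  have hφ1 : φ.symm (φ 1) = 1 := φ.left_inv h1s
  have hφs : ∀ y ∈ φ.target, ContMDiffAt 𝓘(ℝ, EH) 𝓘(ℝ, EH) ∞ φ.symm y := fun y hy =>
    (contMDiffOn_extChartAt_symm 1).contMDiffAt ((isOpen_extChartAt_target 1).mem_nhds hy)
  obtain ⟨K, hK⟩ : ∃ K : EH ≃L[ℝ] EH, (K : EH →L[ℝ] EH) = tder EH EH φ.symm (φ 1) := by
    obtain ⟨K, hK⟩ := isInvertible_mfderivWithin_extChartAt_symm (I := 𝓘(ℝ, EH)) (x := (1 : H)) h1t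
    rw [mfderivWithin_eq_mfderiv] at hK
    · exact ⟨K, hK⟩
    · simp [uniqueMDiffWithinAt_univ]
    · exact (hφs _ h1t).mdifferentiableAt (by simp)
  -- the map `(n, w) ↦ n • A w`, with `n` in a chart at `1`
  let Θ : EH × W → M := fun p => φ.symm p.1 • A p.2
  have hΘ0 : Θ (φ 1, 0) = z := by simp [Θ, hφ1, hA0]
  have hn : ∀ p : EH × W, p.1 ∈ φ.target →
      ContMDiffAt 𝓘(ℝ, EH × W) 𝓘(ℝ, EH) ∞ (fun p : EH × W => φ.symm p.1) p := fun p hp =>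
    (hφs _ hp).comp p contDiff_fst.contMDiff.contMDiffAt
  have hsub : ContDiff ℝ ∞ fun p : EH × W => (p.2 : E) :=
    (W.subtypeL.comp (ContinuousLinearMap.snd ℝ EH W)).contDiff
  have hm : ∀ p : EH × W, ContMDiffAt 𝓘(ℝ, E) 𝓘(ℝ, E) ∞ A p.2 →
      ContMDiffAt 𝓘(ℝ, EH × W) 𝓘(ℝ, E) ∞ (fun p : EH × W => A p.2) p := fun p hp =>
    hp.comp p hsub.contMDiff.contMDiffAt
  have hΘ : ∀ᶠ p in 𝓝 (φ 1, (0 : W)), ContMDiffAt 𝓘(ℝ, EH × W) 𝓘(ℝ, E) ∞ Θ p := by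
    have e1 : ∀ᶠ p in 𝓝 (φ 1, (0 : W)), p.1 ∈ φ.target :=
      continuousAt_fst.eventually_mem ((isOpen_extChartAt_target 1).mem_nhds h1t)
    have e2 : ∀ᶠ p : EH × W in 𝓝 (φ 1, (0 : W)), ContMDiffAt 𝓘(ℝ, E) 𝓘(ℝ, E) ∞ A (p.2 : E) :=
      (hsub.continuous.continuousAt (x := (φ 1, (0 : W)))).eventually hA
    filter_upwards [e1, e2] with p h1 h2 using hμ.contMDiffAt_smul (hn p h1) (hm p h2)
  have hΘd : ∀ p, tder (EH × W) E Θ (φ 1, 0) p = infAction EH H E z (K p.1) + p.2 := by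
    intro p
    have d1 := (hn (φ 1, 0) h1t).mdifferentiableAt (by simp)
    have hA' : ContMDiffAt 𝓘(ℝ, E) 𝓘(ℝ, E) ∞ A ((0 : W) : E) := hA.self_of_nhds
    have d2 := (hm (φ 1, 0) hA').mdifferentiableAt (by simp)
    have h1 := hμ.tder_smul_of_eq_one d1 d2 hφ1 p
    have h2 := tder_comp_apply (g := φ.symm) (f := fun p : EH × W => p.1) (x := (φ 1, 0))
      ((hφs _ h1t).mdifferentiableAt (by simp)) differentiableAt_fst.mdifferentiableAt p
    have h3 := tder_comp_apply (g := A) (f := fun p : EH × W => (p.2 : E)) (x := (φ 1, 0))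
      (hA'.mdifferentiableAt (by simp)) (hsub.differentiable (by simp) _).mdifferentiableAt p
    have h4 : tder (EH × W) EH (fun p : EH × W => p.1) (φ 1, 0) p = p.1 :=
      congrArg (fun L => L p) (tder_clm (ContinuousLinearMap.fst ℝ EH W) (φ 1, 0))
    have h5 : tder (EH × W) E (fun p : EH × W => (p.2 : E)) (φ 1, 0) p = p.2 :=
      congrArg (fun L => L p)
        (tder_clm (W.subtypeL.comp (ContinuousLinearMap.snd ℝ EH W)) (φ 1, 0))
    have h6 : tder E E A ((0 : W) : E) = ContinuousLinearMap.id ℝ E := hAd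
    rw [h2, h3, h4, h5, h6, ← hK] at h1
    have h7 : A ((0 : W) : E) = z := hA0
    simp only [h7] at h1
    exact h1
  -- its differential is bijective as the tangent space is the sum of `T(H • z)` and `W`
  have hbij : Function.Bijective (tder (EH × W) E Θ (φ 1, 0)) := by
    constructor
    · rw [injective_iff_map_eq_zero]
      intro p hp
      rw [hΘd] at hp
      have h1 : infAction EH H E z (K p.1) ∈ W := by
        rw [eq_neg_of_add_eq_zero_left hp]; exact W.neg_mem p.2.2
      have h2 : infAction EH H E z (K p.1) = 0 :=
        Submodule.disjoint_def.1 hW.disjoint _ ⟨K p.1, rfl⟩ h1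
      rw [h2, zero_add] at hp
      have h3 : K p.1 = 0 := hinj (h2.trans (map_zero _).symm)
      exact Prod.ext (K.injective (h3.trans (map_zero _).symm)) (Subtype.ext hp)
    · intro y
      have hy : y ∈ LinearMap.range (infAction EH H E z).toLinearMap ⊔ W := by
        rw [hW.sup_eq_top]; trivial
      obtain ⟨_, ⟨a, rfl⟩, w, hw, rfl⟩ := Submodule.mem_sup.1 hy
      refine ⟨(K.symm a, ⟨w, hw⟩), ?_⟩
      rw [hΘd]
      simp
  obtain ⟨g, g0, gs, Θg, gΘ⟩ := exists_local_inverse_of_tder_bijective hΘ hbij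
  rw [hΘ0] at g0 gs Θg
  have gc : Filter.Tendsto g (𝓝 z) (𝓝 (φ 1, 0)) := by
    have := gs.self_of_nhds.continuousAt
    rwa [ContinuousAt, g0] at this
  refine ⟨fun x => φ.symm (g x).1, fun x => (g x).2, by simp only [g0], ?_, ?_⟩
  · have e1 : ∀ᶠ x in 𝓝 z, (g x).1 ∈ φ.target :=
      gc.fst_nhds.eventually_mem ((isOpen_extChartAt_target 1).mem_nhds h1t)
    filter_upwards [gs, e1, Θg] with x h1 h2 h3
    exact ⟨(hφs _ h2).comp x (contDiff_fst.contMDiff.contMDiffAt.comp x h1),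
      contDiff_snd.contMDiff.contMDiffAt.comp x h1, h3⟩
  · have hc : Filter.Tendsto (fun p : H × W => (φ p.1, p.2)) (𝓝 (1, 0)) (𝓝 (φ 1, 0)) := by
      refine Filter.Tendsto.prodMk_nhds ?_ continuousAt_snd
      exact (continuousAt_extChartAt (I := 𝓘(ℝ, EH)) (1 : H)).tendsto.comp continuousAt_fst
    have e1 : ∀ᶠ p : H × W in 𝓝 (1, 0), p.1 ∈ φ.source :=
      continuousAt_fst.eventually_mem ((isOpen_extChartAt_source 1).mem_nhds h1s)
    filter_upwards [hc.eventually gΘ, e1] with p h1 h2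
    simp only [Θ, φ.left_inv h2] at h1
    simp only [h1, φ.left_inv h2, and_self]

end Tube

/-! ### Slices in a level of the momentum map -/

section Slice

variable {EH : Type*} [NormedAddCommGroup EH] [NormedSpace ℝ EH]
  {H : Type*} [TopologicalSpace H] [ChartedSpace EH H] [Group H]
  {E : Type*} [NormedAddCommGroup E] [NormedSpace ℝ E]
  {M : Type*} [TopologicalSpace M] [ChartedSpace E M] [MulAction H M]
  {Ω : ∀ x : M, TangentSpace 𝓘(ℝ, E) x [⋀^Fin 2]→L[ℝ] ℝ}

variable (E) in
/-- `Q : ℝᵈ → M` is a slice through `z` for the action of `H` on the level `μ = c`, with linear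
isotropy group `Γ`: orbits meet the slice in orbits of `Γ`, points of the level near the slice
are moved into the slice by a smooth family of elements of `H`, and tangent spaces of the level are
direct sums of the tangent spaces of the orbits and of the slice, `Q` being an immersion. The slice
is all of `ℝᵈ`, so that it defines a global orbifold chart. -/
structure IsSlice (μ : M → Module.Dual ℝ (GroupLieAlgebra 𝓘(ℝ, EH) H))
    (c : Module.Dual ℝ (GroupLieAlgebra 𝓘(ℝ, EH) H)) (z : M) {d : ℕ}
    (Γ : Subgroup (Eucl d ≃L[ℝ] Eucl d)) (Q : Eucl d → M) : Prop where
  finite : Finite Γ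
  smooth : ContMDiff 𝓘(ℝ, Eucl d) 𝓘(ℝ, E) ∞ Q
  level : ∀ u, μ (Q u) = c
  zero : Q 0 = z
  equivariant : ∀ γ ∈ Γ, ∃ h : H, ∀ u, Q (γ u) = h • Q u
  orbit : ∀ u v (h : H), h • Q u = Q v → ∃ γ ∈ Γ, γ u = v
  lift : ∀ u, ∃ (h : M → H) (f : M → Eucl d), ∀ᶠ x in 𝓝 (Q u),
    ContMDiffAt 𝓘(ℝ, E) 𝓘(ℝ, EH) ∞ h x ∧ ContMDiffAt 𝓘(ℝ, E) 𝓘(ℝ, Eucl d) ∞ f x ∧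
      (μ x = c → h x • Q (f x) = x)
  transverse : ∀ u v (ζ : EH),
    tder (Eucl d) E Q u v = infAction EH H E (Q u) ζ → v = 0
  span : ∀ u (w : E), (∀ ζ : EH, momentDeriv μ (Q u) ζ w = 0) →
    ∃ (ζ : EH) (v : Eucl d), infAction EH H E (Q u) ζ + tder (Eucl d) E Q u v = w

variable {μ : M → Module.Dual ℝ (GroupLieAlgebra 𝓘(ℝ, EH) H)}

/-- A level at a coadjoint-invariant value is invariant. -/
theorem IsHamiltonianAction.moment_smul_eq (hμ : IsHamiltonianAction Ω μ)
    {c : Module.Dual ℝ (GroupLieAlgebra 𝓘(ℝ, EH) H)}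
    (hc : ∀ (g : H) (ξ : EH), c (adj EH g ξ) = c ξ) (g : H) (x : M) (hx : μ x = c) :
    μ (g • x) = c :=
  LinearMap.ext fun ζ => by
    have h1 := hμ.moment_smul g x ζ
    rw [hx] at h1
    exact h1.trans (hc _ _)

/-- A finite group acting linearly on `V` acts on a finite-dimensional invariant subspace, written
here as `ℝᵈ`. -/
theorem exists_restricted_rep {Γ : Type*} [Group Γ] (ρ : Γ →* (E →L[ℝ] E)) {V : Submodule ℝ E}
    [FiniteDimensional ℝ E] (hV : ∀ γ, ∀ v ∈ V, ρ γ v ∈ V) :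
    ∃ (d : ℕ) (j : Eucl d →L[ℝ] E) (r : E →L[ℝ] Eucl d) (σ : Γ →* (Eucl d →L[ℝ] Eucl d)),
      (∀ u, j u ∈ V) ∧ (∀ v ∈ V, j (r v) = v) ∧ (∀ u, r (j u) = u) ∧
        ∀ γ u, j (σ γ u) = ρ γ (j u) := by
  let d := Module.finrank ℝ V
  have hfin : Module.finrank ℝ V = Module.finrank ℝ (Eucl d) := by simp [d]
  let e : V ≃L[ℝ] Eucl d := ContinuousLinearEquiv.ofFinrankEq hfin
  obtain ⟨p, hp⟩ := V.subtype.exists_leftInverse_of_injective V.ker_subtype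
  have hp' : ∀ v : V, p v = v := fun v => LinearMap.congr_fun hp v
  let j : Eucl d →L[ℝ] E := V.subtypeL.comp (e.symm : Eucl d →L[ℝ] V)
  let r : E →L[ℝ] Eucl d := (e : V →L[ℝ] Eucl d).comp p.toContinuousLinearMap
  have hjV : ∀ u, j u ∈ V := fun u => (e.symm u).2
  have hjr : ∀ v ∈ V, j (r v) = v := fun v hv => by
    have h1 : p v = ⟨v, hv⟩ := hp' ⟨v, hv⟩
    simp [j, r, h1]
  have hrj : ∀ u, r (j u) = u := fun u => by
    have h1 : p (j u) = e.symm u := hp' (e.symm u)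
    simp [r, h1]
  refine ⟨d, j, r, ⟨⟨fun γ => r.comp ((ρ γ).comp j), ?_⟩, fun a b => ?_⟩, hjV, hjr, hrj,
    fun γ u => hjr _ (hV γ _ (hjV u))⟩
  · ext1 u
    simp [hrj]
  · ext1 u
    simp [hjr _ (hV b _ (hjV u))]

/-- The slice theorem for the action on an invariant regular level of the momentum map, at a point
`z` with finite stabilizer. Let `A` be a parametrization around `z` in which the stabilizer acts
linearly and `μ` is affine, `W` an invariant complement of the tangent space of the orbit, and `D`
the differential of `μ` at `z`. Near `0` the slice is the restriction of `A` to `W ∩ ker D`; an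
equivariant diffeomorphism of `ℝᵈ` onto a small neighbourhood of `0` makes the parameter space all
of `ℝᵈ`. -/
theorem IsHamiltonianAction.exists_slice [FiniteDimensional ℝ EH] [FiniteDimensional ℝ E]
    [LieGroup 𝓘(ℝ, EH) ∞ H] [CompactSpace H] [IsManifold 𝓘(ℝ, E) ∞ M] [T2Space M]
    (hμ : IsHamiltonianAction Ω μ)
    {c : Module.Dual ℝ (GroupLieAlgebra 𝓘(ℝ, EH) H)}
    (hc : ∀ (g : H) (ξ : EH), c (adj EH g ξ) = c ξ)
    (hreg : IsRegularValue (E := E) μ c) {z : M} (hz : μ z = c)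
    [Finite (MulAction.stabilizer H z)] :
    ∃ (d : ℕ) (Γ : Subgroup (Eucl d ≃L[ℝ] Eucl d)) (Q : Eucl d → M), IsSlice E μ c z Γ Q := by
  have : IsTopologicalGroup H := topologicalGroup_of_lieGroup 𝓘(ℝ, EH) ∞
  have := hμ.continuousSMul
  have hinv := hμ.moment_smul_eq hc
  have hinv' : ∀ (g : H) x, μ (g • x) = c → μ x = c := fun g x hx => by
    have := hinv g⁻¹ _ hx
    rwa [inv_smul_smul] at this
  set ρ := hμ.isotropyRep z
  have hinj := hμ.infAction_injective hreg hz
  obtain ⟨A, hA0, hAd, hAs, hAeq, hAμ⟩ := hμ.exists_linearizing_parametrization hc hreg hz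
  obtain ⟨W, hW, hWinv⟩ := exists_invariant_isCompl ρ
    (LinearMap.range (infAction EH H E z).toLinearMap) (by
      rintro γ _ ⟨ζ, rfl⟩
      exact ⟨adj EH (γ : H) ζ, (hμ.isotropyRep_infAction z γ ζ).symm⟩)
  obtain ⟨h, f, hfz, htube, htube'⟩ := hμ.exists_tube hinj hA0 hAd hAs hW
  let D := hμ.momentDual EH z
  obtain ⟨d, j, r, σ, hjV, hjr, hrj, hjσ⟩ := exists_restricted_rep ρ
    (V := W ⊓ LinearMap.ker D) (by
      rintro γ v ⟨hv, hv'⟩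
      refine ⟨hWinv γ v hv, LinearMap.ext fun ζ => ?_⟩
      rw [momentDual_apply, hμ.momentDeriv_isotropyRep]
      exact LinearMap.congr_fun (LinearMap.mem_ker.1 hv') _)
  have hjD : ∀ u (ζ : EH), momentDeriv μ z ζ (j u) = 0 := fun u ζ =>
    LinearMap.congr_fun (LinearMap.mem_ker.1 (hjV u).2) ζ
  let jW : Eucl d →L[ℝ] W := j.codRestrict W fun u => (hjV u).1
  have hjc : Filter.Tendsto j (𝓝 0) (𝓝 0) := by
    have := j.continuous.continuousAt (x := 0); rwa [ContinuousAt, map_zero] at this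
  have hjWc : Filter.Tendsto jW (𝓝 0) (𝓝 0) := by
    have := jW.continuous.continuousAt (x := 0); rwa [ContinuousAt, map_zero] at this
  have hAc : Filter.Tendsto A (𝓝 0) (𝓝 z) := by
    have := hAs.self_of_nhds.continuousAt; rwa [ContinuousAt, hA0] at this
  have hAjc : Filter.Tendsto (fun u => A (j u)) (𝓝 0) (𝓝 z) := hAc.comp hjc
  have hfc : Filter.Tendsto (fun x => (f x : E)) (𝓝 z) (𝓝 0) := by
    have := (continuous_subtype_val.continuousAt).comp htube.self_of_nhds.2.1.continuousAt
    rw [ContinuousAt, Function.comp_apply, hfz] at this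
    exact this
  -- the properties `c1` to `c7` hold for all small `u`; the slice is shrunk to a region of validity
  have c1 : ∀ᶠ u in 𝓝 (0 : Eucl d), ContMDiffAt 𝓘(ℝ, E) 𝓘(ℝ, E) ∞ A (j u) := hjc.eventually hAs
  have c2 : ∀ᶠ u in 𝓝 (0 : Eucl d), ∀ γ, A (j (σ γ u)) = (γ : H) • A (j u) := by
    rw [Filter.eventually_all]
    intro γ
    filter_upwards [hjc.eventually (hAeq γ)] with u hu
    rw [hjσ]; exact hu
  have c3 : ∀ᶠ u in 𝓝 (0 : Eucl d), μ (A (j u)) = c := by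
    filter_upwards [hjc.eventually hAμ] with u hu
    exact LinearMap.ext fun ζ =>
      (hu ζ).trans ((congrArg (c ζ + ·) (hjD u ζ)).trans (add_zero _))
  -- in tubular coordinates the level is `W ∩ ker D`, because `μ` is affine in the coordinates `A`
  have c4 : ∀ᶠ u in 𝓝 (0 : Eucl d), ∀ᶠ x in 𝓝 (A (j u)),
      (ContMDiffAt 𝓘(ℝ, E) 𝓘(ℝ, EH) ∞ h x ∧ ContMDiffAt 𝓘(ℝ, E) 𝓘(ℝ, W) ∞ f x ∧
        h x • A (f x) = x) ∧ (μ x = c → j (r (f x)) = f x) := by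
    refine hAjc.eventually (Filter.Eventually.eventually_nhds ?_)
    filter_upwards [htube, hfc.eventually hAμ] with x h1 h2
    refine ⟨h1, fun hx => hjr _ ⟨(f x).2, LinearMap.mem_ker.2 (LinearMap.ext fun ζ => ?_)⟩⟩
    have h3 : μ (A (f x)) = c := hinv' (h x) _ (by rw [h1.2.2, hx])
    have h4 := h2 ζ
    rw [h3] at h4
    rw [momentDual_apply]
    exact left_eq_add.1 h4
  have c5 : ∀ᶠ u in 𝓝 (0 : Eucl d), ∀ᶠ p : H × W in 𝓝 (1, jW u),
      h (p.1 • A p.2) = p.1 ∧ f (p.1 • A p.2) = p.2 :=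
    (Filter.Tendsto.prodMk_nhds tendsto_const_nhds hjWc).eventually htube'.eventually_nhds
  -- nearby points of the slice in the same orbit are related by the stabilizer: as `H` is compact,
  -- it suffices to consider elements of `H` near a given `n`; if `n` fixes `z`, uniqueness of
  -- tubular coordinates applies, otherwise `n` separates the two points
  have c6 : ∀ᶠ q : Eucl d × Eucl d in 𝓝 (0, 0), ∀ n : H,
      n • A (j q.1) = A (j q.2) → ∃ γ, σ γ q.1 = q.2 := by
    have key : ∀ n ∈ (Set.univ : Set H), ∀ᶠ p : (Eucl d × Eucl d) × H in 𝓝 ((0, 0), n),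
        p.2 • A (j p.1.1) = A (j p.1.2) → ∃ γ, σ γ p.1.1 = p.1.2 := by
      intro n _
      have t1 : Filter.Tendsto (fun p : (Eucl d × Eucl d) × H => p.1.1) (𝓝 ((0, 0), n)) (𝓝 0) :=
        (continuous_fst.comp continuous_fst).continuousAt
      have t2 : Filter.Tendsto (fun p : (Eucl d × Eucl d) × H => p.1.2) (𝓝 ((0, 0), n)) (𝓝 0) :=
        (continuous_snd.comp continuous_fst).continuousAt
      have t3 : Filter.Tendsto (fun p : (Eucl d × Eucl d) × H => p.2) (𝓝 ((0, 0), n)) (𝓝 n) :=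
        continuous_snd.continuousAt
      by_cases hn : n ∈ MulAction.stabilizer H z
      · let γ : MulAction.stabilizer H z := ⟨n, hn⟩
        have hσc : Filter.Tendsto (fun p : (Eucl d × Eucl d) × H => σ γ p.1.1) (𝓝 ((0, 0), n))
            (𝓝 0) := by
          have := ((σ γ).continuous.continuousAt (x := 0)).tendsto
          rw [map_zero] at this
          exact this.comp t1
        have t4 : Filter.Tendsto (fun p : (Eucl d × Eucl d) × H => p.2 * n⁻¹) (𝓝 ((0, 0), n))
            (𝓝 1) := by
          have := t3.mul_const n⁻¹
          rwa [mul_inv_cancel] at this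
        filter_upwards [t1.eventually c2,
          (t4.prodMk_nhds (hjWc.comp hσc)).eventually htube',
          ((tendsto_const_nhds (x := (1 : H))).prodMk_nhds (hjWc.comp t2)).eventually htube']
          with p h1 h2 h3 h4
        refine ⟨γ, ?_⟩
        have e1 : (p.2 * n⁻¹) • A (j (σ γ p.1.1)) = A (j p.1.2) := by
          rw [h1 γ, smul_smul]
          simpa [γ] using h4
        have e2 : f (A (j p.1.2)) = jW (σ γ p.1.1) := by
          have := h2.2
          simp only [Function.comp_apply] at this
          rw [← this]
          exact congrArg f e1.symm
        have e3 : f (A (j p.1.2)) = jW p.1.2 := by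
          have := h3.2
          simp only [Function.comp_apply, one_smul] at this
          exact this
        have e4 : j (σ γ p.1.1) = j p.1.2 := congrArg Subtype.val (e2.symm.trans e3)
        rw [← hrj (σ γ p.1.1), e4, hrj]
      · have hne : n • z ≠ z := hn
        have s1 : Filter.Tendsto (fun p : (Eucl d × Eucl d) × H => p.2 • A (j p.1.1))
            (𝓝 ((0, 0), n)) (𝓝 (n • z)) := t3.smul (hAjc.comp t1)
        have s2 : Filter.Tendsto (fun p : (Eucl d × Eucl d) × H => A (j p.1.2))
            (𝓝 ((0, 0), n)) (𝓝 z) := hAjc.comp t2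
        filter_upwards [(s1.prodMk_nhds s2).eventually (isOpen_ne_fun continuous_fst
          continuous_snd |>.mem_nhds hne)] with p hp h
        exact absurd h hp
    have := isCompact_univ.eventually_forall_of_forall_eventually
      (P := fun (q : Eucl d × Eucl d) (n : H) => n • A (j q.1) = A (j q.2) → ∃ γ, σ γ q.1 = q.2) key
    filter_upwards [this] with q hq n using hq n trivial
  have c7 : ∀ᶠ u in 𝓝 (0 : Eucl d), ∀ᶠ y in 𝓝 (j u),
      ∀ ζ : EH, μ (A y) ζ = c ζ + momentDeriv μ z ζ y := hjc.eventually hAμ.eventually_nhds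
  obtain ⟨R, hR, hall⟩ := Metric.eventually_nhds_iff.1
    (c1.and (c2.and (c3.and (c4.and (c5.and c7)))))
  obtain ⟨R', hR', hall'⟩ := Metric.eventually_nhds_iff.1 c6
  obtain ⟨s, t, hs, hs0, hsR, hts, hst, hsσ⟩ := exists_equivariant_shrinking σ
    (lt_min hR hR')
  have hall : ∀ u, _ := fun u => hall (y := s u)
    (by rw [dist_zero_right]; exact (hsR u).trans_le (min_le_left _ _))
  have hall' : ∀ u v, _ := fun u v => hall' (y := (s u, s v)) (by
    rw [Prod.dist_eq, dist_zero_right, dist_zero_right]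
    exact max_lt ((hsR u).trans_le (min_le_right _ _)) ((hsR v).trans_le (min_le_right _ _)))
  have hsd : ∀ u, DifferentiableAt ℝ s u := fun u => hs.differentiable (by simp) u
  have htd : ∀ u, DifferentiableAt ℝ t (s u) := fun u =>
    (hst u).self_of_nhds.1.differentiableAt (by simp)
  have hst1 : ∀ u v, fderiv ℝ t (s u) (fderiv ℝ s u v) = v := fun u v => by
    have h1 := fderiv_comp u (htd u) (hsd u)
    have h2 : t ∘ s = id := funext hts
    rw [h2, fderiv_id] at h1
    exact (congrArg (fun L => L v) h1).symm
  have hst2 : ∀ u v, fderiv ℝ s u (fderiv ℝ t (s u) v) = v := fun u v => by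
    have h0 := hsd u
    rw [← hts u] at h0
    have h1 := fderiv_comp (s u) h0 (htd u)
    have h2 : s ∘ t =ᶠ[𝓝 (s u)] id := (hst u).mono fun w hw => hw.2
    rw [h2.fderiv_eq, fderiv_id, hts] at h1
    exact (congrArg (fun L => L v) h1).symm
  have hQd : ∀ u v, tder (Eucl d) E (fun u => A (j (s u))) u v =
      tder E E A (j (s u)) (j (fderiv ℝ s u v)) := fun u v => by
    have h1 : DifferentiableAt ℝ (fun u => j (s u)) u := j.differentiableAt.comp u (hsd u)
    rw [tder_comp_apply (g := A) (f := fun u => j (s u)) ((hall u).1.mdifferentiableAt (by simp))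
      h1.mdifferentiableAt,
      tder_clm_comp j (hsd u).mdifferentiableAt, tder_eq_fderiv]
  have hh1 : ∀ u, h (A (j (s u))) = 1 := fun u => by
    have := (hall u).2.2.2.2.1.self_of_nhds.1
    rwa [one_smul] at this
  have hf1 : ∀ u, f (A (j (s u))) = jW (s u) := fun u => by
    have := (hall u).2.2.2.2.1.self_of_nhds.2
    rwa [one_smul] at this
  have hhd : ∀ u, MDifferentiableAt 𝓘(ℝ, E) 𝓘(ℝ, EH) h (A (j (s u))) := fun u =>
    (hall u).2.2.2.1.self_of_nhds.1.1.mdifferentiableAt (by simp)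
  have hfd : ∀ u, MDifferentiableAt 𝓘(ℝ, E) 𝓘(ℝ, W) f (A (j (s u))) := fun u =>
    (hall u).2.2.2.1.self_of_nhds.1.2.1.mdifferentiableAt (by simp)
  have hAd' : ∀ u, MDifferentiableAt 𝓘(ℝ, E) 𝓘(ℝ, E) A (j (s u)) := fun u =>
    (hall u).1.mdifferentiableAt (by simp)
  -- the linear isotropy group
  let τ : MulAction.stabilizer H z →* (Eucl d ≃L[ℝ] Eucl d) :=
    (ContinuousLinearEquiv.unitsEquiv ℝ (Eucl d)).toMonoidHom.comp σ.toHomUnits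
  have hτ : ∀ γ u, τ γ u = σ γ u := fun γ u => rfl
  refine ⟨d, τ.range, fun u => A (j (s u)), ?_⟩
  constructor
  · exact Set.finite_range τ
  · exact fun u => (hall u).1.comp u (j.contDiff.comp hs).contMDiff.contMDiffAt
  · exact fun u => (hall u).2.2.1
  · simp only [hs0, map_zero, hA0]
  · rintro _ ⟨γ, rfl⟩
    refine ⟨(γ : H), fun u => ?_⟩
    rw [hτ, hsσ]
    exact (hall u).2.1 γ
  · intro u v n hn
    obtain ⟨γ, hγ⟩ := hall' u v n hn
    refine ⟨τ γ, ⟨γ, rfl⟩, ?_⟩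
    rw [hτ, ← hts v]
    change σ γ (s u) = s v at hγ
    rw [← hγ, ← hsσ, hts]
  · intro u
    refine ⟨h, fun x => t (r (f x)), ?_⟩
    have hc0 : ContinuousAt (fun x => r (f x)) (A (j (s u))) :=
      r.continuous.continuousAt.comp
        (continuous_subtype_val.continuousAt.comp (hfd u).continuousAt)
    have h0 : r (f (A (j (s u)))) = s u := by
      rw [hf1]; exact hrj _
    rw [ContinuousAt, h0] at hc0
    filter_upwards [(hall u).2.2.2.1, hc0.eventually (hst u)] with x h1 h2
    refine ⟨h1.1.1, ?_, fun hx => ?_⟩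
    · exact h2.1.contMDiffAt.comp x
        ((r.comp W.subtypeL).contDiff.contMDiff.contMDiffAt.comp x h1.1.2.1)
    · simp only [h2.2, h1.2 hx]
      exact h1.1.2.2
  · intro u v ζ huv
    rw [hQd] at huv
    -- the differential of `f` is injective on the slice and vanishes on the orbit
    have e1 : tder E W f (A (j (s u))) (tder E E A (j (s u)) (j (fderiv ℝ s u v))) =
        jW (fderiv ℝ s u v) := by
      have h1 : (fun w : W => f (A w)) =ᶠ[𝓝 (jW (s u))] fun w => w := by
        have : Filter.Tendsto (fun w : W => ((1 : H), w)) (𝓝 (jW (s u))) (𝓝 (1, jW (s u))) :=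
          Filter.Tendsto.prodMk_nhds tendsto_const_nhds Filter.tendsto_id
        filter_upwards [this.eventually (hall u).2.2.2.2.1] with w hw
        simpa using hw.2
      have h2 := tder_comp_apply (g := f) (f := fun w : W => A w) (x := jW (s u)) (hfd u)
        ((hAd' u).comp (jW (s u)) W.subtypeL.differentiableAt.mdifferentiableAt)
        (jW (fderiv ℝ s u v))
      rw [tder_congr h1, tder_id] at h2
      have h3 := tder_comp_apply (g := A) (f := fun w : W => W.subtypeL w) (x := jW (s u))
        (hAd' u) W.subtypeL.differentiableAt.mdifferentiableAt (jW (fderiv ℝ s u v))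
      rw [tder_clm] at h3
      exact (h2.trans (congrArg _ h3)).symm
    have e2 : tder E W f (A (j (s u))) (infAction EH H E (A (j (s u))) ζ) = 0 := by
      have h1 : (fun n : H => f (n • A (j (s u)))) =ᶠ[𝓝 1] fun _ => jW (s u) := by
        have : Filter.Tendsto (fun n : H => (n, jW (s u))) (𝓝 1) (𝓝 (1, jW (s u))) :=
          Filter.Tendsto.prodMk_nhds Filter.tendsto_id tendsto_const_nhds
        filter_upwards [this.eventually (hall u).2.2.2.2.1] with w hw
        exact hw.2
      have h2 := tder_comp_apply (g := f) (f := fun n : H => n • A (j (s u))) (x := 1)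
        (by rw [one_smul]; exact hfd u) (hμ.mdifferentiable_smul_const 1 _) ζ
      rw [tder_congr h1, tder_const, one_smul] at h2
      exact h2.symm
    rw [huv, e2] at e1
    have e3 : fderiv ℝ s u v = 0 := by
      rw [← hrj (fderiv ℝ s u v)]
      have : j (fderiv ℝ s u v) = 0 := congrArg Subtype.val e1.symm
      rw [this, map_zero]
    rw [← hst1 u v, e3, map_zero]
  · intro u w hw
    set x₀ := A (j (s u)) with hx₀
    let w' : W := tder E W f x₀ w
    -- differentiate `x = h x • A (f x)` at the point of the slice
    have e0 : MDifferentiableAt 𝓘(ℝ, E) 𝓘(ℝ, E) (fun x => (f x : E)) x₀ :=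
      W.subtypeL.differentiableAt.mdifferentiableAt.comp x₀ (hfd u)
    have hfx : (f x₀ : E) = j (s u) := congrArg Subtype.val (hf1 u)
    have e1 : MDifferentiableAt 𝓘(ℝ, E) 𝓘(ℝ, E) (fun x => A (f x)) x₀ :=
      MDifferentiableAt.comp (I' := 𝓘(ℝ, E)) x₀ (by rw [hfx]; exact hAd' u) e0
    have e2 := hμ.tder_smul_of_eq_one (hhd u) e1 (hh1 u) w
    have e3 : (fun x => h x • A (f x)) =ᶠ[𝓝 x₀] fun x => x :=
      (hall u).2.2.2.1.mono fun x hx => hx.1.2.2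
    rw [tder_congr e3, tder_id] at e2
    have e4 : tder E E (fun x => A (f x)) x₀ w = tder E E A (j (s u)) w' := by
      have := tder_comp_apply (g := A) (f := fun x => (f x : E)) (x := x₀)
        (by rw [hfx]; exact hAd' u) e0 w
      rw [this, hfx]
      congr 1
      exact tder_clm_comp W.subtypeL (hfd u) w
    have e5 : A (f x₀) = x₀ := by rw [hfx]
    rw [e4, e5] at e2
    -- `μ` is constant on orbits, so the component of `w` in `W` is also in the kernel of `dμ`,
    -- which is the constant `D` in the coordinates `A`
    have hwD : (w' : E) ∈ W ⊓ LinearMap.ker D := by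
      refine ⟨w'.2, LinearMap.mem_ker.2 (LinearMap.ext fun ζ => ?_)⟩
      have h1 := hw ζ
      have h2 : w = infAction EH H E x₀ (tder E EH h x₀ w) + tder E E A (j (s u)) w' := e2
      rw [h2, map_add, hμ.momentDeriv_infAction (fun g => hinv g _ (hall u).2.2.1), zero_add] at h1
      have h3 := tder_comp_apply (g := fun x => μ x ζ) (f := A) (x := j (s u))
        (hμ.mdifferentiable_moment ζ _) (hAd' u) (w' : E)
      have h4 : (fun y => μ (A y) ζ) =ᶠ[𝓝 (j (s u))] fun y => c ζ + momentDeriv μ z ζ y :=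
        (hall u).2.2.2.2.2.mono fun y hy => hy ζ
      rw [tder_congr h4, tder_add mdifferentiableAt_const
        (momentDeriv μ z ζ).differentiableAt.mdifferentiableAt, tder_const, tder_clm,
        zero_add] at h3
      exact h3.trans h1
    refine ⟨tder E EH h x₀ w, fderiv ℝ t (s u) (r w'), ?_⟩
    rw [hQd, hst2, hjr _ hwD]
    exact e2.symm

end Slice

/-! ### Independence of the lift -/

section OrbitEquivalence

variable {EH : Type*} [NormedAddCommGroup EH] [NormedSpace ℝ EH] [FiniteDimensional ℝ EH]
  {H : Type*} [TopologicalSpace H] [ChartedSpace EH H] [Group H]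
  {E : Type*} [NormedAddCommGroup E] [NormedSpace ℝ E] [FiniteDimensional ℝ E]
  {M : Type*} [TopologicalSpace M] [ChartedSpace E M] [MulAction H M]
  {Ω : ∀ x : M, TangentSpace 𝓘(ℝ, E) x [⋀^Fin 2]→L[ℝ] ℝ}
  {μ : M → Module.Dual ℝ (GroupLieAlgebra 𝓘(ℝ, EH) H)}

/-- Two lifts to the level of the same map to the orbit space pull `Ω` back to the same form. In a
slice the lifts differ by elements of a finite group; on a dense open set these can be chosen
locally constant, and the equality extends to all points by continuity. -/
theorem IsHamiltonianAction.pull_eq_pull_of_orbit [LieGroup 𝓘(ℝ, EH) ∞ H] [CompactSpace H]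
    [IsManifold 𝓘(ℝ, E) ∞ M] [T2Space M]
    (hμ : IsHamiltonianAction Ω μ)
    (hΩ : ∀ x₀ : M, ContDiffOn ℝ ∞ (formInChart Ω x₀) (extChartAt 𝓘(ℝ, E) x₀).target)
    {c : Module.Dual ℝ (GroupLieAlgebra 𝓘(ℝ, EH) H)}
    (hc : ∀ (g : H) (ξ : EH), c (adj EH g ξ) = c ξ)
    (hreg : IsRegularValue (E := E) μ c)
    (hfin : ∀ z, μ z = c → Finite (MulAction.stabilizer H z)) {n : ℕ} {P P' : Eucl n → M}
    (hP : ContMDiff 𝓘(ℝ, Eucl n) 𝓘(ℝ, E) ∞ P) (hP' : ContMDiff 𝓘(ℝ, Eucl n) 𝓘(ℝ, E) ∞ P')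
    (hPc : ∀ t, μ (P t) = c) (hPc' : ∀ t, μ (P' t) = c) {t : Eucl n}
    (hPP' : ∀ᶠ s in 𝓝 t, ∃ h : H, h • P s = P' s) : pull Ω P t = pull Ω P' t := by
  have hinv := hμ.moment_smul_eq hc
  obtain ⟨h₀, hh₀⟩ := hPP'.self_of_nhds
  have hP'' : ContMDiff 𝓘(ℝ, Eucl n) 𝓘(ℝ, E) ∞ (fun s => h₀⁻¹ • P' s) :=
    (hμ.contMDiff_const_smul h₀⁻¹).comp hP'
  -- move `P'` so that it agrees with `P` at `t`
  rw [← hμ.pull_const_smul h₀⁻¹ (hP'.mdifferentiable (by simp) t)]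
  set P'' : Eucl n → M := fun s => h₀⁻¹ • P' s with hP''def
  have hPc'' : ∀ t, μ (P'' t) = c := fun t => hinv _ _ (hPc' t)
  have hPt : P'' t = P t := by simp only [hP''def, ← hh₀, inv_smul_smul]
  have := hfin (P t) (hPc t)
  obtain ⟨d, Γ, Q, hQ⟩ := hμ.exists_slice hc hreg (hPc t)
  obtain ⟨h, f, hf⟩ := hQ.lift 0
  rw [hQ.zero] at hf
  have hev : ∀ᶠ s in 𝓝 t, (ContMDiffAt 𝓘(ℝ, E) 𝓘(ℝ, EH) ∞ h (P s) ∧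
      ContMDiffAt 𝓘(ℝ, E) 𝓘(ℝ, Eucl d) ∞ f (P s) ∧ (μ (P s) = c → h (P s) • Q (f (P s)) = P s)) ∧
      (ContMDiffAt 𝓘(ℝ, E) 𝓘(ℝ, EH) ∞ h (P'' s) ∧ ContMDiffAt 𝓘(ℝ, E) 𝓘(ℝ, Eucl d) ∞ f (P'' s) ∧
        (μ (P'' s) = c → h (P'' s) • Q (f (P'' s)) = P'' s)) ∧ ∃ h : H, h • P s = P' s := by
    have c2 : Filter.Tendsto P'' (𝓝 t) (𝓝 (P t)) := by
      rw [← hPt]; exact hP''.continuous.continuousAt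
    exact (hP.continuous.continuousAt.eventually hf).and ((c2.eventually hf).and hPP')
  obtain ⟨U, hU, hUo, htU⟩ := eventually_nhds_iff.1 hev
  obtain ⟨θ, hθ, hθU, hθt⟩ := exists_smooth_localization hUo htU
  have hFs : ContDiff ℝ ∞ fun s => f (P (θ s)) := by
    rw [← contMDiff_iff_contDiff]
    exact fun s => (hU _ (hθU s)).1.2.1.comp s ((hP _).comp s hθ.contMDiff.contMDiffAt)
  have hFs' : ContDiff ℝ ∞ fun s => f (P'' (θ s)) := by
    rw [← contMDiff_iff_contDiff]
    exact fun s => (hU _ (hθU s)).2.1.2.1.comp s ((hP'' _).comp s hθ.contMDiff.contMDiffAt)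
  have hlift : ∀ (R : Eucl n → M) (hR : ContMDiff 𝓘(ℝ, Eucl n) 𝓘(ℝ, E) ∞ R)
      (hRf : ContDiff ℝ ∞ fun s => f (R (θ s)))
      (_ : ∀ s ∈ U, ContMDiffAt 𝓘(ℝ, E) 𝓘(ℝ, EH) ∞ h (R s) ∧ h (R s) • Q (f (R s)) = R s),
      pull Ω R t = pull Ω (fun s => Q (f (R (θ s)))) t := by
    intro R hR hRf hRU
    have e1 : R =ᶠ[𝓝 t] fun s => h (R s) • Q (f (R (θ s))) := by
      filter_upwards [hθt, hUo.mem_nhds htU] with s h1 h2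
      simp only [id] at h1
      rw [h1, (hRU s h2).2]
    rw [pull_congr e1]
    exact hμ.pull_smul hinv
      (((hRU t htU).1.comp t (hR t)).mdifferentiableAt (by simp))
      ((hQ.smooth.comp hRf.contMDiff).mdifferentiable (by simp) t)
      (Filter.Eventually.of_forall fun s => hQ.level _)
  rw [hlift P hP hFs fun s hs => ⟨(hU s hs).1.1, (hU s hs).1.2.2 (hPc s)⟩,
    hlift P'' hP'' hFs' fun s hs => ⟨(hU s hs).2.1.1, (hU s hs).2.1.2.2 (hPc'' s)⟩]
  -- the lifts to the slice differ pointwise by elements of the finite group `Γ`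
  have hΓ : ∀ s, ∃ γ : Γ, (γ : Eucl d ≃L[ℝ] Eucl d) (f (P (θ s))) = f (P'' (θ s)) := by
    intro s
    obtain ⟨⟨-, -, h1⟩, ⟨-, -, h2⟩, k, hk⟩ := hU _ (hθU s)
    have e : ((h (P'' (θ s)))⁻¹ * h₀⁻¹ * k * h (P (θ s))) • Q (f (P (θ s))) =
        Q (f (P'' (θ s))) := by
      rw [mul_smul, h1 (hPc _), mul_smul, hk, mul_smul, inv_smul_eq_iff, h2 (hPc'' _)]
    obtain ⟨γ, hγ, hγe⟩ := hQ.orbit _ _ _ e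
    exact ⟨⟨γ, hγ⟩, hγe⟩
  have := hQ.finite
  -- the closed sets where a given element of `Γ` relates the lifts cover the space, so that the
  -- union of their interiors is dense
  let C : Γ → Set (Eucl n) := fun γ =>
    {s | (γ : Eucl d ≃L[ℝ] Eucl d) (f (P (θ s))) = f (P'' (θ s))}
  have hCc : ∀ γ, IsClosed (C γ) := fun γ =>
    isClosed_eq ((γ : Eucl d ≃L[ℝ] Eucl d).continuous.comp hFs.continuous) hFs'.continuous
  have hdense : Dense (⋃ γ, interior (C γ)) :=
    dense_iUnion_interior_of_closed hCc
      (Set.eq_univ_of_forall fun s => Set.mem_iUnion.2 (hΓ s))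
  have hQs := hQ.smooth.comp hFs.contMDiff
  have hQs' := hQ.smooth.comp hFs'.contMDiff
  have hcl : IsClosed {s | pull Ω (fun s => Q (f (P (θ s)))) s =
      pull Ω (fun s => Q (f (P'' (θ s)))) s} :=
    isClosed_eq (contDiff_pull hΩ hQs).continuous (contDiff_pull hΩ hQs').continuous
  have hsub : (⋃ γ, interior (C γ)) ⊆ {s | pull Ω (fun s => Q (f (P (θ s)))) s =
      pull Ω (fun s => Q (f (P'' (θ s)))) s} := by
    intro s hs
    obtain ⟨γ, hγ⟩ := Set.mem_iUnion.1 hs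
    obtain ⟨k, hk⟩ := hQ.equivariant γ γ.2
    have e1 : (fun s => Q (f (P'' (θ s)))) =ᶠ[𝓝 s] fun s => k • Q (f (P (θ s))) := by
      filter_upwards [mem_interior_iff_mem_nhds.1 hγ] with r hr
      rw [← hk]
      exact congrArg Q (Eq.symm hr)
    change pull Ω _ s = pull Ω _ s
    rw [pull_congr e1]
    exact (hμ.pull_const_smul k (hQs.mdifferentiable (by simp) s)).symm
  have ht := (hdense.mono hsub) t
  rw [hcl.closure_eq] at ht
  exact ht

end OrbitEquivalence

/-! ### Closed Lie subgroups -/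

section LieSubgroup

variable {EN : Type*} [NormedAddCommGroup EN] [NormedSpace ℝ EN]
  {EG : Type*} [NormedAddCommGroup EG] [NormedSpace ℝ EG]
  {G : Type*} [TopologicalSpace G] [ChartedSpace EG G] [Group G]
  {N : Subgroup G} [ChartedSpace EN N]

variable (EN EG N) in
/-- The inclusion of Lie algebras, on the model spaces of the groups. -/
def incl : EN →L[ℝ] EG := tder EN EG (fun n : N => (n : G)) 1

/-- A differentiable map to `G` with values in a closed Lie subgroup `N` and passing through `1` has
velocities in the Lie algebra of `N`: near `1` the inclusion of `N` has a smooth left inverse, so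
the map is differentiable as a map to `N`. -/
theorem IsClosedLieSubgroup.tder_mem_lieSubspace [FiniteDimensional ℝ EN]
    [FiniteDimensional ℝ EG]
    [LieGroup 𝓘(ℝ, EG) ∞ G] [LieGroup 𝓘(ℝ, EN) ∞ N] (hN : IsClosedLieSubgroup (EG := EG) EN N)
    {F : Type*} [NormedAddCommGroup F] [NormedSpace ℝ F]
    {X : Type*} [TopologicalSpace X] [ChartedSpace F X] {f : X → G} {x : X}
    (hf : MDifferentiableAt 𝓘(ℝ, F) 𝓘(ℝ, EG) f x) (hfN : ∀ y, f y ∈ N) (hfx : f x = 1) (v : F) :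
    ∃ ζ, incl EN EG N ζ = tder F EG f x v := by
  let φ := extChartAt 𝓘(ℝ, EG) (1 : G)
  have h1s : (1 : G) ∈ φ.source := mem_extChartAt_source 1
  have hφs : ∀ y ∈ φ.source, ContMDiffAt 𝓘(ℝ, EG) 𝓘(ℝ, EG) ∞ φ y := fun y hy =>
    contMDiffAt_extChartAt' (by simpa [φ] using hy)
  obtain ⟨K, hK⟩ : ∃ K : EG ≃L[ℝ] EG, (K : EG →L[ℝ] EG) = tder EG EG φ 1 :=
    isInvertible_mfderiv_extChartAt (I := 𝓘(ℝ, EG)) (x := (1 : G)) h1s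
  have hinj : Function.Injective (incl EN EG N) := hN.immersion 1
  -- a left inverse of the derivative of the inclusion in coordinates
  obtain ⟨S, hS⟩ : ∃ S : EG →L[ℝ] EN, ∀ ζ, S (incl EN EG N ζ) = ζ := by
    obtain ⟨S, hS⟩ := (incl EN EG N).exists_leftInverse_of_injective
      (LinearMap.ker_eq_bot.2 hinj)
    exact ⟨S.toContinuousLinearMap, fun ζ => congrArg (fun L => L ζ) hS⟩
  let L : EG →L[ℝ] EN := S.comp (K.symm : EG →L[ℝ] EG)
  have hLφ : ∀ y ∈ φ.source, ContMDiffAt 𝓘(ℝ, EG) 𝓘(ℝ, EN) ∞ (fun g => L (φ g)) y := fun y hy =>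
    L.contDiff.contMDiff.contMDiffAt.comp y (hφs y hy)
  let k : N → EN := fun n => L (φ n)
  have hk : ∀ᶠ n : N in 𝓝 1, ContMDiffAt 𝓘(ℝ, EN) 𝓘(ℝ, EN) ∞ k n := by
    have : ∀ᶠ n : N in 𝓝 1, (n : G) ∈ φ.source :=
      continuous_subtype_val.continuousAt.eventually_mem (extChartAt_source_mem_nhds (1 : G))
    filter_upwards [this] with n hn
    exact (hLφ _ hn).comp n (hN.smooth n)
  have hkd : tder EN EN k 1 = ContinuousLinearMap.id ℝ EN := by
    ext ζ
    have d1 : MDifferentiableAt 𝓘(ℝ, EG) 𝓘(ℝ, EN) (fun g => L (φ g)) ((1 : N) : G) :=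
      (hLφ 1 h1s).mdifferentiableAt (by simp)
    rw [tder_comp_apply (g := fun g => L (φ g)) d1 ((hN.smooth 1).mdifferentiableAt (by simp))]
    change tder EG EN (fun g => L (φ g)) 1 (incl EN EG N ζ) = ζ
    rw [tder_clm_comp L ((hφs 1 h1s).mdifferentiableAt (by simp)), ← hK]
    simp [L, hS]
  obtain ⟨g, g0, gs, -, gk⟩ := exists_local_inverse_of_tder_bijective hk
    (by rw [hkd]; exact Function.bijective_id)
  let f' : X → N := fun y => ⟨f y, hfN y⟩
  have hf'x : f' x = 1 := Subtype.ext hfx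
  have hf'c : ContinuousAt f' x := hf.continuousAt.codRestrict hfN
  have hf'd : MDifferentiableAt 𝓘(ℝ, F) 𝓘(ℝ, EN) f' x := by
    have e1 : f' =ᶠ[𝓝 x] fun y => g (L (φ (f y))) := by
      rw [ContinuousAt, hf'x] at hf'c
      filter_upwards [hf'c.eventually gk] with y hy using hy.symm
    refine MDifferentiableAt.congr_of_eventuallyEq ?_ e1
    have d1 : MDifferentiableAt 𝓘(ℝ, F) 𝓘(ℝ, EN) (fun y => L (φ (f y))) x :=
      MDifferentiableAt.comp (I' := 𝓘(ℝ, EG)) (g := fun g => L (φ g)) x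
        (by rw [hfx]; exact (hLφ 1 h1s).mdifferentiableAt (by simp)) hf
    refine MDifferentiableAt.comp (I' := 𝓘(ℝ, EN)) (g := g) x ?_ d1
    rw [hfx]
    exact gs.self_of_nhds.mdifferentiableAt (by simp)
  refine ⟨tder F EN f' x v, ?_⟩
  have h1 := tder_comp_apply (g := fun n : N => (n : G)) (f := f') (x := x)
    ((hN.smooth _).mdifferentiableAt (by simp)) hf'd v
  rw [hf'x] at h1
  exact h1.symm

variable [FiniteDimensional ℝ EN] [FiniteDimensional ℝ EG] [LieGroup 𝓘(ℝ, EG) ∞ G]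
  [LieGroup 𝓘(ℝ, EN) ∞ N]

/-- The adjoint action of `G` preserves the Lie algebra of a normal subgroup. -/
theorem IsClosedLieSubgroup.adj_incl [N.Normal] (hN : IsClosedLieSubgroup (EG := EG) EN N) (g : G)
    (ζ : EN) : ∃ ζ', incl EN EG N ζ' = adj EG g (incl EN EG N ζ) := by
  have d1 : MDifferentiableAt 𝓘(ℝ, EG) 𝓘(ℝ, EG) (fun x : G => g * x * g⁻¹) ((1 : N) : G) :=
    (contMDiff_conj (EH := EG) g 1).mdifferentiableAt (by simp)
  have d2 : MDifferentiableAt 𝓘(ℝ, EN) 𝓘(ℝ, EG) (fun n : N => (n : G)) 1 :=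
    (hN.smooth 1).mdifferentiableAt (by simp)
  obtain ⟨ζ', h⟩ := hN.tder_mem_lieSubspace (f := fun n : N => g * n * g⁻¹) (x := 1)
    (d1.comp 1 d2) (fun n => Subgroup.Normal.conj_mem ‹_› _ n.2 g) (by simp) ζ
  refine ⟨ζ', h.trans ?_⟩
  exact tder_comp_apply (g := fun x : G => g * x * g⁻¹) d1 d2 ζ

/-- Elements of a normal subgroup `N` act trivially on the quotient of the Lie algebras: the map
`x ↦ n x n⁻¹ x⁻¹` has values in `N`. -/
theorem IsClosedLieSubgroup.adj_sub_self [N.Normal] (hN : IsClosedLieSubgroup (EG := EG) EN N)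
    {n : G} (hn : n ∈ N) (ξ : EG) : ∃ ζ, incl EN EG N ζ = adj EG n ξ - ξ := by
  have d1 : MDifferentiableAt 𝓘(ℝ, EG) 𝓘(ℝ, EG) (fun x : G => n * x * n⁻¹) 1 :=
    (contMDiff_conj (EH := EG) n 1).mdifferentiableAt (by simp)
  have d2 : MDifferentiableAt 𝓘(ℝ, EG) 𝓘(ℝ, EG) (fun x : G => x⁻¹) 1 :=
    (contMDiff_inv 𝓘(ℝ, EG) ∞ (1 : G)).mdifferentiableAt (by simp)
  have hm : ∀ p : G × G, MDifferentiableAt (𝓘(ℝ, EG).prod 𝓘(ℝ, EG)) 𝓘(ℝ, EG)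
      (fun p : G × G => p.1 * p.2) p := fun p =>
    (contMDiff_mul 𝓘(ℝ, EG) ∞ p).mdifferentiableAt (by simp)
  have d3 : MDifferentiableAt 𝓘(ℝ, EG) 𝓘(ℝ, EG) (fun x : G => n * x * n⁻¹ * x⁻¹) 1 :=
    (hm _).comp 1 (d1.prodMk d2)
  obtain ⟨ζ, h⟩ := hN.tder_mem_lieSubspace d3
    (fun x => by
      have := N.mul_mem hn (Subgroup.Normal.conj_mem ‹_› _ (N.inv_mem hn) x)
      simpa [mul_assoc] using this) (by simp) ξ
  refine ⟨ζ, h.trans ?_⟩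
  have e1 := tder_comp₂ (F := fun p : G × G => p.1 * p.2) (hm _) d1 d2 ξ
  have e2 := tder_comp₂ (F := fun p : G × G => p.1 * p.2) (x := (1 : G)) (hm _)
    (mdifferentiableAt_id (I := 𝓘(ℝ, EG))) d2 ξ
  simp only [id, mul_one, mul_inv_cancel, inv_one, one_mul, tder_const] at e1 e2
  have e3 : tder EG EG (fun x : G => x) 1 = ContinuousLinearMap.id ℝ EG := tder_id 1
  have e4 : tder EG EG (fun x : G => n * x * n⁻¹) 1 = adj EG n := rfl
  have e5 : tder EG EG (id : G → G) 1 = ContinuousLinearMap.id ℝ EG := tder_id 1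
  rw [e3, e4] at e1
  rw [e3, e5] at e2
  simp only [ContinuousLinearMap.id_apply, zero_apply] at e1 e2
  rw [e1, sub_eq_add_neg]
  congr 1
  exact (neg_eq_of_add_eq_zero_right e2.symm).symm

end LieSubgroup

/-! ### Restriction of a hamiltonian action to a subgroup -/

section Restriction

variable {EG : Type*} [NormedAddCommGroup EG] [NormedSpace ℝ EG]
  {G : Type*} [TopologicalSpace G] [ChartedSpace EG G] [Group G] [LieGroup 𝓘(ℝ, EG) ∞ G]
  {EN : Type*} [NormedAddCommGroup EN] [NormedSpace ℝ EN]
  {N : Subgroup G} [ChartedSpace EN N] [LieGroup 𝓘(ℝ, EN) ∞ N]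
  {E : Type*} [NormedAddCommGroup E] [NormedSpace ℝ E]
  {M : Type*} [TopologicalSpace M] [ChartedSpace E M] [MulAction G M]
  {Ω : ∀ x : M, TangentSpace 𝓘(ℝ, E) x [⋀^Fin 2]→L[ℝ] ℝ}
  {μ : M → Module.Dual ℝ (GroupLieAlgebra 𝓘(ℝ, EG) G)}
  {μN : M → Module.Dual ℝ (GroupLieAlgebra 𝓘(ℝ, EN) N)}

/-- The inclusion of Lie algebras is equivariant for the adjoint actions of the subgroup. -/
theorem IsClosedLieSubgroup.incl_adj (hN : IsClosedLieSubgroup (EG := EG) EN N) (n : N) (ζ : EN) :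
    incl EN EG N (adj EN n ζ) = adj EG (n : G) (incl EN EG N ζ) := by
  have d0 : ∀ m : N, MDifferentiableAt 𝓘(ℝ, EN) 𝓘(ℝ, EG) (fun n : N => (n : G)) m := fun m =>
    (hN.smooth m).mdifferentiableAt (by simp)
  have d1 : MDifferentiableAt 𝓘(ℝ, EN) 𝓘(ℝ, EN) (fun x : N => n * x * n⁻¹) 1 :=
    (contMDiff_conj (EH := EN) n 1).mdifferentiableAt (by simp)
  have d2 : MDifferentiableAt 𝓘(ℝ, EG) 𝓘(ℝ, EG) (fun x : G => n * x * (n : G)⁻¹) ((1 : N) : G) :=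
    (contMDiff_conj (EH := EG) (n : G) 1).mdifferentiableAt (by simp)
  have h1 := tder_comp_apply (g := fun n : N => (n : G)) (d0 _) d1 ζ
  have h2 := tder_comp_apply (g := fun x : G => n * x * (n : G)⁻¹) d2 (d0 1) ζ
  have h3 : n * 1 * n⁻¹ = 1 := by simp
  rw [h3] at h1
  exact h1.symm.trans h2

/-- The restriction of a hamiltonian action to a closed Lie subgroup is hamiltonian, and its
momentum map is the projection of the momentum map. -/
theorem IsHamiltonianAction.restrict (hμ : IsHamiltonianAction Ω μ)
    (hN : IsClosedLieSubgroup (EG := EG) EN N) (hμN : ∀ x, μN x = dualRestrict EN N (μ x)) :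
    IsHamiltonianAction (G := N) Ω μN := by
  have hμN' : ∀ x (ζ : EN), μN x ζ = μ x (incl EN EG N ζ) := fun x ζ => by rw [hμN]; rfl
  refine ⟨?_, fun n x => hμ.symplectic (n : G) x, fun ζ => ?_, fun n x ζ => ?_, fun ζ x v => ?_⟩
  · exact hμ.smooth_action.comp ((hN.smooth.comp contMDiff_fst).prodMk contMDiff_snd)
  · have h : (fun x => μN x ζ) = fun x => μ x (incl EN EG N ζ) := funext fun x => hμN' x ζ
    rw [h]
    exact hμ.smooth _
  · have h1 := hμ.moment_smul ((n⁻¹ : N) : G)⁻¹ x (incl EN EG N ζ)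
    have h2 := hN.incl_adj n⁻¹ ζ
    refine (hμN' _ ζ).trans ?_
    refine Eq.trans ?_ (hμN' x (adj EN n⁻¹ ζ)).symm
    rw [h2, InvMemClass.coe_inv]
    exact hμ.moment_smul (n : G) x _
  · have h1 : infAction EN N E x ζ = infAction EG G E x (incl EN EG N ζ) :=
      tder_comp_apply (g := fun g : G => g • x) (f := fun n : N => (n : G)) (x := 1)
        (hμ.mdifferentiable_smul_const _ x) ((hN.smooth 1).mdifferentiableAt (by simp)) ζ
    have h2 : (fun x => μN x ζ) = fun x => μ x (incl EN EG N ζ) := funext fun x => hμN' x ζ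
    rw [h2]
    have h3 : ∀ w : E, formAt Ω x ![infAction EN N E x ζ, w] =
        - momentDeriv μ x (incl EN EG N ζ) w := fun w => by rw [h1, hμ.form_infAction]
    exact h3 v

variable [FiniteDimensional ℝ EN] [FiniteDimensional ℝ EG]

/-- The levels of the momentum map of a normal subgroup `N` at restrictions of coadjoint-invariant
elements are invariant under the whole group. -/
theorem IsHamiltonianAction.smul_mem_momentumLevel [N.Normal] (hμ : IsHamiltonianAction Ω μ)
    (hN : IsClosedLieSubgroup (EG := EG) EN N) (hμN : ∀ x, μN x = dualRestrict EN N (μ x))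
    {c' : Module.Dual ℝ (GroupLieAlgebra 𝓘(ℝ, EG) G)}
    (hc' : ∀ (g : G) (ξ : EG), c' (adj EG g ξ) = c' ξ) (g : G) {z : M}
    (hz : z ∈ momentumLevel μN (dualRestrict EN N c')) :
    g • z ∈ momentumLevel μN (dualRestrict EN N c') := by
  have hμN' : ∀ x (ζ : EN), μN x ζ = μ x (incl EN EG N ζ) := fun x ζ => by rw [hμN]; rfl
  have hz' : ∀ ζ : EN, μ z (incl EN EG N ζ) = c' (incl EN EG N ζ) := fun ζ =>
    (hμN' z ζ).symm.trans (LinearMap.congr_fun hz ζ)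
  refine LinearMap.ext fun ζ => (hμN' _ ζ).trans ?_
  obtain ⟨ζ', h⟩ := hN.adj_incl g⁻¹ ζ
  have h1 := hμ.moment_smul g z (incl EN EG N ζ)
  rw [← h, hz', h] at h1
  exact h1.trans (hc' g⁻¹ (incl EN EG N ζ))

end Restriction

/-! ### The reduced form -/

section ReducedForm

variable {EN : Type*} [NormedAddCommGroup EN] [NormedSpace ℝ EN]
  {G : Type*} [TopologicalSpace G] [Group G]
  {E : Type*} [NormedAddCommGroup E]
  {M : Type*} [TopologicalSpace M] [ChartedSpace E M] [MulAction G M]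
  {N : Subgroup G} [ChartedSpace EN N]
  {μN : M → Module.Dual ℝ (GroupLieAlgebra 𝓘(ℝ, EN) N)}
  {c : Module.Dual ℝ (GroupLieAlgebra 𝓘(ℝ, EN) N)}

theorem symplecticQuotientMk_eq_iff {z z' : momentumLevel μN c} :
    symplecticQuotientMk E N μN c z = symplecticQuotientMk E N μN c z' ↔
      ∃ n : N, n • (z : M) = z' := by
  rw [eq_comm]
  exact Quotient.eq

variable [NormedSpace ℝ E]

theorem isPlot_symplecticQuotient_iff {n : ℕ} {p : Eucl n → SymplecticQuotient E N μN c} :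
    IsPlot p ↔ ∀ t, ∃ P : Eucl n → momentumLevel μN c,
      ContMDiff 𝓘(ℝ, Eucl n) 𝓘(ℝ, E) ∞ (fun s => (P s : M)) ∧
        (fun s => symplecticQuotientMk E N μN c (P s)) =ᶠ[𝓝 t] p := Iff.rfl

/-- Two lifts of the same map to the quotient pull `Ω` back to the same form. -/
def PullDescends (N : Subgroup G) [ChartedSpace EN N]
    (μN : M → Module.Dual ℝ (GroupLieAlgebra 𝓘(ℝ, EN) N))
    (c : Module.Dual ℝ (GroupLieAlgebra 𝓘(ℝ, EN) N))
    (Ω : ∀ x : M, TangentSpace 𝓘(ℝ, E) x [⋀^Fin 2]→L[ℝ] ℝ) : Prop :=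
  ∀ (n : ℕ) (P P' : Eucl n → momentumLevel μN c),
    ContMDiff 𝓘(ℝ, Eucl n) 𝓘(ℝ, E) ∞ (fun s => (P s : M)) →
    ContMDiff 𝓘(ℝ, Eucl n) 𝓘(ℝ, E) ∞ (fun s => (P' s : M)) → ∀ t,
    (∀ᶠ s in 𝓝 t, symplecticQuotientMk E N μN c (P s) = symplecticQuotientMk E N μN c (P' s)) →
    pull Ω (fun s => (P s : M)) t = pull Ω (fun s => (P' s : M)) t

variable {Ω : ∀ x : M, TangentSpace 𝓘(ℝ, E) x [⋀^Fin 2]→L[ℝ] ℝ}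

/-- The value at `t` of the reduced form along a plot `p`: pull `Ω` back along a chosen lift of `p`
near `t`. When `PullDescends` holds, the choice is irrelevant. -/
def reducedEval (Ω : ∀ x : M, TangentSpace 𝓘(ℝ, E) x [⋀^Fin 2]→L[ℝ] ℝ) {n : ℕ}
    (p : Eucl n → SymplecticQuotient E N μN c) (hp : IsPlot p) (t : Eucl n) :
    Eucl n [⋀^Fin 2]→L[ℝ] ℝ :=
  pull Ω (fun s => ((isPlot_symplecticQuotient_iff.1 hp t).choose s : M)) t

theorem PullDescends.reducedEval_eq (hd : PullDescends N μN c Ω) {n : ℕ}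
    {p : Eucl n → SymplecticQuotient E N μN c} (hp : IsPlot p) {t : Eucl n}
    {P : Eucl n → momentumLevel μN c}
    (hP : ContMDiff 𝓘(ℝ, Eucl n) 𝓘(ℝ, E) ∞ (fun s => (P s : M)))
    (hPp : (fun s => symplecticQuotientMk E N μN c (P s)) =ᶠ[𝓝 t] p) :
    reducedEval Ω p hp t = pull Ω (fun s => (P s : M)) t := by
  obtain ⟨h1, h2⟩ := (isPlot_symplecticQuotient_iff.1 hp t).choose_spec
  exact hd n _ P h1 hP t (h2.trans hPp.symm)

theorem PullDescends.reducedEval_eventuallyEq (hd : PullDescends N μN c Ω) {n : ℕ}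
    {p : Eucl n → SymplecticQuotient E N μN c} (hp : IsPlot p) {t : Eucl n}
    {P : Eucl n → momentumLevel μN c}
    (hP : ContMDiff 𝓘(ℝ, Eucl n) 𝓘(ℝ, E) ∞ (fun s => (P s : M)))
    (hPp : (fun s => symplecticQuotientMk E N μN c (P s)) =ᶠ[𝓝 t] p) :
    reducedEval Ω p hp =ᶠ[𝓝 t] pull Ω (fun s => (P s : M)) := by
  filter_upwards [hPp.eventuallyEq_nhds] with s hs using hd.reducedEval_eq hp hP hs

/-- The reduced form on the symplectic quotient. -/
def reducedForm [IsManifold 𝓘(ℝ, E) ∞ M] (hΩ : IsSymplecticForm Ω)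
    (hd : PullDescends N μN c Ω) : DiffForm 2 (SymplecticQuotient E N μN c) where
  eval := reducedEval Ω
  smooth p hp := by
    rw [contDiff_iff_contDiffAt]
    intro t
    obtain ⟨P, hP, hPp⟩ := isPlot_symplecticQuotient_iff.1 hp t
    exact (contDiff_pull hΩ.smooth hP).contDiffAt.congr_of_eventuallyEq
      (hd.reducedEval_eventuallyEq hp hP hPp)
  pullback p hp f hf t := by
    obtain ⟨P, hP, hPp⟩ := isPlot_symplecticQuotient_iff.1 hp (f t)
    rw [hd.reducedEval_eq hp hP hPp,
      hd.reducedEval_eq (P := fun s => P (f s)) _ (hP.comp hf.contMDiff)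
        (hPp.comp_tendsto hf.continuous.continuousAt)]
    exact pull_comp (hP.mdifferentiable (by simp) _) (hf.differentiable (by simp) t)

variable [IsManifold 𝓘(ℝ, E) ∞ M]

theorem reducedForm_eval (hΩ : IsSymplecticForm Ω) (hd : PullDescends N μN c Ω) {n : ℕ}
    {p : Eucl n → SymplecticQuotient E N μN c} (hp : IsPlot p) {t : Eucl n}
    {P : Eucl n → momentumLevel μN c}
    (hP : ContMDiff 𝓘(ℝ, Eucl n) 𝓘(ℝ, E) ∞ (fun s => (P s : M)))
    (hPp : (fun s => symplecticQuotientMk E N μN c (P s)) =ᶠ[𝓝 t] p) :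
    (reducedForm hΩ hd).eval p hp t = pull Ω (fun s => (P s : M)) t :=
  hd.reducedEval_eq hp hP hPp

theorem isReducedForm_reducedForm (hΩ : IsSymplecticForm Ω) (hd : PullDescends N μN c Ω) :
    IsReducedForm E N μN c Ω (reducedForm hΩ hd) := fun _ hP _ =>
  hd.reducedEval_eq (isPlot_symplecticQuotientMk E N μN c hP) hP Filter.EventuallyEq.rfl

theorem extDeriv_reducedForm (hΩ : IsSymplecticForm Ω) (hd : PullDescends N μN c Ω) {n : ℕ}
    (p : Eucl n → SymplecticQuotient E N μN c) (hp : IsPlot p) (t : Eucl n) :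
    extDeriv ((reducedForm hΩ hd).eval p hp) t = 0 := by
  obtain ⟨P, hP, hPp⟩ := isPlot_symplecticQuotient_iff.1 hp t
  have h : (reducedForm hΩ hd).eval p hp =ᶠ[𝓝 t] pull Ω (fun s => (P s : M)) :=
    hd.reducedEval_eventuallyEq hp hP hPp
  rw [h.extDeriv_eq]
  exact extDeriv_pull hΩ.smooth hΩ.closed hP t

end ReducedForm

/-! ### The symplectic quotient is a symplectic orbifold -/

section Orbifold

/-- A linear form vanishing on the kernel of a linear map to a dual space is an evaluation. -/
theorem exists_eq_eval_of_ker_le {V W : Type*} [AddCommGroup V] [Module ℝ V] [AddCommGroup W]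
    [Module ℝ W] [FiniteDimensional ℝ W] (D : V →ₗ[ℝ] Module.Dual ℝ W) (l : Module.Dual ℝ V)
    (h : ∀ v, D v = 0 → l v = 0) : ∃ ζ, ∀ v, l v = D v ζ := by
  have h1 : l ∈ (LinearMap.ker D).dualAnnihilator :=
    (Submodule.mem_dualAnnihilator l).2 fun v hv => h v (LinearMap.mem_ker.1 hv)
  rw [← LinearMap.range_dualMap_eq_dualAnnihilator_ker] at h1
  obtain ⟨f, rfl⟩ := h1
  obtain ⟨ζ, rfl⟩ := (Module.evalEquiv ℝ W).surjective f
  exact ⟨ζ, fun v => rfl⟩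

theorem finite_stabilizer_of_discreteTopology {H X : Type*} [Group H] [TopologicalSpace H]
    [CompactSpace H] [TopologicalSpace X] [T1Space X] [MulAction H X] [ContinuousSMul H X] (x : X)
    [DiscreteTopology (MulAction.stabilizer H x)] : Finite (MulAction.stabilizer H x) := by
  have h : IsClosed (MulAction.stabilizer H x : Set H) :=
    isClosed_singleton.preimage (continuous_id.smul (continuous_const (y := x)))
  have : CompactSpace (MulAction.stabilizer H x) := isCompact_iff_compactSpace.1 h.isCompact
  exact finite_of_compact_of_discrete

variable {EN : Type*} [NormedAddCommGroup EN] [NormedSpace ℝ EN]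
  {G : Type*} [TopologicalSpace G] [Group G]
  {E : Type*} [NormedAddCommGroup E] [NormedSpace ℝ E]
  {M : Type*} [TopologicalSpace M] [ChartedSpace E M] [MulAction G M]
  {N : Subgroup G} [ChartedSpace EN N]
  {Ω : ∀ x : M, TangentSpace 𝓘(ℝ, E) x [⋀^Fin 2]→L[ℝ] ℝ}
  {μN : M → Module.Dual ℝ (GroupLieAlgebra 𝓘(ℝ, EN) N)}
  {c : Module.Dual ℝ (GroupLieAlgebra 𝓘(ℝ, EN) N)}

theorem IsHamiltonianAction.pullDescends [FiniteDimensional ℝ EN] [FiniteDimensional ℝ E]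
    [LieGroup 𝓘(ℝ, EN) ∞ N] [CompactSpace N] [IsManifold 𝓘(ℝ, E) ∞ M] [T2Space M]
    (hμ : IsHamiltonianAction (G := N) Ω μN) (hΩ : IsSymplecticForm Ω)
    (hc : ∀ (n : N) (ζ : EN), c (adj EN n ζ) = c ζ) (hreg : IsRegularValue (E := E) μN c)
    (hfin : ∀ z, μN z = c → Finite (MulAction.stabilizer N z)) : PullDescends N μN c Ω :=
  fun _ P P' hP hP' _ h => hμ.pull_eq_pull_of_orbit hΩ.smooth hc hreg hfin hP hP'
    (fun s => (P s).2) (fun s => (P' s).2) (h.mono fun _ hs => symplecticQuotientMk_eq_iff.1 hs)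

section Slice

variable {z : M} {d : ℕ} {Γ : Subgroup (Eucl d ≃L[ℝ] Eucl d)} {Q : Eucl d → M}

/-- The chart of the symplectic quotient defined by a slice. -/
def IsSlice.chart (hQ : IsSlice E μN c z Γ Q) (u : Eucl d) : SymplecticQuotient E N μN c :=
  symplecticQuotientMk E N μN c ⟨Q u, hQ.level u⟩

theorem IsSlice.isPlot_chart (hQ : IsSlice E μN c z Γ Q) : IsPlot hQ.chart :=
  isPlot_symplecticQuotientMk E N μN c hQ.smooth

/-- A slice defines an orbifold chart of the symplectic quotient. -/
theorem IsSlice.isOrbifoldChart (hQ : IsSlice E μN c z Γ Q)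
    (hμ : IsHamiltonianAction (G := N) Ω μN) (hinv : ∀ (n : N) x, μN x = c → μN (n • x) = c) :
    IsOrbifoldChart Γ hQ.chart where
  finite := hQ.finite
  isPlot := hQ.isPlot_chart
  fiber u v := by
    refine symplecticQuotientMk_eq_iff.trans ⟨fun ⟨n, hn⟩ => hQ.orbit u v n hn, ?_⟩
    rintro ⟨γ, hγ, rfl⟩
    obtain ⟨n, hn⟩ := hQ.equivariant γ hγ
    exact ⟨n, (hn u).symm⟩
  lift {n} p hp t := by
    rintro ⟨u₀, hu₀⟩
    obtain ⟨P, hP, hPp⟩ := isPlot_symplecticQuotient_iff.1 hp t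
    obtain ⟨k, hk⟩ := symplecticQuotientMk_eq_iff.1 (hPp.self_of_nhds.trans hu₀.symm)
    have hP' : ContMDiff 𝓘(ℝ, Eucl n) 𝓘(ℝ, E) ∞ (fun s => k • (P s : M)) :=
      (hμ.contMDiff_const_smul k).comp hP
    obtain ⟨h, f, hf⟩ := hQ.lift u₀
    have hev : ∀ᶠ s in 𝓝 t, ContMDiffAt 𝓘(ℝ, E) 𝓘(ℝ, Eucl d) ∞ f (k • (P s : M)) ∧
        h (k • (P s : M)) • Q (f (k • (P s : M))) = k • (P s : M) := by
      have h1 : Filter.Tendsto (fun s => k • (P s : M)) (𝓝 t) (𝓝 (Q u₀)) := by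
        have := hP'.continuous.continuousAt (x := t)
        rwa [ContinuousAt, hk] at this
      filter_upwards [h1.eventually hf] with s hs using
        ⟨hs.2.1, hs.2.2 (hinv k _ (P s).2)⟩
    obtain ⟨U, hU, hUo, htU⟩ := eventually_nhds_iff.1 hev
    obtain ⟨θ, hθ, hθU, hθt⟩ := exists_smooth_localization hUo htU
    refine ⟨fun s => f (k • (P (θ s) : M)), ?_, ?_⟩
    · rw [← contMDiff_iff_contDiff]
      exact fun s => (hU _ (hθU s)).1.comp s ((hP' _).comp s hθ.contMDiff.contMDiffAt)
    · filter_upwards [hθt, hPp, hUo.mem_nhds htU] with s h1 h2 h3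
      simp only [id] at h1
      rw [← h2]
      refine symplecticQuotientMk_eq_iff.2 ⟨k⁻¹ * h (k • (P s : M)), ?_⟩
      simp only [h1]
      rw [mul_smul, (hU s h3).2, inv_smul_smul]

/-- The pullback of the symplectic form to a slice is nondegenerate: the kernel of the restriction
of the form to a tangent space of the level is the tangent space of the orbit. -/
theorem IsSlice.pull_nondegenerate (hQ : IsSlice E μN c z Γ Q) [FiniteDimensional ℝ EN]
    (hμ : IsHamiltonianAction (G := N) Ω μN) (hΩ : IsSymplecticForm Ω) {u v : Eucl d}
    (h : ∀ w, pull Ω Q u ![v, w] = 0) : v = 0 := by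
  let l : Module.Dual ℝ E :=
    { toFun := fun w => formAt Ω (Q u) ![tder (Eucl d) E Q u v, w]
      map_add' := fun a b => twoForm_add_right _ _ a b
      map_smul' := fun a b => by
        have := (formAt Ω (Q u)).toMultilinearMap.map_update_smul
          ![tder (Eucl d) E Q u v, 0] 1 a b
        have e : ∀ x : E, Function.update ![tder (Eucl d) E Q u v, 0] 1 x =
            ![tder (Eucl d) E Q u v, x] := fun x => by funext i; fin_cases i <;> rfl
        rw [e, e] at this
        exact this }
  -- `Ω(dQ v, ·)` vanishes on the kernel of `dμ`, hence is a component of `dμ`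
  obtain ⟨ζ, hζ⟩ := exists_eq_eval_of_ker_le (hμ.momentDual EN (Q u)) l (by
    intro w hw
    obtain ⟨ζ, v', rfl⟩ := hQ.span u w fun ζ => LinearMap.congr_fun hw ζ
    change formAt Ω (Q u) ![tder (Eucl d) E Q u v, _] = 0
    rw [twoForm_add_right, ← pull_pair, h, twoForm_swap, hμ.form_infAction,
      momentDeriv_tder_of_eventually hμ (hQ.smooth.mdifferentiable (by simp) u)
        (Filter.Eventually.of_forall hQ.level)]
    simp)
  have h0 : tder (Eucl d) E Q u v + infAction EN N E (Q u) ζ = 0 := by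
    have h1 : ∀ w : E, formAt Ω (Q u)
        ![tder (Eucl d) E Q u v + infAction EN N E (Q u) ζ, w] = 0 := fun w => by
      rw [twoForm_add_left, hμ.form_infAction]
      exact add_neg_eq_zero.2 (hζ w)
    exact hΩ.nondegenerate (Q u) _ h1
  refine hQ.transverse u v (-ζ) ?_
  rw [map_neg]
  exact eq_neg_of_add_eq_zero_left h0

end Slice

/-- The projection to the symplectic quotient, with the topology of its quotient diffeology, is an
open quotient map. -/
theorem isOpenQuotientMap_symplecticQuotientMk
    (hμ : IsHamiltonianAction (G := N) Ω μN) (hinv : ∀ (n : N) x, μN x = c → μN (n • x) = c)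
    (hslice : ∀ z, μN z = c → ∃ (d : ℕ) (Γ : Subgroup (Eucl d ≃L[ℝ] Eucl d)) (Q : Eucl d → M),
      IsSlice E μN c z Γ Q) :
    @IsOpenQuotientMap _ _ _ DiffeologicalSpace.dTopology (symplecticQuotientMk E N μN c) := by
  let := (DiffeologicalSpace.dTopology : TopologicalSpace (SymplecticQuotient E N μN c))
  refine ⟨Quotient.mk_surjective, ⟨fun U hU => ?_⟩, fun V hV => ?_⟩
  · rw [isOpen_iff_mem_nhds]
    intro z hz
    obtain ⟨d, Γ, Q, hQ⟩ := hslice z z.2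
    obtain ⟨h, f, hf⟩ := hQ.lift 0
    rw [hQ.zero] at hf
    have h1 : ∀ x : momentumLevel μN c, h x • Q (f x) = x →
        hQ.chart (f x) = symplecticQuotientMk E N μN c x := fun x hx =>
      symplecticQuotientMk_eq_iff.2 ⟨h x, hx⟩
    have h2 : hQ.chart ⁻¹' U ∈ 𝓝 (f z) := by
      refine (isOpen_iff_preimages_plots.1 hU d _ hQ.isPlot_chart).mem_nhds ?_
      rw [Set.mem_preimage, h1 z (hf.self_of_nhds.2.2 z.2)]
      exact hz
    have h3 : Filter.Tendsto (fun x : momentumLevel μN c => f x) (𝓝 z) (𝓝 (f z)) :=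
      hf.self_of_nhds.2.1.continuousAt.comp continuous_subtype_val.continuousAt
    filter_upwards [h3.eventually_mem h2, continuous_subtype_val.continuousAt.eventually hf]
      with x hx hx'
    rw [Set.mem_preimage, ← h1 x (hx'.2.2 x.2)]
    exact hx
  · refine isOpen_iff_preimages_plots.2 fun n p hp => ?_
    rw [isOpen_iff_mem_nhds]
    rintro t ⟨z, hz, hzt⟩
    obtain ⟨P, hP, hPp⟩ := isPlot_symplecticQuotient_iff.1 hp t
    obtain ⟨k, hk⟩ := symplecticQuotientMk_eq_iff.1 (hPp.self_of_nhds.trans hzt.symm)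
    let R : Eucl n → momentumLevel μN c := fun s => ⟨k • (P s : M), hinv k _ (P s).2⟩
    have hR : Continuous R :=
      Continuous.subtype_mk ((hμ.contMDiff_const_smul k).comp hP).continuous _
    have hRt : R t = z := Subtype.ext hk
    filter_upwards [hR.continuousAt.eventually_mem (hV.mem_nhds (hRt ▸ hz)), hPp] with s h1 h2
    refine ⟨R s, h1, ?_⟩
    rw [← h2]
    exact (symplecticQuotientMk_eq_iff.2 ⟨k, rfl⟩).symm

/-- The reduced form makes the quotient of a regular level by a locally free action a symplectic
orbifold. -/
theorem IsHamiltonianAction.isSymplecticOrbifold_reducedForm [FiniteDimensional ℝ EN]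
    [FiniteDimensional ℝ E] [LieGroup 𝓘(ℝ, EN) ∞ N] [CompactSpace N] [IsManifold 𝓘(ℝ, E) ∞ M]
    [T2Space M] [SecondCountableTopology M]
    (hμ : IsHamiltonianAction (G := N) Ω μN) (hΩ : IsSymplecticForm Ω)
    (hc : ∀ (n : N) (ζ : EN), c (adj EN n ζ) = c ζ) (hreg : IsRegularValue (E := E) μN c)
    (hfin : ∀ z, μN z = c → Finite (MulAction.stabilizer N z)) (hd : PullDescends N μN c Ω) :
    IsSymplecticOrbifold (reducedForm hΩ hd) := by
  have hinv := hμ.moment_smul_eq hc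
  have hslice : ∀ z, μN z = c → ∃ (d : ℕ) (Γ : Subgroup (Eucl d ≃L[ℝ] Eucl d)) (Q : Eucl d → M),
      IsSlice E μN c z Γ Q := fun z hz => by
    have := hfin z hz
    exact hμ.exists_slice hc hreg hz
  have hq := isOpenQuotientMap_symplecticQuotientMk hμ hinv hslice
  have := hμ.continuousSMul
  let := (DiffeologicalSpace.dTopology : TopologicalSpace (SymplecticQuotient E N μN c))
  refine ⟨?_, ?_, extDeriv_reducedForm hΩ hd, fun x => ?_⟩
  · rw [t2Space_iff_of_isOpenQuotientMap hq]
    -- the orbit relation is the projection of a closed set along a compact factor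
    have h1 : IsClosed {a : N × (momentumLevel μN c × momentumLevel μN c) |
        a.1 • (a.2.1 : M) = a.2.2} := isClosed_eq (by fun_prop) (by fun_prop)
    convert isClosedMap_snd_of_compactSpace _ h1 using 1
    ext ⟨a, b⟩
    simp [symplecticQuotientMk_eq_iff]
  · exact hq.isQuotientMap.secondCountableTopology hq.isOpenMap
  · obtain ⟨z, rfl⟩ := Quotient.mk_surjective x
    obtain ⟨d, Γ, Q, hQ⟩ := hslice z z.2
    refine ⟨d, Γ, hQ.chart, hQ.isOrbifoldChart hμ hinv, ⟨0, ?_⟩, fun u v h => ?_⟩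
    · exact congrArg (symplecticQuotientMk E N μN c) (Subtype.ext hQ.zero)
    · refine hQ.pull_nondegenerate hμ hΩ (u := u) fun w => ?_
      rw [← h w]
      exact congrArg (fun α : Eucl d [⋀^Fin 2]→L[ℝ] ℝ => α ![v, w])
        (reducedForm_eval hΩ hd hQ.isPlot_chart (P := fun u => ⟨Q u, hQ.level u⟩) hQ.smooth
          Filter.EventuallyEq.rfl).symm

end Orbifold

/-! ### The action of the quotient group -/

section QuotientAction

/-- The projection `ℝ × ℝⁿ → ℝⁿ` as a continuous linear map. -/
def euclTailL (n : ℕ) : Eucl (n + 1) →L[ℝ] Eucl n :=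
  LinearMap.toContinuousLinearMap
    { toFun := euclTail
      map_add' := fun _ _ => rfl
      map_smul' := fun _ _ => rfl }

theorem euclTail_euclCons {n : ℕ} (a : ℝ) (u : Eucl n) : euclTail (euclCons a u) = u := rfl

theorem euclCons_zero {n : ℕ} (a : ℝ) (u : Eucl n) : euclCons a u 0 = a := rfl

variable {EG : Type*} [NormedAddCommGroup EG] [NormedSpace ℝ EG]
  {G : Type*} [TopologicalSpace G] [ChartedSpace EG G] [Group G]
  {EN : Type*} [NormedAddCommGroup EN] [NormedSpace ℝ EN]
  {N : Subgroup G} [ChartedSpace EN N]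
  {E : Type*} [NormedAddCommGroup E] [NormedSpace ℝ E]
  {M : Type*} [TopologicalSpace M] [ChartedSpace E M] [MulAction G M]
  {Ω : ∀ x : M, TangentSpace 𝓘(ℝ, E) x [⋀^Fin 2]→L[ℝ] ℝ}
  {μ : M → Module.Dual ℝ (GroupLieAlgebra 𝓘(ℝ, EG) G)}
  {μN : M → Module.Dual ℝ (GroupLieAlgebra 𝓘(ℝ, EN) N)}
  {c : Module.Dual ℝ (GroupLieAlgebra 𝓘(ℝ, EN) N)}
  {c' : Module.Dual ℝ (GroupLieAlgebra 𝓘(ℝ, EG) G)}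

variable (E) in
/-- The action of `G ⧸ N` on the quotient of an invariant level by `N`. -/
abbrev symplecticQuotientMulAction [N.Normal]
    (hL : ∀ (g : G), ∀ z ∈ momentumLevel μN c, g • z ∈ momentumLevel μN c) :
    MulAction (G ⧸ N) (SymplecticQuotient E N μN c) where
  smul k x := Quotient.liftOn₂' k x
    (fun g z => symplecticQuotientMk E N μN c ⟨g • (z : M), hL g z z.2⟩) (by
      intro g z g' z' hg hz
      obtain ⟨m, hm⟩ := symplecticQuotientMk_eq_iff (E := E).1 (Quotient.sound hz)
      refine symplecticQuotientMk_eq_iff.2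
        ⟨⟨g' * m * g⁻¹, ?_⟩, ?_⟩
      · have := Subgroup.Normal.conj_mem ‹_› _ (N.mul_mem (QuotientGroup.leftRel_apply.1 hg) m.2) g
        simpa [mul_assoc] using this
      · change (g' * m * g⁻¹) • g • (z : M) = g' • (z' : M)
        rw [mul_smul, inv_smul_smul, mul_smul, ← hm]
        rfl)
  one_smul x := by
    obtain ⟨z, rfl⟩ := Quotient.mk_surjective x
    exact congrArg (symplecticQuotientMk E N μN c) (Subtype.ext (one_smul G (z : M)))
  mul_smul k k' x := by
    obtain ⟨z, rfl⟩ := Quotient.mk_surjective x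
    obtain ⟨g, rfl⟩ := QuotientGroup.mk_surjective k
    obtain ⟨g', rfl⟩ := QuotientGroup.mk_surjective k'
    exact congrArg (symplecticQuotientMk E N μN c) (Subtype.ext (mul_smul g g' (z : M)))

/-- On the level, `μ - c'` vanishes on the Lie algebra of `N` and is `N`-invariant, so that it
descends to a map from the quotient to the dual of `𝔤 ⧸ 𝔫`. -/
theorem IsHamiltonianAction.exists_reduced_moment [FiniteDimensional ℝ EG] [FiniteDimensional ℝ EN]
    [LieGroup 𝓘(ℝ, EG) ∞ G] [LieGroup 𝓘(ℝ, EN) ∞ N] [N.Normal] (hμ : IsHamiltonianAction Ω μ)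
    (hN : IsClosedLieSubgroup (EG := EG) EN N) (hμN : ∀ x, μN x = dualRestrict EN N (μ x))
    (hc' : ∀ (g : G) (ξ : EG), c' (adj EG g ξ) = c' ξ) :
    ∃ ν : SymplecticQuotient E N μN (dualRestrict EN N c') →
        Module.Dual ℝ (QuotientLieAlgebra (EG := EG) EN N),
      ∀ (z : momentumLevel μN (dualRestrict EN N c')) (ξ : GroupLieAlgebra 𝓘(ℝ, EG) G),
        ν (symplecticQuotientMk E N μN _ z) (Submodule.Quotient.mk ξ) = μ z ξ - c' ξ := by
  have h0 : ∀ z : momentumLevel μN (dualRestrict EN N c'), ∀ ζ : EN,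
      μ z (incl EN EG N ζ) = c' (incl EN EG N ζ) := fun z ζ =>
    LinearMap.congr_fun ((hμN z).symm.trans z.2) ζ
  let ν₀ : momentumLevel μN (dualRestrict EN N c') →
      Module.Dual ℝ (QuotientLieAlgebra (EG := EG) EN N) := fun z =>
    Submodule.liftQ (lieSubspace (EG := EG) EN N) (μ z - c') (by
      rintro _ ⟨ζ, rfl⟩
      exact LinearMap.mem_ker.2 (sub_eq_zero.2 (h0 z ζ)))
  refine ⟨Quotient.lift ν₀ fun z z' hz => ?_, fun z ξ => rfl⟩
  obtain ⟨n, hn⟩ := symplecticQuotientMk_eq_iff (E := E).1 (Quotient.sound hz)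
  refine Submodule.linearMap_qext _ (LinearMap.ext fun ξ => ?_)
  change μ z ξ - c' ξ = μ z' ξ - c' ξ
  congr 1
  have h1 : μ (z' : M) ξ = μ z (adj EG (n : G)⁻¹ ξ) := by
    rw [← hn]
    exact hμ.moment_smul (n : G) z ξ
  obtain ⟨ζ, hζ⟩ := hN.adj_sub_self (N.inv_mem n.2) ξ
  have h2 := h0 z ζ
  rw [hζ] at h2
  have h3 := (map_sub (μ z) (adj EG (n : G)⁻¹ ξ) ξ).symm.trans
    ((h2.trans (map_sub c' (adj EG (n : G)⁻¹ ξ) ξ)).trans (sub_eq_zero.2 (hc' _ ξ)))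
  exact (sub_eq_zero.1 h3).symm.trans h1.symm

/-- The action of `G ⧸ N` on the symplectic quotient is hamiltonian, with the momentum map induced
by `μ - c'`. -/
theorem IsHamiltonianAction.isHamiltonianQuotientAction [FiniteDimensional ℝ E]
    [N.Normal] [IsManifold 𝓘(ℝ, E) ∞ M]
    (hμ : IsHamiltonianAction Ω μ) (hΩ : IsSymplecticForm Ω)
    (hc' : ∀ (g : G) (ξ : EG), c' (adj EG g ξ) = c' ξ)
    (hL : ∀ (g : G), ∀ z ∈ momentumLevel μN c, g • z ∈ momentumLevel μN c)
    (hd : PullDescends N μN c Ω) [MulAction (G ⧸ N) (SymplecticQuotient E N μN c)]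
    (hact : ∀ (g : G) (z : momentumLevel μN c),
      (g : G ⧸ N) • symplecticQuotientMk E N μN c z =
        symplecticQuotientMk E N μN c ⟨g • (z : M), hL g z z.2⟩)
    {ν : SymplecticQuotient E N μN c → Module.Dual ℝ (QuotientLieAlgebra (EG := EG) EN N)}
    (hν : ∀ (z : momentumLevel μN c) (ξ : GroupLieAlgebra 𝓘(ℝ, EG) G),
      ν (symplecticQuotientMk E N μN c z) (Submodule.Quotient.mk ξ) = μ z ξ - c' ξ) :
    IsHamiltonianQuotientAction EN N (reducedForm hΩ hd) ν := by
  have smooth_action : ∀ {n : ℕ} (a : Eucl n → G ⧸ N) (p : Eucl n → SymplecticQuotient E N μN c),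
      @IsPlot _ (quotientGroupDiffeology N EG) n a → IsPlot p → IsPlot (fun t => a t • p t) := by
    intro n a p ha hp
    refine isPlot_symplecticQuotient_iff.2 fun t => ?_
    obtain ⟨A, hA, hAa⟩ := ha t
    obtain ⟨P, hP, hPp⟩ := isPlot_symplecticQuotient_iff.1 hp t
    refine ⟨fun s => ⟨A s • (P s : M), hL _ _ (P s).2⟩,
      fun s => hμ.contMDiffAt_smul (hA s) (hP s), ?_⟩
    filter_upwards [hAa, hPp] with s h1 h2
    rw [← h1, ← h2]
    exact (hact (A s) (P s)).symm
  refine ⟨smooth_action, fun k n p hp => ?_, fun η => ?_, fun g x ξ => ?_,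
    fun ξ γ hγ hγ0 hγξ n p hp => ?_⟩
  · refine
      ⟨smooth_action (fun _ => k) p (@isPlot_const _ (quotientGroupDiffeology N EG) _ _) hp, ?_⟩
    obtain ⟨g, rfl⟩ := QuotientGroup.mk_surjective k
    funext t
    obtain ⟨P, hP, hPp⟩ := isPlot_symplecticQuotient_iff.1 hp t
    rw [reducedForm_eval hΩ hd hp hP hPp,
      reducedForm_eval hΩ hd _ (P := fun s => ⟨g • (P s : M), hL _ _ (P s).2⟩)
        ((hμ.contMDiff_const_smul g).comp hP) ?_]
    · exact hμ.pull_const_smul g (hP.mdifferentiable (by simp) t)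
    · filter_upwards [hPp] with s hs
      rw [← hs]
      exact (hact g (P s)).symm
  · intro n p hp
    obtain ⟨ξ, rfl⟩ := Submodule.Quotient.mk_surjective _ η
    refine ContDiff.isPlot (contDiff_iff_contDiffAt.2 fun t => ?_)
    obtain ⟨P, hP, hPp⟩ := isPlot_symplecticQuotient_iff.1 hp t
    have h1 : ContDiffAt ℝ ∞ (fun s => μ (P s) ξ - c' ξ) t :=
      (contMDiffAt_iff_contDiffAt.1 ((hμ.smooth ξ (P t)).comp t (hP t))).sub contDiffAt_const
    refine h1.congr_of_eventuallyEq ?_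
    filter_upwards [hPp] with s hs
    rw [← hν, hs]
    rfl
  · obtain ⟨z, rfl⟩ := Quotient.mk_surjective x
    have h1 := hν ⟨g • (z : M), hL g z z.2⟩ ξ
    rw [← hact] at h1
    refine h1.trans (Eq.trans ?_ (hν z _).symm)
    exact congrArg₂ (· - ·) (hμ.moment_smul g z ξ) (hc' g⁻¹ ξ).symm
  · have hγ' : ∀ y : Eucl (n + 1), ContMDiffAt 𝓘(ℝ, Eucl (n + 1)) 𝓘(ℝ, EG) ∞
        (fun y : Eucl (n + 1) => γ (y 0)) y :=
      hγ.comp (EuclideanSpace.proj (0 : Fin (n + 1)) : Eucl (n + 1) →L[ℝ] ℝ).contDiff.contMDiff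
    refine ⟨smooth_action _ _ (fun _ => ⟨fun y => γ (y 0), hγ', Filter.EventuallyEq.rfl⟩)
      (isPlot_reparam hp (euclTailL n).contDiff), fun u v => ?_⟩
    obtain ⟨P, hP, hPp⟩ := isPlot_symplecticQuotient_iff.1 hp u
    have hPt : ContMDiff 𝓘(ℝ, Eucl (n + 1)) 𝓘(ℝ, E) ∞ (fun y => (P (euclTail y) : M)) :=
      hP.comp (euclTailL n).contDiff.contMDiff
    have ht : Filter.Tendsto (euclTail (n := n)) (𝓝 (euclCons 0 u)) (𝓝 u) :=
      (euclTailL n).continuous.continuousAt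
    -- lift the plot `y ↦ [γ (y 0)] • p (euclTail y)` to `y ↦ γ (y 0) • P (euclTail y)`
    rw [reducedForm_eval hΩ hd _
      (P := fun y => ⟨γ (y 0) • (P (euclTail y) : M), hL _ _ (P _).2⟩)
      (fun y => hμ.contMDiffAt_smul (hγ' y) (hPt y)) (by
        filter_upwards [ht.eventually hPp] with y hy
        rw [← hy]
        exact (hact _ _).symm), pull_pair]
    have dP : MDifferentiableAt 𝓘(ℝ, Eucl n) 𝓘(ℝ, E) (fun t => (P t : M)) u :=
      hP.mdifferentiable (by simp) u
    have e1 : ∀ w, tder (Eucl (n + 1)) EG (fun y : Eucl (n + 1) => γ (y 0)) (euclCons 0 u) w =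
        tder ℝ EG γ 0 (w 0) := fun w => by
      have h1 := tder_comp_apply (g := γ) (x := euclCons 0 u)
        (f := fun y => (EuclideanSpace.proj (0 : Fin (n + 1)) : Eucl (n + 1) →L[ℝ] ℝ) y)
        (hγ.mdifferentiable (by simp) _)
        (ContinuousLinearMap.differentiableAt _).mdifferentiableAt w
      rw [tder_clm] at h1
      exact h1
    have e2 : ∀ w, tder (Eucl (n + 1)) E (fun y => (P (euclTail y) : M)) (euclCons 0 u) w =
        tder (Eucl n) E (fun t => (P t : M)) u (euclTail w) := fun w => by
      have h1 := tder_comp_apply (g := fun t => (P t : M)) (x := euclCons 0 u)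
        (f := fun y => euclTailL n y) dP
        (ContinuousLinearMap.differentiableAt _).mdifferentiableAt w
      rw [tder_clm] at h1
      exact h1
    have e3 := fun w => hμ.tder_smul_of_eq_one (t := euclCons 0 u)
      ((hγ' _).mdifferentiableAt (by simp)) (hPt.mdifferentiable (by simp) (euclCons 0 u)) hγ0 w
    have e4 : tder ℝ EG γ 0 1 = ξ := hγξ
    have e5 : γ (euclCons 0 u 0) • (P (euclTail (euclCons 0 u)) : M) = P u := by
      rw [euclCons_zero, hγ0, one_smul, euclTail_euclCons]
    have e6 : (fun t => ν (p t) (Submodule.Quotient.mk ξ)) =ᶠ[𝓝 u] fun t => μ (P t) ξ - c' ξ := by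
      filter_upwards [hPp] with s hs
      rw [← hν, hs]
    have e7 := tder_comp_apply (g := fun x => μ x ξ) (f := fun t => (P t : M))
      (hμ.mdifferentiable_moment ξ _) dP v
    rw [tder_eq_fderiv] at e7
    rw [e6.fderiv_eq, fderiv_sub_const, e7, e3, e3, e1, e1, e2, e2]
    change formAt Ω (γ (euclCons 0 u 0) • (P (euclTail (euclCons 0 u)) : M)) _ = _
    rw [e5]
    simp only [euclCons_zero, euclTail_euclCons, e4, map_zero, zero_add, add_zero]
    exact hμ.form_infAction (P u) ξ _

end QuotientAction

theorem mainTheorem4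
    {EG : Type*} [NormedAddCommGroup EG] [NormedSpace ℝ EG] [FiniteDimensional ℝ EG]
    {G : Type*} [TopologicalSpace G] [ChartedSpace EG G] [Group G] [LieGroup 𝓘(ℝ, EG) ∞ G]
    [T2Space G] [CompactSpace G]
    {EN : Type*} [NormedAddCommGroup EN] [NormedSpace ℝ EN] [FiniteDimensional ℝ EN]
    (N : Subgroup G) [N.Normal] [ChartedSpace EN N] [LieGroup 𝓘(ℝ, EN) ∞ N]
    (hN : IsClosedLieSubgroup (EG := EG) EN N)
    {E : Type*} [NormedAddCommGroup E] [NormedSpace ℝ E] [FiniteDimensional ℝ E]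
    {M : Type*} [TopologicalSpace M] [ChartedSpace E M] [IsManifold 𝓘(ℝ, E) ∞ M]
    [T2Space M] [SecondCountableTopology M]
    (Ω : ∀ x : M, TangentSpace 𝓘(ℝ, E) x [⋀^Fin 2]→L[ℝ] ℝ) (hΩ : IsSymplecticForm Ω)
    [MulAction G M]
    (μ : M → Module.Dual ℝ (GroupLieAlgebra 𝓘(ℝ, EG) G)) (hμ : IsHamiltonianAction Ω μ)
    (μN : M → Module.Dual ℝ (GroupLieAlgebra 𝓘(ℝ, EN) N))
    (hμN : ∀ x, μN x = dualRestrict EN N (μ x))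
    (c' : Module.Dual ℝ (GroupLieAlgebra 𝓘(ℝ, EG) G))
    (hc' : ∀ (g : G) (ξ : GroupLieAlgebra 𝓘(ℝ, EG) G), c' (adjointAction g ξ) = c' ξ)
    (c : Module.Dual ℝ (GroupLieAlgebra 𝓘(ℝ, EN) N)) (hc : c = dualRestrict EN N c')
    (hreg : IsRegularValue (E := E) μN c)
    (hfree : ∀ z ∈ momentumLevel μN c, DiscreteTopology (MulAction.stabilizer N z)) :
    -- `μ_N` is a momentum map for the induced action of `N`
    IsHamiltonianAction (G := N) Ω μN ∧
    -- the symplectic orbifold `M //_c N`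
    ∃ Ωc : DiffForm 2 (SymplecticQuotient E N μN c),
      IsReducedForm E N μN c Ω Ωc ∧ IsSymplecticOrbifold Ωc ∧
      -- the induced action of `G / N`
      ∃ _ : MulAction (G ⧸ N) (SymplecticQuotient E N μN c),
        (∀ (g : G) (z : momentumLevel μN c), ∃ hz : g • (z : M) ∈ momentumLevel μN c,
          (g : G ⧸ N) • symplecticQuotientMk E N μN c z =
            symplecticQuotientMk E N μN c ⟨g • (z : M), hz⟩) ∧
        -- its momentum map, the restriction of `μ - c'`
        ∃ ν : SymplecticQuotient E N μN c → Module.Dual ℝ (QuotientLieAlgebra (EG := EG) EN N),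
          IsHamiltonianQuotientAction EN N Ωc ν ∧
          ∀ (z : momentumLevel μN c) (ξ : GroupLieAlgebra 𝓘(ℝ, EG) G),
            ν (symplecticQuotientMk E N μN c z) (Submodule.Quotient.mk ξ) = μ z ξ - c' ξ := by
  subst hc
  have hNμ := hμ.restrict hN hμN
  have hc'' : ∀ (g : G) (ξ : EG), c' (adj EG g ξ) = c' ξ := hc'
  have hcN : ∀ (n : N) (ζ : EN), dualRestrict EN N c' (adj EN n ζ) = dualRestrict EN N c' ζ :=
    fun n ζ => (congrArg c' (hN.incl_adj n ζ)).trans (hc'' (n : G) (incl EN EG N ζ))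
  have : CompactSpace N := isCompact_iff_compactSpace.1 hN.isClosed.isCompact
  have := hNμ.continuousSMul
  have hfin : ∀ z, μN z = dualRestrict EN N c' → Finite (MulAction.stabilizer N z) := fun z hz => by
    have := hfree z hz
    exact finite_stabilizer_of_discreteTopology z
  have hd := hNμ.pullDescends hΩ hcN hreg hfin
  have hL := fun (g : G) z (hz : z ∈ momentumLevel μN (dualRestrict EN N c')) =>
    hμ.smul_mem_momentumLevel hN hμN hc'' g hz
  obtain ⟨ν, hν⟩ := hμ.exists_reduced_moment hN hμN hc''
  let act := symplecticQuotientMulAction E hL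
  exact ⟨hNμ, reducedForm hΩ hd, isReducedForm_reducedForm hΩ hd,
    hNμ.isSymplecticOrbifold_reducedForm hΩ hcN hreg hfin hd, act, fun g z => ⟨hL g z z.2, rfl⟩, ν,
    hμ.isHamiltonianQuotientAction hΩ hc'' hL hd (fun _ _ => rfl) hν, hν⟩

end
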